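/- **Setting.** Let $\Delta\subset\mathbb R^n$ be a nonempty open polytope with compact closure $\bar\Delta$, $\Delta=\{x:\delta_k(x)>0 \text{ for all } k\}$ with $\delta_k=h_k-c_k$, $h_k$ linear, $c_k\in\mathbb R$, where the sets $\bar\Delta\cap\{\delta_k=0\}$ are the (distinct) facets of $\Delta$. Let $\mu$ be Lebesgue measure, and let $\sigma$ be the measure on $\partial\Delta$ with $d\sigma\wedge dh_k=\pm d\mu$ on the $k$-th facet (Euclidean area divided by $|\nabla h_k|$). Put $u_o=\sum_k\delta_k\log\delta_k$, and let $\mathcal S$ be the set of continuous convex functions $u$ on $\bar\Delta$ such that $u-u_o$ is smooth on $\bar\Delta$. Let $\mathcal C_\infty$ be the set of continuous convex functions on $\bar\Delta$ that are smooth in $\Delta$, fix a point $p_o\in\Delta$, and let $\tilde{\mathcal C}=\{u\in\mathcal C_\infty: u\ge u(p_o)=0\}$ be the set of normalized functions. For $u\in\tilde{\mathcal C}$ put $\|u\|_b=\int_{\partial\Delta}u\,d\sigma$. For a smooth function $A$ on $\bar\Delta$ let $$\mathcal L_A(u)=\int_{\partial\Delta}u\,d\sigma-\int_\Delta Au\,d\mu,\qquad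 \mathcal F_A(u)=-\int_\Delta\log\det(u_{ij})\,d\mu+\mathcal L_A(u)$$ ($\mathcal F_A$ is the Mabuchi functional), where $(u_{ij})$ is the Hessian of $u$ and $\log 0=-\infty$. Assume that $\mathcal L_A(\ell)=0$ for every affine linear function $\ell$. **Theorem 4.8.** Suppose that the Abreu equation $\sum_{i,j}\frac{\partial^2 v^{ij}}{\partial x_i\partial x_j}=-A$ on $\Delta$ has a solution $v\in\mathcal S$ (that is, the Hessian of $v$ is invertible on $\Delta$ and its inverse $(v^{ij})$ satisfies the equation). Then the Mabuchi functional is proper: the integral of the positive part of $\log\det(u_{ij})$ over $\Delta$ is finite for every $u\in\tilde{\mathcal C}$, so that $\mathcal F_A(u)$ is well defined in $(-\infty,+\infty]$, and there are constants $\epsilon,C>0$ such that $$\mathcal F_A(u)\ge -C+\epsilon\int_\Delta u\,d\mu\qquad\text{for all }u\in\tilde{\mathcal C}.$$ Moreover, there are constants $\epsilon',C'>0$ such that $$\mathcal F_A(u)\ge -C'+\epsilon'\|u\|_b\qquad\text{for all }u\in\tilde{\mathcal C}.$$ -/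

import Mathlib

open MeasureTheory Set
open scoped ContDiff ENNReal

namespace ToricAbreu

/-- A bounded nonempty open polytope in `ℝⁿ`, given by finitely many linear inequalities
`h k x - c k > 0`, one for each of its facets. -/
structure OpenPolytope (n : ℕ) where
  /-- number of facets -/
  N : ℕ
  /-- the linear functions defining the facets -/
  h : Fin N → EuclideanSpace ℝ (Fin n) →L[ℝ] ℝ
  /-- the constants defining the facets -/
  c : Fin N → ℝ
  /-- the open polytope is nonempty -/
  nonempty : {x | ∀ k, 0 < h k x - c k}.Nonempty
  /-- the open polytope has compact closure -/
  bounded : Bornology.IsBounded {x | ∀ k, 0 < h k x - c k}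
  /-- each hyperplane `h k = c k` cuts out a facet, and different indices give different facets:
  some point of the closed polytope lies on this hyperplane and on no other one -/
  facet : ∀ k, ∃ x, h k x - c k = 0 ∧ ∀ j, j ≠ k → 0 < h j x - c j

noncomputable section

variable {n : ℕ}

namespace OpenPolytope

/-- The defining function `δ_k = h_k - c_k` of the `k`-th facet. -/
def delta (P : OpenPolytope n) (k : Fin P.N) (x : EuclideanSpace ℝ (Fin n)) : ℝ :=
  P.h k x - P.c k

/-- The open polytope as a set of points. -/
def interior (P : OpenPolytope n) : Set (EuclideanSpace ℝ (Fin n)) :=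
  {x | ∀ k, 0 < P.delta k x}

/-- The compact polytope, the closure of the open one. -/
def body (P : OpenPolytope n) : Set (EuclideanSpace ℝ (Fin n)) :=
  closure P.interior

/-- The `k`-th closed facet. -/
def facetSet (P : OpenPolytope n) (k : Fin P.N) : Set (EuclideanSpace ℝ (Fin n)) :=
  {x ∈ P.body | P.delta k x = 0}

/-- The measure `σ` on the boundary of the polytope with `dσ ∧ dh_k = ± dμ` on the `k`-th facet,
that is, `(n-1)`-dimensional Euclidean area divided by the length of the gradient of `h_k`. -/
def sigma (P : OpenPolytope n) : Measure (EuclideanSpace ℝ (Fin n)) :=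
  ∑ k, (ENNReal.ofReal ‖P.h k‖)⁻¹ •
    (Measure.euclideanHausdorffMeasure (n - 1)).restrict (P.facetSet k)

/-- Guillemin's function `u_o = ∑ δ_k log δ_k` (with `0 log 0 = 0` on the boundary). -/
def guillemin (P : OpenPolytope n) (x : EuclideanSpace ℝ (Fin n)) : ℝ :=
  ∑ k, P.delta k x * Real.log (P.delta k x)

end OpenPolytope

/-- The partial derivative `∂f/∂x_i`. -/
def pderiv (i : Fin n) (f : EuclideanSpace ℝ (Fin n) → ℝ) (x : EuclideanSpace ℝ (Fin n)) : ℝ :=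
  fderiv ℝ f x (EuclideanSpace.single i 1)

/-- The Hessian matrix `(u_ij)`. -/
def hess (u : EuclideanSpace ℝ (Fin n) → ℝ) (x : EuclideanSpace ℝ (Fin n)) :
    Matrix (Fin n) (Fin n) ℝ :=
  Matrix.of fun i j => pderiv i (pderiv j u) x

/-- The class `𝒮`: continuous convex functions `u` on the closed polytope such that `u - u_o` is
smooth on the closed polytope. -/
def ClassS (P : OpenPolytope n) (u : EuclideanSpace ℝ (Fin n) → ℝ) : Prop :=
  ContinuousOn u P.body ∧ ConvexOn ℝ P.body u ∧
    ContDiffOn ℝ ∞ (fun x => u x - P.guillemin x) P.body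

/-- The class `𝒞_∞`: continuous convex functions on the closed polytope which are smooth in the
interior. -/
def ClassCInfty (P : OpenPolytope n) (u : EuclideanSpace ℝ (Fin n) → ℝ) : Prop :=
  ContinuousOn u P.body ∧ ConvexOn ℝ P.body u ∧ ContDiffOn ℝ ∞ u P.interior

/-- The normalized functions in `𝒞_∞`: those with `u ≥ u(p) = 0`. -/
def ClassCTilde (P : OpenPolytope n) (p : EuclideanSpace ℝ (Fin n))
    (u : EuclideanSpace ℝ (Fin n) → ℝ) : Prop :=
  ClassCInfty P u ∧ u p = 0 ∧ ∀ x ∈ P.body, 0 ≤ u x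

/-- `v` solves the Abreu equation `∑ ∂²v^{ij}/∂x_i∂x_j = -A` in the open polytope, where
`(v^{ij})` is the inverse of the Hessian matrix, which is part of the claim. -/
def SolvesAbreu (P : OpenPolytope n) (A v : EuclideanSpace ℝ (Fin n) → ℝ) : Prop :=
  ∀ x ∈ P.interior, IsUnit (hess v x).det ∧
    ∑ i, ∑ j, pderiv i (pderiv j (fun y => (hess v y)⁻¹ i j)) x = -A x

/-- The boundary norm `‖u‖_b`, the integral of `u` over the boundary. -/
def normB (P : OpenPolytope n) (u : EuclideanSpace ℝ (Fin n) → ℝ) : ℝ :=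
  ∫ x, u x ∂P.sigma

/-- The linear functional `ℒ_A(u) = ∫_∂Δ u dσ - ∫_Δ A u dμ`. -/
def functionalL (P : OpenPolytope n) (A u : EuclideanSpace ℝ (Fin n) → ℝ) : ℝ :=
  (∫ x, u x ∂P.sigma) - ∫ x in P.interior, A x * u x

/-- `log det (u_ij)` as an extended real; it is `-∞` where the determinant of the (positive
semidefinite) Hessian vanishes. -/
def logDet (u : EuclideanSpace ℝ (Fin n) → ℝ) (x : EuclideanSpace ℝ (Fin n)) : EReal :=
  ENNReal.log (ENNReal.ofReal (hess u x).det)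

/-- The extended real `-∫_Δ log det (u_ij) dμ`, as the integral of the positive part of
`-log det (u_ij)` minus the integral of its negative part. It is `+∞` if only the former is
infinite, and `-∞` (by the convention `∞ - ∞ = -∞` of `EReal`) as soon as the latter is infinite;
hence a lower bound for it by a real number contains the claim that the integral is
well-defined in `(-∞, +∞]`. -/
def entropy (P : OpenPolytope n) (u : EuclideanSpace ℝ (Fin n) → ℝ) : EReal :=
  ((∫⁻ x in P.interior, (-logDet u x).toENNReal : ℝ≥0∞) : EReal) -
    ((∫⁻ x in P.interior, (logDet u x).toENNReal : ℝ≥0∞) : EReal)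

/-- The Mabuchi functional `ℱ_A(u) = -∫_Δ log det (u_ij) dμ + ℒ_A(u)`. -/
def mabuchi (P : OpenPolytope n) (A u : EuclideanSpace ℝ (Fin n) → ℝ) : EReal :=
  entropy P u + (functionalL P A u : EReal)

end

end ToricAbreu

/-! Write V and H for the Hessians of the solution v and of a normalized function u, and L for the
value of `functionalL` at u. Two estimates carry the theorem: the integral of tr(V⁻¹H) over the
polytope is at most L (`ClassCTilde.lintegral_trace_le`), and both the boundary norm and the
integral of u are at most a constant times L (`ClassS.exists_normB_le`). By `det_le_det_mul_exp`,
log det H ≤ n log 2 + log det V + tr(V⁻¹H)/2, and the positive part of log det V is integrable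
because det V ∏ δ_k is bounded. So the entropy is at least -C - L/2, the Mabuchi functional is at
least -C + L/2, and coercivity of L finishes the proof.

Trace estimate. Formally, integrating the Abreu equation by parts against u turns the integral of
tr(V⁻¹H) into L. To control the boundary terms, cut off by φ(E) with E = (x - p)·∇v - v
(`legendre`). This E tends to infinity at the boundary, and V⁻¹∇E = x - p, so every term containing
φ' is a radial derivative: with θ = -φ' and G = -log det V, the boundary term is the integral of
θ(E)(∂u - u ∂G), ∂ being the radial derivative (`setIntegral_abreu`). Split G = N + ∑ log δ_k +
const. The logarithms contribute the poles ∑ δ_k(p)/δ_k. The function N is nonnegative, since det V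
∏ δ_k is bounded above; no lower bound on this product near the boundary is needed. The term with ∂N
is integrated by parts once more along the rays. It then has a favourable sign away from a fixed
compact set, because ∂E = Q (`radialHess`) grows exponentially in E and φ is strictly convex where
it does not vanish (`exists_setIntegral_cut_le`). What remains tends to zero as the scale of the
cutoff grows.

In polar coordinates about p, with volume as a density over the facets, the pole term is compared
with θ(E)Q, essentially minus the derivative of φ(E) along a ray. Each ray thus contributes at most
u at its endpoint in the limit, and the integral over the facets is the boundary integral of u
(`CutData.eventually_setIntegral_poleSum_le`). All this is done for dilates of u plus 1, which are
regular up to the boundary; Fatou's lemma passes to u.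

Coercivity. On a compact subset, convexity gives 0 ≤ u ≤ ∂u, and two integrations by parts bound a
positively weighted integral of ∂u by tr(V⁻¹H) (`ClassS.exists_setIntegral_le`). On a thin shell at
the boundary, u is bounded by its boundary values, so its integral is at most a small multiple of
the boundary norm (`ClassCTilde.setIntegral_shell_le`), which is absorbed. -/

namespace ToricAbreu

/-- Points of `ℝⁿ`. -/
abbrev Vec (n : ℕ) := EuclideanSpace ℝ (Fin n)

/-! ### Partial and radial derivatives, divergence theorem with compact support -/

section Calculus

variable {n : ℕ} {Ω : Set (Vec n)} {f g : Vec n → ℝ} {x : Vec n}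

theorem contDiffOn_pderiv (hΩ : IsOpen Ω) (hf : ContDiffOn ℝ ∞ f Ω) (i : Fin n) :
    ContDiffOn ℝ ∞ (pderiv i f) Ω :=
  (hf.fderiv_of_isOpen hΩ (by simp)).clm_apply contDiffOn_const

theorem differentiableAt_of_contDiffOn (hΩ : IsOpen Ω) (hf : ContDiffOn ℝ ∞ f Ω) (hx : x ∈ Ω) :
    DifferentiableAt ℝ f x :=
  (hf.contDiffAt (hΩ.mem_nhds hx)).differentiableAt (by simp)

theorem pderiv_add (i : Fin n) (hf : DifferentiableAt ℝ f x) (hg : DifferentiableAt ℝ g x) :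
    pderiv i (fun y => f y + g y) x = pderiv i f x + pderiv i g x := by
  simp [pderiv, fderiv_fun_add hf hg]

theorem pderiv_sub (i : Fin n) (hf : DifferentiableAt ℝ f x) (hg : DifferentiableAt ℝ g x) :
    pderiv i (fun y => f y - g y) x = pderiv i f x - pderiv i g x := by
  simp [pderiv, fderiv_fun_sub hf hg]

theorem pderiv_mul (i : Fin n) (hf : DifferentiableAt ℝ f x) (hg : DifferentiableAt ℝ g x) :
    pderiv i (fun y => f y * g y) x = pderiv i f x * g x + f x * pderiv i g x := by
  simp [pderiv, fderiv_fun_mul hf hg]; ring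

theorem pderiv_sum {ι : Type*} (s : Finset ι) {F : ι → Vec n → ℝ} (i : Fin n)
    (hF : ∀ k ∈ s, DifferentiableAt ℝ (F k) x) :
    pderiv i (fun y => ∑ k ∈ s, F k y) x = ∑ k ∈ s, pderiv i (F k) x := by
  simp [pderiv, fderiv_fun_sum hF]

theorem pderiv_const (i : Fin n) (c : ℝ) : pderiv i (fun _ : Vec n => c) x = 0 := by
  simp [pderiv]

theorem pderiv_coord_sub (i j : Fin n) (p : Vec n) :
    pderiv i (fun y => y j - p j) x = if i = j then 1 else 0 := by
  have h : HasFDerivAt (fun y : Vec n => y j - p j)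
      (EuclideanSpace.proj j : Vec n →L[ℝ] ℝ) x :=
    ((EuclideanSpace.proj j : Vec n →L[ℝ] ℝ).hasFDerivAt).sub_const _
  simp [pderiv, h.fderiv, eq_comm]

theorem contDiff_coord_sub (j : Fin n) (p : Vec n) : ContDiff ℝ ∞ (fun y : Vec n => y j - p j) :=
  ((EuclideanSpace.proj j : Vec n →L[ℝ] ℝ).contDiff).sub contDiff_const

theorem pderiv_comp {φ : ℝ → ℝ} {φ' : ℝ} (i : Fin n) (hφ : HasDerivAt φ φ' (f x))
    (hf : DifferentiableAt ℝ f x) : pderiv i (fun y => φ (f y)) x = φ' * pderiv i f x := by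
  have := hφ.comp_hasFDerivAt x hf.hasFDerivAt
  simp only [pderiv]
  rw [show (fun y => φ (f y)) = φ ∘ f from rfl, this.fderiv]
  simp

theorem pderiv_congr (hΩ : IsOpen Ω) (h : EqOn f g Ω) (hx : x ∈ Ω) (i : Fin n) :
    pderiv i f x = pderiv i g x := by
  simp only [pderiv]
  rw [Filter.EventuallyEq.fderiv_eq (h.eventuallyEq_of_mem (hΩ.mem_nhds hx))]

theorem fderiv_eq_sum_pderiv (w : Vec n) : fderiv ℝ f x w = ∑ i, w i * pderiv i f x := by
  conv_lhs => rw [← (EuclideanSpace.basisFun (Fin n) ℝ).sum_repr w]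
  simp [pderiv, map_sum]

theorem pderiv_comm (hΩ : IsOpen Ω) (hf : ContDiffOn ℝ ∞ f Ω) (hx : x ∈ Ω) (i j : Fin n) :
    pderiv i (pderiv j f) x = pderiv j (pderiv i f) x := by
  have hd : DifferentiableAt ℝ (fderiv ℝ f) x :=
    ((hf.fderiv_of_isOpen hΩ (m := ∞) (by simp)).contDiffAt (hΩ.mem_nhds hx)).differentiableAt
      (by simp)
  have key : ∀ i j : Fin n, pderiv i (pderiv j f) x =
      fderiv ℝ (fderiv ℝ f) x (EuclideanSpace.single i 1) (EuclideanSpace.single j 1) := by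
    intro i j
    have := (hd.hasFDerivAt.clm_apply (hasFDerivAt_const (EuclideanSpace.single j (1:ℝ)) x))
    have h2 : pderiv i (pderiv j f) x =
        fderiv ℝ (fun y => fderiv ℝ f y (EuclideanSpace.single j 1)) x
          (EuclideanSpace.single i 1) := rfl
    rw [h2, this.fderiv]
    simp
  rw [key, key]
  exact ((hf.contDiffAt (hΩ.mem_nhds hx)).isSymmSndFDerivAt (by
    simp only [minSmoothness_of_isRCLikeNormedField]; exact ENat.LEInfty.out)).eq _ _

theorem hess_symm (hΩ : IsOpen Ω) (hf : ContDiffOn ℝ ∞ f Ω) (hx : x ∈ Ω) (i j : Fin n) :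
    hess f x i j = hess f x j i := by
  simpa [hess] using pderiv_comm hΩ hf hx i j

theorem contDiffOn_hess (hΩ : IsOpen Ω) (hf : ContDiffOn ℝ ∞ f Ω) (i j : Fin n) :
    ContDiffOn ℝ ∞ (fun y => hess f y i j) Ω := by
  simpa [hess] using contDiffOn_pderiv hΩ (contDiffOn_pderiv hΩ hf j) i

/-- Extension by zero of a `C¹` function whose support is a compact subset of an open set. -/
theorem contDiff_of_compact_support (hΩ : IsOpen Ω) {K : Set (Vec n)} (hK : IsCompact K)
    (hKΩ : K ⊆ Ω) (hf : ContDiffOn ℝ 1 f Ω) (h0 : ∀ y ∉ K, f y = 0) : ContDiff ℝ 1 f := by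
  rw [contDiff_iff_contDiffAt]
  intro y
  by_cases hy : y ∈ K
  · exact hf.contDiffAt (hΩ.mem_nhds (hKΩ hy))
  · have : f =ᶠ[nhds y] fun _ => 0 := by
      filter_upwards [hK.isClosed.isOpen_compl.mem_nhds hy] with z hz using h0 z hz
    exact contDiffAt_const.congr_of_eventuallyEq this

theorem integrableOn_of_compact_support (hΩ : IsOpen Ω) {K : Set (Vec n)} (hK : IsCompact K)
    (hKΩ : K ⊆ Ω) (hf : ContinuousOn f Ω) (h0 : ∀ y ∈ Ω, y ∉ K → f y = 0) :
    IntegrableOn f Ω := by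
  have h1 : IntegrableOn f K := (hf.mono hKΩ).integrableOn_compact hK
  have h2 : IntegrableOn f (Ω ∩ K) := h1.mono_set inter_subset_right
  have h3 : IntegrableOn f (Ω \ K) :=
    integrableOn_zero.congr_fun (fun y hy => (h0 y hy.1 hy.2).symm)
      (hΩ.measurableSet.diff hK.measurableSet)
  rw [← inter_union_sdiff Ω K]
  exact h2.union h3

theorem setIntegral_pderiv_eq_zero (hΩ : IsOpen Ω) {K : Set (Vec n)} (hK : IsCompact K)
    (hKΩ : K ⊆ Ω) (hf : ContDiffOn ℝ 1 f Ω) (h0 : ∀ y ∈ Ω, y ∉ K → f y = 0) (i : Fin n) :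
    ∫ y in Ω, pderiv i f y = 0 := by
  set F := Ω.indicator f
  have hF : EqOn f F Ω := fun y hy => (indicator_of_mem hy f).symm
  have hF0 : ∀ y ∉ K, F y = 0 := fun y hy => by
    by_cases hyΩ : y ∈ Ω
    · rw [← hF hyΩ]; exact h0 y hyΩ hy
    · exact indicator_of_notMem hyΩ f
  have hC := contDiff_of_compact_support hΩ hK hKΩ (hf.congr hF.symm) hF0
  have hz : ∀ y ∉ K, pderiv i F y = 0 := by
    intro y hy
    have : F =ᶠ[nhds y] fun _ => 0 := by
      filter_upwards [hK.isClosed.isOpen_compl.mem_nhds hy] with z hz using hF0 z hz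
    simp [pderiv, this.fderiv_eq]
  rw [setIntegral_congr_fun hΩ.measurableSet fun y hy => pderiv_congr hΩ hF hy i,
    setIntegral_eq_integral_of_forall_compl_eq_zero (fun y hy => hz y fun h => hy (hKΩ h))]
  have hsupp : HasCompactSupport F := HasCompactSupport.intro hK hF0
  have hint : Integrable F := hC.continuous.integrable_of_hasCompactSupport hsupp
  have hint' : Integrable (fun y => pderiv i F y) := by
    refine Continuous.integrable_of_hasCompactSupport ?_ (HasCompactSupport.intro hK hz)
    exact (hC.continuous_fderiv (by simp)).clm_apply continuous_const
  -- Integration by parts against the constant function 1.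
  have := integral_mul_fderiv_eq_neg_fderiv_mul_of_integrable (μ := volume) (f := fun _ => (1:ℝ))
    (g := F) (v := EuclideanSpace.single i (1:ℝ)) (by simp) (by simpa [pderiv] using hint')
    (by simpa using hint) (fun _ _ => differentiableAt_const _)
    (fun y _ => hC.differentiable (by simp) y)
  simpa [pderiv] using this

theorem setIntegral_divergence_eq_zero (hΩ : IsOpen Ω) {K : Set (Vec n)} (hK : IsCompact K)
    (hKΩ : K ⊆ Ω) {W : Fin n → Vec n → ℝ} (hW : ∀ i, ContDiffOn ℝ 1 (W i) Ω)
    (h0 : ∀ i, ∀ y ∈ Ω, y ∉ K → W i y = 0) : ∫ y in Ω, ∑ i, pderiv i (W i) y = 0 := by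
  rw [integral_finsetSum]
  · exact Finset.sum_eq_zero fun i _ => setIntegral_pderiv_eq_zero hΩ hK hKΩ (hW i) (h0 i) i
  · intro i _
    refine integrableOn_of_compact_support hΩ hK hKΩ ?_ ?_
    · exact ((hW i).continuousOn_fderiv_of_isOpen hΩ (by simp)).clm_apply continuousOn_const
    · intro y hyΩ hy
      have : W i =ᶠ[nhds y] fun _ => 0 := by
        filter_upwards [hK.isClosed.isOpen_compl.mem_nhds hy, hΩ.mem_nhds hyΩ] with z hz hzΩ
          using h0 i z hzΩ hz
      simp [pderiv, this.fderiv_eq]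

/-- The radial derivative `(x - p) · ∇f`. -/
noncomputable def radial (p : Vec n) (f : Vec n → ℝ) (x : Vec n) : ℝ := fderiv ℝ f x (x - p)

theorem radial_eq_sum (p : Vec n) : radial p f x = ∑ i, (x i - p i) * pderiv i f x := by
  simp [radial, fderiv_eq_sum_pderiv]

theorem contDiffOn_radial (hΩ : IsOpen Ω) (hf : ContDiffOn ℝ ∞ f Ω) (p : Vec n) :
    ContDiffOn ℝ ∞ (radial p f) Ω :=
  (hf.fderiv_of_isOpen hΩ (by simp)).clm_apply (contDiff_id.sub contDiff_const).contDiffOn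

theorem radial_mul (p : Vec n) (hf : DifferentiableAt ℝ f x) (hg : DifferentiableAt ℝ g x) :
    radial p (fun y => f y * g y) x = radial p f x * g x + f x * radial p g x := by
  simp [radial, fderiv_fun_mul hf hg]; ring

theorem radial_comp {φ : ℝ → ℝ} {φ' : ℝ} (p : Vec n) (hφ : HasDerivAt φ φ' (f x))
    (hf : DifferentiableAt ℝ f x) : radial p (fun y => φ (f y)) x = φ' * radial p f x := by
  have := hφ.comp_hasFDerivAt x hf.hasFDerivAt
  simp only [radial]
  rw [show (fun y => φ (f y)) = φ ∘ f from rfl, this.fderiv]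
  simp

/-- The integrand is the divergence of f(x)(x - p). -/
theorem setIntegral_radial (hΩ : IsOpen Ω) {K : Set (Vec n)} (hK : IsCompact K)
    (hKΩ : K ⊆ Ω) (hf : ContDiffOn ℝ 1 f Ω) (h0 : ∀ y ∈ Ω, y ∉ K → f y = 0) (p : Vec n) :
    ∫ y in Ω, (n * f y + radial p f y) = 0 := by
  have hW : ∀ i : Fin n, ContDiffOn ℝ 1 (fun y => f y * (y i - p i)) Ω := fun i =>
    hf.mul ((contDiff_coord_sub i p).of_le (by simp)).contDiffOn
  rw [← setIntegral_divergence_eq_zero hΩ hK hKΩ hW (by intro i y hyΩ hy; simp [h0 y hyΩ hy])]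
  refine setIntegral_congr_fun hΩ.measurableSet fun y hy => ?_
  have hd : DifferentiableAt ℝ f y := (hf.contDiffAt (hΩ.mem_nhds hy)).differentiableAt (by simp)
  have : ∀ i, pderiv i (fun y => f y * (y i - p i)) y = (y i - p i) * pderiv i f y + f y := by
    intro i
    rw [pderiv_mul i hd ((contDiff_coord_sub i p).differentiable (by simp) y), pderiv_coord_sub]
    simp; ring
  simp only [this, Finset.sum_add_distrib, radial_eq_sum]
  simp; ring

theorem pderiv_radial (hΩ : IsOpen Ω) (hf : ContDiffOn ℝ ∞ f Ω) (hx : x ∈ Ω) (p : Vec n)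
    (i : Fin n) : pderiv i (radial p f) x = pderiv i f x + ∑ j, hess f x i j * (x j - p j) := by
  rw [show radial p f = fun y => ∑ j, (y j - p j) * pderiv j f y from
      funext fun y => radial_eq_sum p]
  have hd : ∀ j, DifferentiableAt ℝ (pderiv j f) x := fun j =>
    differentiableAt_of_contDiffOn hΩ (contDiffOn_pderiv hΩ hf j) hx
  have hc : ∀ j, DifferentiableAt ℝ (fun y : Vec n => y j - p j) x := fun j =>
    (contDiff_coord_sub j p).differentiable (by simp) x
  rw [pderiv_sum _ _ fun j _ => (hc j).fun_mul (hd j)]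
  simp only [pderiv_mul i (hc _) (hd _), pderiv_coord_sub, Finset.sum_add_distrib]
  simp [hess, mul_comm]

theorem radial_radial (hΩ : IsOpen Ω) (hf : ContDiffOn ℝ ∞ f Ω) (hx : x ∈ Ω) (p : Vec n) :
    radial p (radial p f) x =
      radial p f x + ∑ i, ∑ j, (x i - p i) * hess f x i j * (x j - p j) := by
  rw [radial_eq_sum]
  simp only [pderiv_radial hΩ hf hx, mul_add, Finset.sum_add_distrib, radial_eq_sum,
    Finset.mul_sum, mul_assoc]

end Calculus

/-! ### Derivatives of determinants and inverse Hessians -/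

section MatrixCalculus

variable {n : ℕ} {Ω : Set (Vec n)} {H : Vec n → Matrix (Fin n) (Fin n) ℝ} {x : Vec n}

theorem contDiffOn_det {m : ℕ} {H : Vec n → Matrix (Fin m) (Fin m) ℝ}
    (hH : ∀ i j, ContDiffOn ℝ ∞ (fun y => H y i j) Ω) :
    ContDiffOn ℝ ∞ (fun y => (H y).det) Ω := by
  simp only [Matrix.det_apply]
  refine ContDiffOn.sum fun σ _ => ContDiffOn.const_smul _ ?_
  exact contDiffOn_prod fun i _ => hH _ _

theorem contDiffOn_matrix_inv (hH : ∀ i j, ContDiffOn ℝ ∞ (fun y => H y i j) Ω)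
    (hu : ∀ y ∈ Ω, IsUnit (H y).det) (i j : Fin n) :
    ContDiffOn ℝ ∞ (fun y => (H y)⁻¹ i j) Ω := by
  have h1 : ContDiffOn ℝ ∞ (fun y => ((H y).det)⁻¹ * (H y).adjugate i j) Ω := by
    refine ((contDiffOn_det hH).inv fun y hy => (hu y hy).ne_zero).mul ?_
    simp only [Matrix.adjugate_apply]
    refine contDiffOn_det fun a b => ?_
    by_cases h : a = j
    · simp only [h, Matrix.updateRow_self]; exact contDiffOn_const
    · simp only [Matrix.updateRow_ne h]; exact hH _ _
  refine h1.congr fun y _ => ?_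
  simp [Matrix.inv_def, Ring.inverse_eq_inv']

/-- The matrix of the partial derivatives of the entries. -/
noncomputable def pderivMatrix (k : Fin n) (H : Vec n → Matrix (Fin n) (Fin n) ℝ) (x : Vec n) :
    Matrix (Fin n) (Fin n) ℝ :=
  Matrix.of fun i j => pderiv k (fun y => H y i j) x

theorem hasDerivAt_det_add_smul {M : Matrix (Fin n) (Fin n) ℝ} (hM : IsUnit M.det)
    (B : Matrix (Fin n) (Fin n) ℝ) :
    HasDerivAt (fun r : ℝ => (M + r • B).det) (M.det * (M⁻¹ * B).trace) 0 := by
  have h1 : ∀ r : ℝ, (M + r • B).det = M.det * (1 + (M⁻¹ * B).trace * r +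
      Polynomial.eval r (1 + (Polynomial.X : Polynomial ℝ) •
        (M⁻¹ * B).map Polynomial.C).det.divX.divX * r ^ 2) := by
    intro r
    rw [← Matrix.det_one_add_smul, ← Matrix.det_mul, mul_add, mul_one, Matrix.mul_smul,
      ← Matrix.mul_assoc, Matrix.mul_nonsing_inv _ hM, Matrix.one_mul]
  simp only [h1]
  refine HasDerivAt.const_mul _ ?_
  set q := (1 + (Polynomial.X : Polynomial ℝ) • (M⁻¹ * B).map Polynomial.C).det.divX.divX
  have h2 := ((((hasDerivAt_id (0:ℝ)).const_mul (M⁻¹ * B).trace).const_add 1).add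
    ((q.hasDerivAt 0).mul ((hasDerivAt_id (0:ℝ)).pow 2)))
  refine (h2.congr_deriv ?_)
  simp

theorem pderiv_det (hd : ∀ i j, DifferentiableAt ℝ (fun y => H y i j) x)
    (hu : IsUnit (H x).det) (k : Fin n) :
    pderiv k (fun y => (H y).det) x = (H x).det * ((H x)⁻¹ * pderivMatrix k H x).trace := by
  let D : (Fin n → Fin n → ℝ) → ℝ := fun A => (Matrix.of A).det
  have hD : Differentiable ℝ D := by
    simp only [D, Matrix.det_apply, Matrix.of_apply]
    fun_prop
  let A : Vec n → (Fin n → Fin n → ℝ) := fun y i j => H y i j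
  have hA : DifferentiableAt ℝ A x :=
    differentiableAt_pi.2 fun i => differentiableAt_pi.2 fun j => hd i j
  have hcomp : (fun y => (H y).det) = D ∘ A := rfl
  let B : Fin n → Fin n → ℝ := fun i j => pderiv k (fun y => H y i j) x
  have hAB : fderiv ℝ A x (EuclideanSpace.single k 1) = B := by
    ext i j
    have h1 := fderiv_pi (𝕜 := ℝ) (x := x) (φ := fun i y => A y i)
      (fun i => differentiableAt_pi.1 hA i)
    have h2 := fderiv_pi (𝕜 := ℝ) (x := x) (φ := fun j y => A y i j) (fun j => hd i j)
    change fderiv ℝ (fun y i => A y i) x (EuclideanSpace.single k 1) i j = _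
    rw [h1]
    change fderiv ℝ (fun y j => A y i j) x (EuclideanSpace.single k 1) j = _
    rw [h2]
    rfl
  have hline : HasDerivAt (fun r : ℝ => A x + r • B) B 0 := by
    simpa using ((hasDerivAt_id (0:ℝ)).smul_const B).const_add (A x)
  have h3 : HasDerivAt (fun r : ℝ => D (A x + r • B)) (fderiv ℝ D (A x) B) 0 := by
    have := HasFDerivAt.comp_hasDerivAt (x := (0:ℝ)) (f := fun r : ℝ => A x + r • B) (l := D)
      (l' := fderiv ℝ D (A x)) (by simpa using (hD (A x)).hasFDerivAt) hline
    exact this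
  have h4 := hasDerivAt_det_add_smul hu (pderivMatrix k H x)
  have h5 := h3.unique h4
  rw [pderiv, hcomp, fderiv_comp _ (hD _) hA]
  simp only [ContinuousLinearMap.comp_apply, hAB]
  exact h5

/-- Differentiate the identity H⁻¹H = 1. -/
theorem pderiv_matrix_inv (hΩ : IsOpen Ω) (hH : ∀ i j, ContDiffOn ℝ ∞ (fun y => H y i j) Ω)
    (hu : ∀ y ∈ Ω, IsUnit (H y).det) (hx : x ∈ Ω) (k : Fin n) :
    pderivMatrix k (fun y => (H y)⁻¹) x =
      -((H x)⁻¹ * pderivMatrix k H x * (H x)⁻¹) := by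
  have h1 : pderivMatrix k (fun y => (H y)⁻¹) x * H x + (H x)⁻¹ * pderivMatrix k H x = 0 := by
    ext i j
    have h2 : pderiv k (fun y => ∑ a, (H y)⁻¹ i a * H y a j) x = 0 := by
      rw [pderiv_congr (g := fun _ => (1 : Matrix (Fin n) (Fin n) ℝ) i j) hΩ ?_ hx, pderiv_const]
      intro y hy
      simp only
      rw [← Matrix.mul_apply, Matrix.nonsing_inv_mul _ (hu y hy)]
    have hd1 : ∀ i j, DifferentiableAt ℝ (fun y => H y i j) x := fun i j =>
      differentiableAt_of_contDiffOn hΩ (hH i j) hx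
    have hd2 : ∀ i j, DifferentiableAt ℝ (fun y => (H y)⁻¹ i j) x := fun i j =>
      differentiableAt_of_contDiffOn hΩ (contDiffOn_matrix_inv hH hu i j) hx
    rw [pderiv_sum _ _ fun a _ => (hd2 _ _).fun_mul (hd1 _ _)] at h2
    simp only [pderiv_mul k (hd2 _ _) (hd1 _ _), Finset.sum_add_distrib] at h2
    simpa [Matrix.mul_apply, pderivMatrix] using h2
  have h3 := congrArg (· * (H x)⁻¹) (eq_neg_of_add_eq_zero_left h1)
  simpa [Matrix.mul_assoc, Matrix.mul_nonsing_inv _ (hu x hx)] using h3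

variable {v : Vec n → ℝ}

theorem contDiffOn_inv_hess (hΩ : IsOpen Ω) (hv : ContDiffOn ℝ ∞ v Ω)
    (hu : ∀ y ∈ Ω, IsUnit (hess v y).det) (i j : Fin n) :
    ContDiffOn ℝ ∞ (fun y => (hess v y)⁻¹ i j) Ω :=
  contDiffOn_matrix_inv (contDiffOn_hess hΩ hv) hu i j

theorem inv_hess_symm (hΩ : IsOpen Ω) (hv : ContDiffOn ℝ ∞ v Ω) (hx : x ∈ Ω) (i j : Fin n) :
    (hess v x)⁻¹ i j = (hess v x)⁻¹ j i := by
  have : (hess v x).transpose = hess v x := by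
    ext i j; simpa using hess_symm hΩ hv hx j i
  conv_lhs => rw [← this, ← Matrix.transpose_nonsing_inv]
  rfl

/-- The divergence of the inverse Hessian is the metric gradient of `-log det`. -/
theorem divergence_inv_hess (hΩ : IsOpen Ω) (hv : ContDiffOn ℝ ∞ v Ω)
    (hu : ∀ y ∈ Ω, IsUnit (hess v y).det) (hx : x ∈ Ω) (i : Fin n) :
    ∑ j, pderiv j (fun y => (hess v y)⁻¹ i j) x =
      ∑ j, (hess v x)⁻¹ i j * pderiv j (fun y => -Real.log (hess v y).det) x := by
  have hH := contDiffOn_hess hΩ hv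
  have hd1 : ∀ i j, DifferentiableAt ℝ (fun y => hess v y i j) x := fun i j =>
    differentiableAt_of_contDiffOn hΩ (hH i j) hx
  have hdet : DifferentiableAt ℝ (fun y => (hess v y).det) x :=
    differentiableAt_of_contDiffOn hΩ (contDiffOn_det hH) hx
  have hG : ∀ j, pderiv j (fun y => -Real.log (hess v y).det) x =
      -((hess v x)⁻¹ * pderivMatrix j (hess v) x).trace := by
    intro j
    have hne := (hu x hx).ne_zero
    rw [pderiv_comp (φ := fun t => -Real.log t) j (Real.hasDerivAt_log hne).neg hdet,
      pderiv_det hd1 (hu x hx)]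
    field_simp
  have hW : ∀ j, pderiv j (fun y => (hess v y)⁻¹ i j) x =
      -((hess v x)⁻¹ * pderivMatrix j (hess v) x * (hess v x)⁻¹) i j := by
    intro j
    have := congrFun (congrFun (pderiv_matrix_inv hΩ hH hu hx j) i) j
    simpa [pderivMatrix] using this
  -- Third derivatives are totally symmetric; this is what makes the divergence of V⁻¹ a contraction
  -- of the gradient of log det V.
  have hsym : ∀ a b j, pderivMatrix j (hess v) x a b = pderivMatrix a (hess v) x j b := by
    intro a b j
    simp only [pderivMatrix, Matrix.of_apply, hess]
    exact pderiv_comm hΩ (contDiffOn_pderiv hΩ hv b) hx j a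
  simp only [hG, hW, mul_neg, Finset.sum_neg_distrib, neg_inj]
  simp only [Matrix.mul_assoc]
  simp only [Matrix.mul_apply, Matrix.trace, Matrix.diag]
  rw [Finset.sum_comm]
  refine Finset.sum_congr rfl fun a _ => ?_
  rw [← Finset.mul_sum, Finset.sum_comm]
  congr 1
  refine Finset.sum_congr rfl fun b _ => Finset.sum_congr rfl fun j _ => ?_
  rw [hsym a b j]; ring

end MatrixCalculus

/-! ### Trace and determinant inequalities for positive semidefinite matrices -/

section PosSemidefMatrices

variable {n : ℕ}

open scoped Matrix in
theorem exists_symm_sqrt {A : Matrix (Fin n) (Fin n) ℝ} (hA : A.PosSemidef) :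
    ∃ R : Matrix (Fin n) (Fin n) ℝ, Rᵀ = R ∧ R * R = A := by
  have h := hA.1.spectral_theorem
  set U : Matrix (Fin n) (Fin n) ℝ := (hA.1.eigenvectorUnitary : Matrix (Fin n) (Fin n) ℝ)
  have hU : star U * U = 1 := Unitary.coe_star_mul_self hA.1.eigenvectorUnitary
  refine ⟨U * Matrix.diagonal (fun i => Real.sqrt (hA.1.eigenvalues i)) * star U, ?_, ?_⟩
  · simp [Matrix.star_eq_conjTranspose, Matrix.transpose_mul, Matrix.mul_assoc]
  · conv_rhs => rw [h]
    simp only [Unitary.conjStarAlgAut_apply]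
    calc _ = U * (Matrix.diagonal (fun i => Real.sqrt (hA.1.eigenvalues i)) * ((star U * U) *
          Matrix.diagonal (fun i => Real.sqrt (hA.1.eigenvalues i)))) * star U := by
          simp only [Matrix.mul_assoc]
      _ = _ := by
          rw [hU, Matrix.one_mul, Matrix.diagonal_mul_diagonal]
          have hd : (fun i => Real.sqrt (hA.1.eigenvalues i) * Real.sqrt (hA.1.eigenvalues i)) =
              hA.1.eigenvalues := by
            ext i
            exact Real.mul_self_sqrt (hA.eigenvalues_nonneg i)
          rw [hd]
          rfl

open scoped Matrix in
theorem trace_transpose_mul_self_eq (A : Matrix (Fin n) (Fin n) ℝ) :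
    (Aᵀ * A).trace = ∑ i, ∑ j, A j i ^ 2 := by
  simp [Matrix.trace, Matrix.mul_apply, sq]

open scoped Matrix in
theorem trace_transpose_mul_self_mul_le (A B : Matrix (Fin n) (Fin n) ℝ) :
    ((A * B)ᵀ * (A * B)).trace ≤ (Aᵀ * A).trace * (Bᵀ * B).trace := by
  simp only [trace_transpose_mul_self_eq, Matrix.mul_apply]
  rw [Finset.sum_comm, Finset.sum_comm (f := fun i j => A j i ^ 2), Finset.sum_mul]
  refine Finset.sum_le_sum fun i _ => ?_
  rw [Finset.mul_sum]
  exact Finset.sum_le_sum fun j _ => Finset.sum_mul_sq_le_sq_mul_sq _ _ _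

open scoped Matrix in
-- With square roots R of V and T of H, tr(V⁻¹H) is the squared Frobenius norm of TR⁻¹. This
-- replaces simultaneous diagonalization in the inequalities below.
theorem PosDef.exists_conj {V H : Matrix (Fin n) (Fin n) ℝ} (hV : V.PosDef)
    (hH : H.PosSemidef) : ∃ R T : Matrix (Fin n) (Fin n) ℝ, Rᵀ = R ∧ Tᵀ = T ∧ R * R = V ∧
      T * T = H ∧ IsUnit R.det ∧ (V⁻¹ * H).trace = ((T * R⁻¹)ᵀ * (T * R⁻¹)).trace := by
  obtain ⟨R, hR, hRV⟩ := exists_symm_sqrt hV.posSemidef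
  obtain ⟨T, hT, hTH⟩ := exists_symm_sqrt hH
  have hu : IsUnit R.det := by
    have h1 : IsUnit V.det := (Matrix.isUnit_iff_isUnit_det V).1 hV.isUnit
    rw [← hRV, Matrix.det_mul] at h1
    exact isUnit_of_mul_isUnit_left h1
  refine ⟨R, T, hR, hT, hRV, hTH, hu, ?_⟩
  rw [Matrix.transpose_mul, Matrix.transpose_nonsing_inv, hR, hT, ← hRV, ← hTH,
    Matrix.mul_inv_rev, ← Matrix.mul_assoc, Matrix.trace_mul_comm]
  simp only [← Matrix.mul_assoc]
  rw [Matrix.trace_mul_comm]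
  simp only [← Matrix.mul_assoc]
  rw [Matrix.trace_mul_comm]
  simp only [← Matrix.mul_assoc]

theorem trace_inv_mul_nonneg {V H : Matrix (Fin n) (Fin n) ℝ} (hV : V.PosDef)
    (hH : H.PosSemidef) : 0 ≤ (V⁻¹ * H).trace := by
  obtain ⟨R, T, -, -, -, -, -, h⟩ := PosDef.exists_conj hV hH
  rw [h, trace_transpose_mul_self_eq]
  positivity

/-- Submultiplicativity of the Frobenius norm applied to T = (TR⁻¹)R. -/
theorem trace_le_trace_mul_trace_inv_mul {V H : Matrix (Fin n) (Fin n) ℝ} (hV : V.PosDef)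
    (hH : H.PosSemidef) : H.trace ≤ V.trace * (V⁻¹ * H).trace := by
  obtain ⟨R, T, hR, hT, hRV, hTH, hu, h⟩ := PosDef.exists_conj hV hH
  have h1 := trace_transpose_mul_self_mul_le (T * R⁻¹) R
  rw [Matrix.mul_assoc T, Matrix.nonsing_inv_mul _ hu, Matrix.mul_one, hT, hTH, hR, hRV] at h1
  rw [h]; linarith

theorem det_le_exp_trace {B : Matrix (Fin n) (Fin n) ℝ} (hB : B.PosSemidef) :
    B.det ≤ Real.exp B.trace := by
  rw [hB.1.det_eq_prod_eigenvalues, hB.1.trace_eq_sum_eigenvalues, Real.exp_sum]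
  refine Finset.prod_le_prod (fun i _ => ?_) fun i _ => ?_
  · simpa using hB.eigenvalues_nonneg i
  · have := Real.add_one_le_exp (hB.1.eigenvalues i)
    simp only [RCLike.ofReal_real_eq_id, id_eq]
    linarith

open scoped Matrix in
-- Apply `det_le_exp_trace` to half of the conjugate of H by R⁻¹. The half costs the factor 2ⁿ and
-- leaves half of the trace, hence half of the linear functional, available for properness.
theorem det_le_det_mul_exp {V H : Matrix (Fin n) (Fin n) ℝ} (hV : V.PosDef)
    (hH : H.PosSemidef) :
    H.det ≤ 2 ^ n * V.det * Real.exp ((V⁻¹ * H).trace / 2) := by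
  obtain ⟨R, T, hR, hT, hRV, hTH, hu, h⟩ := PosDef.exists_conj hV hH
  set B := (1 / 2 : ℝ) • ((T * R⁻¹)ᵀ * (T * R⁻¹))
  have hB : B.PosSemidef := by
    have := Matrix.posSemidef_conjTranspose_mul_self (T * R⁻¹)
    rw [Matrix.conjTranspose_eq_transpose_of_trivial] at this
    exact this.smul (by norm_num)
  have h1 := det_le_exp_trace hB
  have h2 : B.trace = (V⁻¹ * H).trace / 2 := by
    rw [h, Matrix.trace_smul, smul_eq_mul]; ring
  have h3 : H.det = 2 ^ n * V.det * B.det := by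
    have hr : R.det ≠ 0 := hu.ne_zero
    simp only [B, Matrix.det_smul, Matrix.det_mul, Matrix.det_transpose, Matrix.det_nonsing_inv,
      ← hRV, ← hTH, Ring.inverse_eq_inv', Fintype.card_fin]
    field_simp
    rw [one_div, mul_assoc, ← mul_pow]
    norm_num
  rw [h3, ← h2]
  exact mul_le_mul_of_nonneg_left h1
    (mul_nonneg (by positivity) hV.det_pos.le)

theorem quadratic_form_nonneg {H : Matrix (Fin n) (Fin n) ℝ} (hH : H.PosSemidef) (w : Fin n → ℝ) :
    0 ≤ ∑ i, ∑ j, w i * H i j * w j := by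
  have := hH.dotProduct_mulVec_nonneg w
  simpa [dotProduct, Matrix.mulVec, Finset.mul_sum, mul_assoc] using this

/-- With T a symmetric square root of H, the left side is |Tw|², and Cauchy–Schwarz is applied row
by row. -/
theorem quadratic_form_le_trace {H : Matrix (Fin n) (Fin n) ℝ} (hH : H.PosSemidef)
    (w : Fin n → ℝ) : ∑ i, ∑ j, w i * H i j * w j ≤ H.trace * ∑ i, w i ^ 2 := by
  obtain ⟨T, hT, hTH⟩ := exists_symm_sqrt hH
  have hs : ∀ i j, T i j = T j i := fun i j => by
    conv_lhs => rw [← hT]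
    rfl
  have h1 : ∑ i, ∑ j, w i * H i j * w j = ∑ k, (∑ i, T k i * w i) ^ 2 := by
    simp only [← hTH, Matrix.mul_apply, sq, Finset.sum_mul_sum]
    simp only [Finset.mul_sum, Finset.sum_mul]
    rw [Finset.sum_comm' (s := Finset.univ) (t := fun _ => Finset.univ)
      (t' := Finset.univ) (s' := fun _ => Finset.univ) (by simp)]
    have : ∀ f : Fin n → Fin n → Fin n → ℝ, ∑ i, ∑ j, ∑ k, f i j k = ∑ k, ∑ j, ∑ i, f i j k := by
      intro f
      rw [Finset.sum_comm]
      rw [Finset.sum_congr rfl fun j _ => Finset.sum_comm]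
      rw [Finset.sum_comm]
    rw [this]
    refine Finset.sum_congr rfl fun k _ => Finset.sum_congr rfl fun i _ =>
      Finset.sum_congr rfl fun j _ => ?_
    rw [hs i k]; ring
  rw [h1, show H.trace = ∑ k, ∑ i, T k i ^ 2 by
    rw [← hTH]; conv_lhs => rw [← hT]
    rw [hT, show T * T = T.transpose * T by rw [hT], trace_transpose_mul_self_eq, Finset.sum_comm],
    Finset.sum_mul]
  exact Finset.sum_le_sum fun k _ => Finset.sum_mul_sq_le_sq_mul_sq _ _ _

theorem trace_mul_eq_sum {A H : Matrix (Fin n) (Fin n) ℝ} (hH : ∀ i j, H i j = H j i) :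
    (A * H).trace = ∑ i, ∑ j, A i j * H i j := by
  simp only [Matrix.trace, Matrix.diag, Matrix.mul_apply]
  exact Finset.sum_congr rfl fun i _ => Finset.sum_congr rfl fun j _ => by rw [hH]

end PosSemidefMatrices

/-! ### Gradient inequality and Hessians of convex functions -/

section Convexity

variable {n : ℕ} {S Ω : Set (Vec n)} {f : Vec n → ℝ} {x y : Vec n}

/-- The gradient inequality for convex functions. -/
theorem add_fderiv_le_of_convexOn (hf : ConvexOn ℝ S f) (hx : x ∈ S) (hy : y ∈ S)
    (hd : DifferentiableAt ℝ f x) : f x + fderiv ℝ f x (y - x) ≤ f y := by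
  have hg : ConvexOn ℝ (AffineMap.lineMap (k := ℝ) x y ⁻¹' S)
      (f ∘ AffineMap.lineMap (k := ℝ) x y) := hf.comp_affineMap _
  have h1 : HasDerivAt (f ∘ AffineMap.lineMap (k := ℝ) x y) (fderiv ℝ f x (y - x)) 0 := by
    have h2 : HasDerivAt (AffineMap.lineMap (k := ℝ) x y) (y - x) (0:ℝ) := by
      simpa using (AffineMap.lineMap (k := ℝ) x y).hasDerivAt (x := (0:ℝ))
    refine HasFDerivAt.comp_hasDerivAt (0:ℝ) ?_ h2
    simpa using hd.hasFDerivAt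
  have := hg.le_slope_of_hasDerivAt (x := 0) (y := 1) (by simpa using hx) (by simpa using hy)
    one_pos h1
  simp [slope_def_field] at this
  rw [map_sub]
  linarith

/-- Adding the gradient inequalities at x and at x + te shows that the directional derivative along
e is monotone; the difference quotients converge to the quadratic form of the Hessian. -/
theorem hess_posSemidef_of_convexOn (hΩ : IsOpen Ω) (hc : ConvexOn ℝ Ω f)
    (hf : ContDiffOn ℝ ∞ f Ω) (hx : x ∈ Ω) : (hess f x).PosSemidef := by
  refine Matrix.PosSemidef.of_dotProduct_mulVec_nonneg ?_ ?_
  · ext i j; simpa using hess_symm hΩ hf hx j i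
  intro w
  have hw : star w ⬝ᵥ (hess f x).mulVec w = ∑ i, ∑ j, w i * hess f x i j * w j := by
    simp [dotProduct, Matrix.mulVec, Finset.mul_sum, mul_assoc]
  rw [hw]
  set e : Vec n := WithLp.toLp 2 w
  set D : Vec n → ℝ := fun z => ∑ j, w j * pderiv j f z
  have hDd : HasDerivAt (fun t : ℝ => D (x + t • e)) (∑ i, ∑ j, w i * hess f x i j * w j) 0 := by
    have h1 : ∀ j, DifferentiableAt ℝ (pderiv j f) x := fun j =>
      differentiableAt_of_contDiffOn hΩ (contDiffOn_pderiv hΩ hf j) hx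
    have h2 : DifferentiableAt ℝ D x := by
      simp only [D]
      exact DifferentiableAt.fun_sum fun j _ => (h1 j).const_mul _
    have h3 : HasDerivAt (fun t : ℝ => x + t • e) e 0 := by
      simpa using ((hasDerivAt_id (0:ℝ)).smul_const e).const_add x
    have h4 := HasFDerivAt.comp_hasDerivAt (x := (0:ℝ)) (f := fun t : ℝ => x + t • e) (l := D)
      (l' := fderiv ℝ D x) (by simpa using h2.hasFDerivAt) h3
    refine h4.congr_deriv ?_
    rw [fderiv_eq_sum_pderiv]
    refine Finset.sum_congr rfl fun i _ => ?_
    have h5 : pderiv i D x = ∑ j, w j * hess f x i j := by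
      simp only [D]
      rw [pderiv_sum _ _ fun j _ => (h1 j).const_mul _]
      refine Finset.sum_congr rfl fun j _ => ?_
      rw [pderiv_mul i (differentiableAt_const _) (h1 j), pderiv_const]
      simp [hess]
    rw [h5, Finset.mul_sum]
    exact Finset.sum_congr rfl fun j _ => by simp [e]; ring
  have hmem : ∀ᶠ t : ℝ in nhdsWithin 0 (Ioi 0), x + t • e ∈ Ω := by
    have : Filter.Tendsto (fun t : ℝ => x + t • e) (nhdsWithin 0 (Ioi 0)) (nhds x) := by
      have : Continuous fun t : ℝ => x + t • e := by fun_prop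
      simpa using (this.tendsto 0).mono_left nhdsWithin_le_nhds
    exact this (hΩ.mem_nhds hx)
  have hslope := (hasDerivAt_iff_tendsto_slope.1 hDd).mono_left
    (nhdsWithin_mono 0 (show Ioi (0:ℝ) ⊆ {0}ᶜ from fun t ht => ne_of_gt ht))
  refine ge_of_tendsto hslope ?_
  filter_upwards [hmem, self_mem_nhdsWithin] with t ht htp
  have htp : 0 < t := htp
  have hD : ∀ z, D z = fderiv ℝ f z e := fun z => by simp [D, fderiv_eq_sum_pderiv, e]
  have h1 := add_fderiv_le_of_convexOn hc hx ht (differentiableAt_of_contDiffOn hΩ hf hx)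
  have h2 := add_fderiv_le_of_convexOn hc ht hx (differentiableAt_of_contDiffOn hΩ hf ht)
  simp only [add_sub_cancel_left, sub_add_cancel_left, map_neg, map_smul, smul_eq_mul] at h1 h2
  simp only [slope_def_field, hD, zero_smul, add_zero, sub_zero]
  have : 0 ≤ t * (fderiv ℝ f (x + t • e) e - fderiv ℝ f x e) := by linarith
  have := nonneg_of_mul_nonneg_right this htp
  positivity

end Convexity

/-! ### Geometry of the polytope and slicing by hyperplanes parallel to a facet -/

namespace OpenPolytope

variable {n : ℕ} (P : OpenPolytope n) {p x z : Vec n}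

theorem delta_ray (k : Fin P.N) (p z : Vec n) (s : ℝ) :
    P.delta k (p + s • (z - p)) = (1 - s) * P.delta k p + s * P.delta k z := by
  simp [delta]; ring

theorem continuous_delta (k : Fin P.N) : Continuous (P.delta k) := by
  unfold delta; fun_prop

theorem isOpen_interior : IsOpen P.interior := by
  have : P.interior = ⋂ k, {x | 0 < P.delta k x} := by ext; simp [interior]
  rw [this]
  exact isOpen_iInter_of_finite fun k => isOpen_lt continuous_const (P.continuous_delta k)

theorem interior_subset_body : P.interior ⊆ P.body := subset_closure

theorem delta_nonneg (hx : x ∈ P.body) (k : Fin P.N) : 0 ≤ P.delta k x := by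
  have : P.body ⊆ {x | 0 ≤ P.delta k x} :=
    closure_minimal (fun y hy => (hy k).le) (isClosed_le continuous_const (P.continuous_delta k))
  exact this hx

theorem ray_mem_interior_of_nonneg (hp : p ∈ P.interior) (hz : ∀ k, 0 ≤ P.delta k z) {s : ℝ}
    (h0 : 0 ≤ s) (h1 : s < 1) : p + s • (z - p) ∈ P.interior := by
  intro k
  rw [delta_ray]
  have := mul_pos (sub_pos.2 h1) (hp k)
  have := mul_nonneg h0 (hz k)
  linarith

theorem ray_mem_interior (hp : p ∈ P.interior) (hz : z ∈ P.body) {s : ℝ}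
    (h0 : 0 ≤ s) (h1 : s < 1) : p + s • (z - p) ∈ P.interior :=
  P.ray_mem_interior_of_nonneg hp (P.delta_nonneg hz) h0 h1

theorem mem_body_iff (hp : p ∈ P.interior) : x ∈ P.body ↔ ∀ k, 0 ≤ P.delta k x := by
  refine ⟨fun h k => P.delta_nonneg h k, fun h => ?_⟩
  have hc : Filter.Tendsto (fun s : ℝ => p + s • (x - p)) (nhdsWithin 1 (Iio 1)) (nhds x) := by
    have : Continuous fun s : ℝ => p + s • (x - p) := by fun_prop
    simpa using (this.tendsto 1).mono_left nhdsWithin_le_nhds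
  refine mem_closure_of_tendsto hc ?_
  filter_upwards [Ioo_mem_nhdsLT (show (0:ℝ) < 1 by norm_num)] with s hs
  exact P.ray_mem_interior_of_nonneg hp h hs.1.le hs.2

theorem isBounded_interior : Bornology.IsBounded P.interior := P.bounded

theorem isCompact_body : IsCompact P.body := P.isBounded_interior.isCompact_closure

theorem convex_interior : Convex ℝ P.interior := by
  have : P.interior = ⋂ k, {x | P.c k < P.h k x} := by ext; simp [interior, delta]
  rw [this]
  exact convex_iInter fun k => convex_halfSpace_gt (P.h k).isLinear _

theorem convex_body : Convex ℝ P.body := P.convex_interior.closure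

theorem ray_mem_body (hp : p ∈ P.interior) (hz : z ∈ P.body) {s : ℝ}
    (h0 : 0 ≤ s) (h1 : s ≤ 1) : p + s • (z - p) ∈ P.body := by
  have := P.convex_body.add_smul_sub_mem (P.interior_subset_body hp) hz ⟨h0, h1⟩
  simpa using this

theorem h_ne_zero (hp : p ∈ P.interior) (k : Fin P.N) : P.h k ≠ 0 := by
  intro h
  obtain ⟨x, hx, -⟩ := P.facet k
  have := hp k
  simp [delta, h] at this hx
  linarith

/-- The part of `σ` on the `k`-th facet. -/
noncomputable def sigmaFacet (k : Fin P.N) : Measure (Vec n) :=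
  (ENNReal.ofReal ‖P.h k‖)⁻¹ •
    (Measure.euclideanHausdorffMeasure (n - 1)).restrict (P.facetSet k)

theorem sigma_eq_sum : P.sigma = ∑ k, P.sigmaFacet k := rfl

theorem isCompact_facetSet (k : Fin P.N) : IsCompact (P.facetSet k) :=
  P.isCompact_body.inter_right (isClosed_eq (P.continuous_delta k) continuous_const)

theorem measurableSet_facetSet (k : Fin P.N) : MeasurableSet (P.facetSet k) :=
  (P.isCompact_facetSet k).measurableSet

/-- The parameter along the rays from `p`, with value `1` on the `k`-th hyperplane. -/
noncomputable def level (k : Fin P.N) (p x : Vec n) : ℝ := 1 - P.delta k x / P.delta k p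

theorem level_ray (hp : p ∈ P.interior) (k : Fin P.N) (hz : P.delta k z = 0) (s : ℝ) :
    P.level k p (p + s • (z - p)) = s := by
  have := (hp k).ne'
  rw [level, delta_ray, hz]; field_simp; ring

/-- The cone with apex `p` over a subset `B` of the `k`-th hyperplane. -/
def coneOver (k : Fin P.N) (p : Vec n) (B : Set (Vec n)) : Set (Vec n) :=
  {x | P.level k p x ∈ Ioo 0 1 ∧ p + (P.level k p x)⁻¹ • (x - p) ∈ B}

theorem ray_mem_coneOver_iff (hp : p ∈ P.interior) (k : Fin P.N) (hz : P.delta k z = 0) {s : ℝ}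
    (hs : s ∈ Ioo (0:ℝ) 1) (B : Set (Vec n)) :
    p + s • (z - p) ∈ P.coneOver k p B ↔ z ∈ B := by
  simp only [coneOver, mem_ofPred_eq, P.level_ray hp k hz, hs, true_and, add_sub_cancel_left,
    smul_smul, inv_mul_cancel₀ hs.1.ne', one_smul, add_sub_cancel]

theorem measurableSet_coneOver (k : Fin P.N) (p : Vec n) {B : Set (Vec n)}
    (hB : MeasurableSet B) : MeasurableSet (P.coneOver k p B) := by
  have h1 : Measurable (P.level k p) := by
    unfold level
    exact ((P.continuous_delta k).measurable.div_const _).const_sub 1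
  exact (h1 measurableSet_Ioo).inter
    ((measurable_const.add (h1.inv.smul (measurable_id.sub measurable_const))) hB)

/-- Polar coordinates with respect to the `k`-th hyperplane, for sets. -/
theorem volume_eq_lintegral_hyperplane (hp : p ∈ P.interior) (k : Fin P.N)
    {t : Set (Vec n)} (ht : MeasurableSet t) (hts : ∀ x ∈ t, P.level k p x ∈ Ioo (0:ℝ) 1) :
    volume t = ENNReal.ofReal (P.delta k p) * ((ENNReal.ofReal ‖P.h k‖)⁻¹ *
      ∫⁻ s in Ioo (0:ℝ) 1, ENNReal.ofReal (s ^ (n - 1)) *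
        Measure.euclideanHausdorffMeasure (n - 1)
          {z | P.delta k z = 0 ∧ p + s • (z - p) ∈ t}) := by
  have hd := hp k
  have hne := P.h_ne_zero hp k
  set g := (InnerProductSpace.toDual ℝ (Vec n)).symm (P.h k) with hg
  have hgi : ∀ y, inner ℝ g y = P.h k y := fun y => InnerProductSpace.toDual_symm_apply
  have hgn : ‖g‖ = ‖P.h k‖ := by rw [hg, LinearIsometryEquiv.norm_map]
  have hpos : 0 < ‖P.h k‖ := norm_pos_iff.2 hne
  have hgg : P.h k g = ‖P.h k‖ ^ 2 := by rw [← hgi, real_inner_self_eq_norm_sq, hgn]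
  -- The normal vector scaled so that the hyperplane through p + s v orthogonal to v is exactly the
  -- set where the level is s. Its length δ_k(p)/‖h_k‖ is the Jacobian factor.
  set v : Vec n := (-(P.delta k p / ‖P.h k‖ ^ 2)) • g with hv
  have hc : -(P.delta k p / ‖P.h k‖ ^ 2) ≠ 0 := by
    simp only [ne_eq, neg_eq_zero]; positivity
  have hg0 : g ≠ 0 := by rw [← norm_pos_iff, hgn]; exact hpos
  have hv0 : v ≠ 0 := smul_ne_zero hc hg0
  have hhv : P.h k v = -P.delta k p := by
    rw [hv, map_smul, hgg, smul_eq_mul]; field_simp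
  have hvn : ‖v‖ₑ = ENNReal.ofReal (P.delta k p) * (ENNReal.ofReal ‖P.h k‖)⁻¹ := by
    rw [← ENNReal.ofReal_inv_of_pos hpos, ← ENNReal.ofReal_mul hd.le, ← ofReal_norm]
    congr 1
    rw [hv, norm_smul, hgn, norm_neg, Real.norm_of_nonneg (by positivity)]
    field_simp
  have hslice : ∀ s : ℝ, (AffineSubspace.mk' (s • v +ᵥ p) (Submodule.span ℝ {v})ᗮ : Set (Vec n)) =
      {y | P.level k p y = s} := by
    intro s
    ext y
    simp only [SetLike.mem_coe, AffineSubspace.mem_mk', Submodule.mem_orthogonal_singleton_iff_inner_right,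
      mem_ofPred_eq, vsub_eq_sub, vadd_eq_add]
    rw [hv, real_inner_smul_left, hgi, ← hv, mul_eq_zero, or_iff_right hc]
    simp only [map_sub, map_add, map_smul, hhv, smul_eq_mul, level]
    have : P.h k y = P.delta k y + P.c k := by simp [delta]
    have h2 : P.h k p = P.delta k p + P.c k := by simp [delta]
    rw [this, h2]
    constructor
    · intro h
      field_simp; linarith
    · intro h
      field_simp at h; linarith
  have key := EuclideanGeometry.euclideanHausdorffMeasure_eq_lintegral p hv0 ht
  rw [InnerProductSpace.euclideanHausdorffMeasure_eq_volume] at key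
  rw [key, hvn, mul_assoc]
  congr 2
  rw [← setLIntegral_eq_of_support_subset (s := Ioo (0:ℝ) 1)]
  · refine setLIntegral_congr_fun measurableSet_Ioo fun s hs => ?_
    simp only
    rw [finrank_euclideanSpace_fin, hslice]
    -- Each slice is the homothetic image, with ratio s and centre p, of a subset of the facet
    -- hyperplane; this scales the area by s to the power n - 1.
    have himg : t ∩ {y | P.level k p y = s} = AffineMap.homothety p s ''
        {z | P.delta k z = 0 ∧ p + s • (z - p) ∈ t} := by
      ext y
      simp only [mem_inter_iff, mem_ofPred_eq, mem_image, AffineMap.homothety_apply, vsub_eq_sub,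
        vadd_eq_add]
      constructor
      · rintro ⟨hyt, hys⟩
        refine ⟨p + s⁻¹ • (y - p), ⟨?_, ?_⟩, ?_⟩
        · rw [delta_ray]
          have : P.delta k y = (1 - s) * P.delta k p := by
            rw [← hys, level]; field_simp; ring
          rw [this]
          have := hs.1.ne'
          field_simp; ring
        · simpa [smul_smul, mul_inv_cancel₀ hs.1.ne'] using hyt
        · simp [smul_smul, mul_inv_cancel₀ hs.1.ne']
      · rintro ⟨z, ⟨hz, hzt⟩, rfl⟩
        rw [add_comm]
        exact ⟨hzt, P.level_ray hp k hz s⟩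
    rw [himg, euclideanHausdorffMeasure_homothety_image _ _ hs.1.ne', ENNReal.smul_def, smul_eq_mul]
    congr 1
    rw [ENNReal.ofReal, Real.toNNReal_pow hs.1.le]
    congr 2
    ext
    simp [abs_of_pos hs.1, Real.coe_toNNReal _ hs.1.le]
  · intro s hs
    by_contra hn
    apply hs
    simp only
    rw [hslice]
    convert measure_empty (μ := Measure.euclideanHausdorffMeasure _) using 2
    ext y
    simp only [mem_inter_iff, mem_ofPred_eq, mem_empty_iff_false, iff_false, not_and]
    rintro hy rfl
    exact hn (hts y hy)

end OpenPolytope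

/-! ### Cones over facets and polar coordinates about p -/

namespace OpenPolytope

variable {n : ℕ} (P : OpenPolytope n) {p x z : Vec n}

/-- All slices of the cone are homothetic copies of B, so the area of B is a positive finite
multiple of the cone volume. Finiteness of σ and negligibility of lower-dimensional faces are read
off from Lebesgue measure in this way. -/
theorem volume_coneOver (hp : p ∈ P.interior) (k : Fin P.N) {B : Set (Vec n)}
    (hB : MeasurableSet B) (hB0 : ∀ z ∈ B, P.delta k z = 0) :
    volume (P.coneOver k p B) = ENNReal.ofReal (P.delta k p) * ((ENNReal.ofReal ‖P.h k‖)⁻¹ *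
      ((∫⁻ s in Ioo (0:ℝ) 1, ENNReal.ofReal (s ^ (n - 1))) *
        Measure.euclideanHausdorffMeasure (n - 1) B)) := by
  rw [P.volume_eq_lintegral_hyperplane hp k (P.measurableSet_coneOver k p hB) fun x hx => hx.1,
    ← lintegral_mul_const _ (by fun_prop)]
  congr 2
  refine setLIntegral_congr_fun measurableSet_Ioo fun s hs => ?_
  simp only
  congr 2
  ext z
  constructor
  · rintro ⟨hz, h⟩
    exact (P.ray_mem_coneOver_iff hp k hz hs B).1 h
  · intro hz
    exact ⟨hB0 z hz, (P.ray_mem_coneOver_iff hp k (hB0 z hz) hs B).2 hz⟩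

theorem lintegral_pow_ne_zero (m : ℕ) :
    ∫⁻ s in Ioo (0:ℝ) 1, ENNReal.ofReal (s ^ m) ≠ 0 := by
  rw [← pos_iff_ne_zero, setLIntegral_pos_iff (by fun_prop)]
  have : Function.support (fun s : ℝ => ENNReal.ofReal (s ^ m)) ∩ Ioo 0 1 = Ioo 0 1 := by
    refine inter_eq_right.2 fun s hs => ?_
    simp only [Function.mem_support, ne_eq, ENNReal.ofReal_eq_zero, not_le]
    exact pow_pos hs.1 m
  rw [this]; simp

theorem coneOver_facetSet_subset (hp : p ∈ P.interior) (k : Fin P.N) :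
    P.coneOver k p (P.facetSet k) ⊆ P.interior := by
  rintro x ⟨hs, hx⟩
  have := P.ray_mem_interior hp hx.1 hs.1.le hs.2
  simpa [smul_smul, mul_inv_cancel₀ hs.1.ne'] using this

theorem volume_interior_lt_top : volume P.interior < ⊤ :=
  P.isBounded_interior.measure_lt_top

/-- A facet of infinite area would span a cone of infinite volume inside the bounded polytope. -/
theorem isFiniteMeasure_restrict_facetSet (hp : p ∈ P.interior) (k : Fin P.N) :
    IsFiniteMeasure ((Measure.euclideanHausdorffMeasure (n - 1)).restrict (P.facetSet k)) := by
  refine ⟨?_⟩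
  rw [Measure.restrict_apply_univ]
  by_contra hcon
  rw [not_lt, top_le_iff] at hcon
  have h := P.volume_coneOver hp k (P.measurableSet_facetSet k) fun z hz => hz.2
  rw [hcon, ENNReal.mul_top (lintegral_pow_ne_zero _), ENNReal.mul_top (by simp),
    ENNReal.mul_top (by simpa using hp k)] at h
  have := (measure_mono (P.coneOver_facetSet_subset hp k)).trans_lt P.volume_interior_lt_top
  rw [h] at this
  exact lt_irrefl _ this

theorem isFiniteMeasure_sigmaFacet (hp : p ∈ P.interior) (k : Fin P.N) :
    IsFiniteMeasure (P.sigmaFacet k) := by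
  have := P.isFiniteMeasure_restrict_facetSet hp k
  have h : (ENNReal.ofReal ‖P.h k‖)⁻¹ ≠ ⊤ := by
    rw [ENNReal.inv_ne_top, ne_eq, ENNReal.ofReal_eq_zero, not_le]
    exact norm_pos_iff.2 (P.h_ne_zero hp k)
  exact Measure.smul_finite _ h

theorem ae_sigmaFacet_mem (k : Fin P.N) : ∀ᵐ z ∂P.sigmaFacet k, z ∈ P.facetSet k :=
  Measure.smul_absolutelyContinuous (ae_restrict_mem (P.measurableSet_facetSet k))

/-- Almost every point of a facet lies on no other facet. -/
theorem ae_sigmaFacet_delta_pos (hp : p ∈ P.interior) (k : Fin P.N) :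
    ∀ᵐ z ∂P.sigmaFacet k, ∀ j, j ≠ k → 0 < P.delta j z := by
  rw [ae_all_iff]
  intro j
  by_cases hj : j = k
  · exact Filter.Eventually.of_forall fun z h => absurd hj h
  set B : Set (Vec n) := P.facetSet k ∩ {z | P.delta j z = 0}
  have hB : MeasurableSet B := (P.measurableSet_facetSet k).inter
    (isClosed_eq (P.continuous_delta j) continuous_const).measurableSet
  -- The cone over the intersection with another facet hyperplane lies in a hyperplane through p,
  -- hence has volume zero. That hyperplane is proper because `facet` provides a point of the k-th
  -- facet off the j-th one.
  have hcone : P.coneOver k p B ⊆ {x | P.level k p x = P.level j p x} := by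
    rintro x ⟨hs, hx⟩
    set s := P.level k p x
    have h1 := P.level_ray hp j hx.2 s
    rw [add_sub_cancel_left, smul_smul, mul_inv_cancel₀ hs.1.ne', one_smul, add_sub_cancel] at h1
    exact h1.symm
  have hvol : volume (P.coneOver k p B) = 0 := by
    refine measure_mono_null hcone ?_
    let a : Vec n →ₗ[ℝ] ℝ := (P.delta k p)⁻¹ • (P.h k).toLinearMap -
      (P.delta j p)⁻¹ • (P.h j).toLinearMap
    have heq : {x | P.level k p x = P.level j p x} =
        (AffineSubspace.mk' p (LinearMap.ker a) : Set (Vec n)) := by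
      ext x
      have hk : ∀ i y, P.h i y = P.delta i y + P.c i := fun i y => by simp [delta]
      have := (hp k).ne'
      have := (hp j).ne'
      simp only [mem_ofPred_eq, SetLike.mem_coe, AffineSubspace.mem_mk', LinearMap.mem_ker, a,
        LinearMap.sub_apply, LinearMap.smul_apply, vsub_eq_sub, map_sub, level, smul_eq_mul,
        ContinuousLinearMap.coe_coe, hk]
      constructor
      · intro h
        field_simp at h ⊢
        linear_combination -h
      · intro h
        field_simp at h ⊢
        linear_combination -h
    rw [heq]
    refine Measure.addHaar_affineSubspace _ _ fun htop => ?_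
    obtain ⟨y, hy, hyj⟩ := P.facet k
    have hy1 : y ∈ (AffineSubspace.mk' p (LinearMap.ker a) : Set (Vec n)) := by rw [htop]; trivial
    rw [← heq] at hy1
    have h1 : P.delta k y = 0 := hy
    have h2 : 0 < P.delta j y := hyj j hj
    have hpj := hp j
    simp only [mem_ofPred_eq, level, h1, zero_div, sub_zero] at hy1
    have : 0 < P.delta j y / P.delta j p := div_pos h2 hpj
    linarith
  rw [P.volume_coneOver hp k hB fun z hz => hz.1.2] at hvol
  have h0 : Measure.euclideanHausdorffMeasure (n - 1) B = 0 := by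
    rcases mul_eq_zero.1 hvol with h | h
    · exact absurd h (by simpa using hp k)
    rcases mul_eq_zero.1 h with h | h
    · exact absurd h (by simp)
    rcases mul_eq_zero.1 h with h | h
    · exact absurd h (lintegral_pow_ne_zero _)
    · exact h
  have hae : ∀ᵐ z ∂((Measure.euclideanHausdorffMeasure (n - 1)).restrict (P.facetSet k)),
      j ≠ k → 0 < P.delta j z := by
    rw [ae_restrict_iff' (P.measurableSet_facetSet k)]
    have : ∀ᵐ z ∂(Measure.euclideanHausdorffMeasure (n - 1) : Measure (Vec n)), z ∉ B :=
      measure_eq_zero_iff_ae_notMem.1 h0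
    filter_upwards [this] with z hz hzk _
    exact lt_of_le_of_ne (P.delta_nonneg hzk.1 j) fun h => hz ⟨hzk, h.symm⟩
  exact Measure.smul_absolutelyContinuous hae

/-- Polar coordinates on the cone over a facet. -/
theorem setLIntegral_coneOver (hp : p ∈ P.interior) (k : Fin P.N) {g : Vec n → ℝ≥0∞}
    (hg : Measurable g) :
    ∫⁻ x in P.coneOver k p (P.facetSet k), g x = ENNReal.ofReal (P.delta k p) *
      ∫⁻ z, (∫⁻ s in Ioo (0:ℝ) 1, ENNReal.ofReal (s ^ (n - 1)) * g (p + s • (z - p)))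
        ∂P.sigmaFacet k := by
  have hfin := P.isFiniteMeasure_restrict_facetSet hp k
  set m := (Measure.euclideanHausdorffMeasure (n - 1)).restrict (P.facetSet k) with hm
  set l : Measure ℝ := (volume.restrict (Ioo (0:ℝ) 1)).withDensity
    fun s => ENNReal.ofReal (s ^ (n - 1)) with hl
  have : SFinite l := by rw [hl]; infer_instance
  set c : Vec n × ℝ → Vec n := fun q => p + q.2 • (q.1 - p)
  have hc : Measurable c := by fun_prop
  set C := P.coneOver k p (P.facetSet k)
  have hC : MeasurableSet C := P.measurableSet_coneOver k p (P.measurableSet_facetSet k)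
  set a := ENNReal.ofReal (P.delta k p) * (ENNReal.ofReal ‖P.h k‖)⁻¹
  -- Lebesgue measure on the cone is a push-forward of facet area times the density s^(n-1); on sets
  -- this is the slicing formula.
  have hmeas : volume.restrict C = a • (m.prod l).map c := by
    ext t ht
    rw [Measure.restrict_apply ht, P.volume_eq_lintegral_hyperplane hp k (ht.inter hC)
      fun x hx => hx.2.1, Measure.smul_apply, smul_eq_mul, Measure.map_apply hc ht,
      Measure.prod_apply_symm (hc ht), ← mul_assoc, hl,
      lintegral_withDensity_eq_lintegral_mul₀ (by fun_prop)
        (measurable_measure_prodMk_right (hc ht)).aemeasurable]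
    congr 1
    refine setLIntegral_congr_fun measurableSet_Ioo fun s hs => ?_
    simp only [Pi.mul_apply]
    congr 1
    rw [hm, Measure.restrict_apply' (P.measurableSet_facetSet k)]
    congr 1
    ext z
    simp only [mem_ofPred_eq, mem_inter_iff, mem_preimage, c]
    constructor
    · rintro ⟨hz, h1, h2⟩
      exact ⟨h1, (P.ray_mem_coneOver_iff hp k hz hs _).1 h2⟩
    · rintro ⟨h1, h2⟩
      exact ⟨h2.2, h1, (P.ray_mem_coneOver_iff hp k h2.2 hs _).2 h2⟩
  rw [hmeas, lintegral_smul_measure, lintegral_map hg hc,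
    lintegral_prod (fun q => g (c q)) (hg.comp hc).aemeasurable, sigmaFacet, ← hm, lintegral_smul_measure,
    smul_eq_mul, smul_eq_mul, mul_assoc]
  congr 2
  refine lintegral_congr fun z => ?_
  rw [hl, lintegral_withDensity_eq_lintegral_mul₀ (by fun_prop) (by fun_prop)]
  rfl

/-- Polar coordinates with respect to the boundary of the polytope. -/
theorem setLIntegral_interior_le (hn : n ≠ 0) (hp : p ∈ P.interior) {g : Vec n → ℝ≥0∞}
    (hg : Measurable g) :
    ∫⁻ x in P.interior, g x ≤ ∑ k, ENNReal.ofReal (P.delta k p) *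
      ∫⁻ z, (∫⁻ s in Ioo (0:ℝ) 1, ENNReal.ofReal (s ^ (n - 1)) * g (p + s • (z - p)))
        ∂P.sigmaFacet k := by
  have hnt : Nontrivial (Vec n) := by
    have : Nonempty (Fin n) := ⟨⟨0, Nat.pos_of_ne_zero hn⟩⟩
    infer_instance
  have hcover : P.interior ⊆ {p} ∪ ⋃ k, P.coneOver k p (P.facetSet k) := by
    intro x hx
    by_cases hxp : x = p
    · left; exact hxp
    right
    -- If no level were positive at x, no δ_k would decrease along the ray from p through x, and the
    -- whole ray would stay in the bounded polytope.
    obtain ⟨k₀, hk₀⟩ : ∃ k, 0 < P.level k p x := by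
      by_contra! hcon
      have hmem : ∀ r : ℝ, 0 ≤ r → p + r • (x - p) ∈ P.interior := by
        intro r hr k
        have h1 : P.delta k p ≤ P.delta k x := by
          have := hcon k
          rw [level, sub_nonpos, one_le_div (hp k)] at this
          exact this
        rw [delta_ray]
        have := mul_nonneg hr (sub_nonneg.2 h1)
        have := hp k
        linarith
      obtain ⟨C, hC⟩ := P.isBounded_interior.exists_norm_le
      have hxn : 0 < ‖x - p‖ := norm_pos_iff.2 (sub_ne_zero.2 hxp)
      have hC0 : 0 ≤ C := (norm_nonneg _).trans (hC p hp)
      have h1 := hC _ (hmem ((2 * C + 1) / ‖x - p‖) (by positivity))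
      have h2 := norm_sub_le (p + ((2 * C + 1) / ‖x - p‖) • (x - p)) p
      rw [add_sub_cancel_left, norm_smul, Real.norm_of_nonneg (by positivity),
        div_mul_cancel₀ _ hxn.ne'] at h2
      have := hC p hp
      linarith
    have : Nonempty (Fin P.N) := ⟨k₀⟩
    -- The largest level belongs to the facet that the ray hits first.
    obtain ⟨k, hk⟩ := Finite.exists_max fun k => P.level k p x
    have hs0 : 0 < P.level k p x := hk₀.trans_le (hk k₀)
    refine mem_iUnion.2 ⟨k, ⟨hs0, ?_⟩, ?_⟩
    · have : 0 < P.delta k x / P.delta k p := div_pos (hx k) (hp k)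
      rw [level]; linarith
    · have hval : ∀ j, P.delta j (p + (P.level k p x)⁻¹ • (x - p)) =
          P.delta j p * (1 - P.level j p x / P.level k p x) := by
        intro j
        have h1 : P.delta j x = P.delta j p * (1 - P.level j p x) := by
          have := (hp j).ne'
          rw [level]; field_simp; ring
        rw [delta_ray, h1]
        field_simp; ring
      refine ⟨(P.mem_body_iff hp).2 fun j => ?_, ?_⟩
      · rw [hval]
        refine mul_nonneg (hp j).le (sub_nonneg.2 ((div_le_one hs0).2 (hk j)))
      · rw [hval, div_self hs0.ne']; simp
  calc ∫⁻ x in P.interior, g x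
      ≤ ∫⁻ x in {p} ∪ ⋃ k, P.coneOver k p (P.facetSet k), g x := lintegral_mono_set hcover
    _ ≤ (∫⁻ x in {p}, g x) + ∫⁻ x in ⋃ k, P.coneOver k p (P.facetSet k), g x :=
        lintegral_union_le _ _ _
    _ ≤ 0 + ∑' k, ∫⁻ x in P.coneOver k p (P.facetSet k), g x := by
        refine add_le_add ?_ (lintegral_iUnion_le _ _)
        simp
    _ = _ := by
        rw [zero_add, tsum_fintype]
        exact Finset.sum_congr rfl fun k _ => P.setLIntegral_coneOver hp k hg

end OpenPolytope

/-! ### The Legendre type transform and its radial derivative -/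

/-- The Legendre type transform `(x - p) · ∇v - v`. -/
noncomputable def legendre {n : ℕ} (p : Vec n) (v : Vec n → ℝ) (x : Vec n) : ℝ :=
  radial p v x - v x

/-- The Hessian of `v` in the radial direction. -/
noncomputable def radialHess {n : ℕ} (p : Vec n) (v : Vec n → ℝ) (x : Vec n) : ℝ :=
  ∑ i, ∑ j, (x i - p i) * hess v x i j * (x j - p j)

section Legendre

variable {n : ℕ} {Ω : Set (Vec n)} {v : Vec n → ℝ} {x p : Vec n}

theorem contDiffOn_legendre (hΩ : IsOpen Ω) (hv : ContDiffOn ℝ ∞ v Ω) :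
    ContDiffOn ℝ ∞ (legendre p v) Ω :=
  (contDiffOn_radial hΩ hv p).sub hv

/-- The terms ∂ᵢv cancel, leaving ∇E = V(x - p). This is the reason for cutting off in E: the
inverse Hessian sends ∇E to the radial field. -/
theorem pderiv_legendre (hΩ : IsOpen Ω) (hv : ContDiffOn ℝ ∞ v Ω) (hx : x ∈ Ω) (i : Fin n) :
    pderiv i (legendre p v) x = ∑ j, hess v x i j * (x j - p j) := by
  have h : pderiv i (legendre p v) x = pderiv i (radial p v) x - pderiv i v x :=
    pderiv_sub i (differentiableAt_of_contDiffOn hΩ (contDiffOn_radial hΩ hv p) hx)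
      (differentiableAt_of_contDiffOn hΩ hv hx)
  rw [h, pderiv_radial hΩ hv hx]; ring

theorem radial_legendre (hΩ : IsOpen Ω) (hv : ContDiffOn ℝ ∞ v Ω) (hx : x ∈ Ω) :
    radial p (legendre p v) x = radialHess p v x := by
  rw [radial_eq_sum]
  simp only [pderiv_legendre hΩ hv hx, radialHess, Finset.mul_sum, mul_assoc]

theorem contDiffOn_radialHess (hΩ : IsOpen Ω) (hv : ContDiffOn ℝ ∞ v Ω) :
    ContDiffOn ℝ ∞ (radialHess p v) Ω := by
  unfold radialHess
  exact ContDiffOn.sum fun i _ => ContDiffOn.sum fun j _ =>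
    ((contDiff_coord_sub i p).contDiffOn.mul (contDiffOn_hess hΩ hv i j)).mul
      (contDiff_coord_sub j p).contDiffOn

end Legendre

/-! ### Bounds up to the boundary and derivatives of Guillemin's function -/

namespace OpenPolytope

variable {n : ℕ} (P : OpenPolytope n) {p x : Vec n} {v f : Vec n → ℝ}

theorem exists_delta_le : ∃ D ≥ (1:ℝ), ∀ x ∈ P.body, ∀ k, P.delta k x ≤ D := by
  have h : ∀ k, ∃ D, ∀ x ∈ P.body, P.delta k x ≤ D := fun k => by
    obtain ⟨D, hD⟩ := P.isCompact_body.exists_bound_of_continuousOn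
      (P.continuous_delta k).continuousOn
    exact ⟨D, fun x hx => (le_abs_self _).trans (hD x hx)⟩
  choose D hD using h
  refine ⟨1 + ∑ k, |D k|, ?_, fun x hx k => ?_⟩
  · have : 0 ≤ ∑ k, |D k| := Finset.sum_nonneg fun _ _ => abs_nonneg _
    linarith
  · have h1 := Finset.single_le_sum (f := fun k => |D k|) (fun _ _ => abs_nonneg _)
      (Finset.mem_univ k)
    have := hD k x hx
    have := le_abs_self (D k)
    linarith

theorem nonempty_facets (hn : n ≠ 0) (hp : p ∈ P.interior) : Nonempty (Fin P.N) := by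
  by_contra hcon
  rw [not_nonempty_iff] at hcon
  have h := P.setLIntegral_interior_le hn hp (g := fun _ => 1) measurable_const
  simp only [Finset.univ_eq_empty, Finset.sum_empty, setLIntegral_one, nonpos_iff_eq_zero] at h
  exact (P.isOpen_interior.measure_pos volume ⟨p, hp⟩).ne' h

theorem body_mem_nhds (hx : x ∈ P.interior) : P.body ∈ nhds x :=
  Filter.mem_of_superset (P.isOpen_interior.mem_nhds hx) P.interior_subset_body

theorem uniqueDiffOn_body (hp : p ∈ P.interior) : UniqueDiffOn ℝ P.body :=
  uniqueDiffOn_convex P.convex_body ⟨p, mem_interior_iff_mem_nhds.2 (P.body_mem_nhds hp)⟩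

/-- The derivative within the closed body is smooth up to the boundary and agrees with the ordinary
one inside. Iterating gives the uniform bounds on first and second derivatives. -/
theorem exists_smooth_pderiv (hp : p ∈ P.interior) (hf : ContDiffOn ℝ ∞ f P.body) (i : Fin n) :
    ∃ g, ContDiffOn ℝ ∞ g P.body ∧ EqOn (pderiv i f) g P.interior := by
  refine ⟨fun x => fderivWithin ℝ f P.body x (EuclideanSpace.single i 1),
    (hf.fderivWithin (P.uniqueDiffOn_body hp) (by simp)).clm_apply contDiffOn_const,
    fun x hx => ?_⟩
  simp only [pderiv]
  rw [fderivWithin_of_mem_nhds (P.body_mem_nhds hx)]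

theorem exists_bound_of_continuousOn (hf : ContinuousOn f P.body) :
    ∃ M > (0:ℝ), ∀ x ∈ P.body, |f x| ≤ M := by
  obtain ⟨D, hD⟩ := P.isCompact_body.exists_bound_of_continuousOn hf
  exact ⟨max D 1, by positivity, fun x hx => (hD x hx).trans (le_max_left _ _)⟩

theorem exists_bound_pderiv (hp : p ∈ P.interior) (hf : ContDiffOn ℝ ∞ f P.body) :
    ∃ M > (0:ℝ), ∀ x ∈ P.interior, ∀ i, |pderiv i f x| ≤ M := by
  have h : ∀ i : Fin n, ∃ M > (0:ℝ), ∀ x ∈ P.interior, |pderiv i f x| ≤ M := fun i => by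
    obtain ⟨g, hg, hfg⟩ := P.exists_smooth_pderiv hp hf i
    obtain ⟨M, hM, h⟩ := P.exists_bound_of_continuousOn hg.continuousOn
    exact ⟨M, hM, fun x hx => by rw [hfg hx]; exact h x (P.interior_subset_body hx)⟩
  choose M hM h using h
  refine ⟨1 + ∑ i, M i, by have := Finset.sum_nonneg fun i (_ : i ∈ Finset.univ) => (hM i).le
                           linarith, fun x hx i => ?_⟩
  have := Finset.single_le_sum (f := M) (fun i _ => (hM i).le) (Finset.mem_univ i)
  have := h i x hx
  linarith

theorem exists_bound_hess (hp : p ∈ P.interior) (hf : ContDiffOn ℝ ∞ f P.body) :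
    ∃ M > (0:ℝ), ∀ x ∈ P.interior, ∀ i j, |hess f x i j| ≤ M := by
  have h : ∀ j : Fin n, ∃ M > (0:ℝ), ∀ x ∈ P.interior, ∀ i, |hess f x i j| ≤ M := fun j => by
    obtain ⟨g, hg, hfg⟩ := P.exists_smooth_pderiv hp hf j
    obtain ⟨M, hM, h⟩ := P.exists_bound_pderiv hp hg
    refine ⟨M, hM, fun x hx i => ?_⟩
    have := pderiv_congr P.isOpen_interior hfg hx i
    simp only [hess, Matrix.of_apply, this]
    exact h x hx i
  choose M hM h using h
  refine ⟨1 + ∑ i, M i, by have := Finset.sum_nonneg fun i (_ : i ∈ Finset.univ) => (hM i).le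
                           linarith, fun x hx i j => ?_⟩
  have := Finset.single_le_sum (f := M) (fun i _ => (hM i).le) (Finset.mem_univ j)
  have := h j x hx i
  linarith

theorem exists_bound_coord (p : Vec n) : ∃ M > (0:ℝ), ∀ x ∈ P.body, ∀ i, |x i - p i| ≤ M := by
  have h : ∀ i : Fin n, ∃ M > (0:ℝ), ∀ x ∈ P.body, |x i - p i| ≤ M := fun i =>
    P.exists_bound_of_continuousOn (contDiff_coord_sub i p).continuous.continuousOn
  choose M hM h using h
  refine ⟨1 + ∑ i, M i, by have := Finset.sum_nonneg fun i (_ : i ∈ Finset.univ) => (hM i).le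
                           linarith, fun x hx i => ?_⟩
  have := Finset.single_le_sum (f := M) (fun i _ => (hM i).le) (Finset.mem_univ i)
  have := h i x hx
  linarith

theorem exists_bound_radial (hp : p ∈ P.interior) (hf : ContDiffOn ℝ ∞ f P.body) :
    ∃ M > (0:ℝ), ∀ x ∈ P.interior, |radial p f x| ≤ M := by
  obtain ⟨M, hM, h⟩ := P.exists_bound_pderiv hp hf
  obtain ⟨D, hD, hc⟩ := P.exists_bound_coord p
  refine ⟨n * (D * M) + 1, by positivity, fun x hx => ?_⟩
  rw [radial_eq_sum]
  refine (Finset.abs_sum_le_sum_abs _ _).trans ?_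
  have : ∑ i, |(x i - p i) * pderiv i f x| ≤ ∑ _i : Fin n, D * M :=
    Finset.sum_le_sum fun i _ => by
      rw [abs_mul]
      exact mul_le_mul (hc x (P.interior_subset_body hx) i) (h x hx i) (abs_nonneg _) hD.le
  simp only [Finset.sum_const, Finset.card_univ, Fintype.card_fin, nsmul_eq_mul] at this
  linarith

theorem exists_bound_radialHess (hp : p ∈ P.interior) (hf : ContDiffOn ℝ ∞ f P.body) :
    ∃ M > (0:ℝ), ∀ x ∈ P.interior, |radialHess p f x| ≤ M := by
  obtain ⟨M, hM, h⟩ := P.exists_bound_hess hp hf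
  obtain ⟨D, hD, hc⟩ := P.exists_bound_coord p
  refine ⟨n * (n * (D * M * D)) + 1, by positivity, fun x hx => ?_⟩
  unfold radialHess
  have h1 : |∑ i, ∑ j, (x i - p i) * hess f x i j * (x j - p j)| ≤
      ∑ _i : Fin n, ∑ _j : Fin n, D * M * D := by
    refine (Finset.abs_sum_le_sum_abs _ _).trans (Finset.sum_le_sum fun i _ =>
      (Finset.abs_sum_le_sum_abs _ _).trans (Finset.sum_le_sum fun j _ => ?_))
    have hx' := P.interior_subset_body hx
    rw [abs_mul, abs_mul]
    exact mul_le_mul (mul_le_mul (hc x hx' i) (h x hx i j) (abs_nonneg _) hD.le) (hc x hx' j)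
      (abs_nonneg _) (by positivity)
  simp only [Finset.sum_const, Finset.card_univ, Fintype.card_fin, nsmul_eq_mul] at h1
  linarith

theorem hasFDerivAt_delta (k : Fin P.N) (x : Vec n) : HasFDerivAt (P.delta k) (P.h k) x :=
  (P.h k).hasFDerivAt.sub_const _

theorem contDiff_delta (k : Fin P.N) : ContDiff ℝ ∞ (P.delta k) :=
  (P.h k).contDiff.sub contDiff_const

theorem pderiv_delta (k : Fin P.N) (i : Fin n) :
    pderiv i (P.delta k) x = P.h k (EuclideanSpace.single i 1) := by
  rw [pderiv, (P.hasFDerivAt_delta k x).fderiv]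

theorem radial_delta (k : Fin P.N) : radial p (P.delta k) x = P.delta k x - P.delta k p := by
  rw [radial, (P.hasFDerivAt_delta k x).fderiv, map_sub]; simp [delta]

theorem contDiffOn_log_delta (k : Fin P.N) :
    ContDiffOn ℝ ∞ (fun x => Real.log (P.delta k x)) P.interior :=
  (P.contDiff_delta k).contDiffOn.log fun _ hx => (hx k).ne'

theorem contDiffOn_guillemin : ContDiffOn ℝ ∞ P.guillemin P.interior := by
  unfold guillemin
  exact ContDiffOn.sum fun k _ => (P.contDiff_delta k).contDiffOn.mul (P.contDiffOn_log_delta k)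

theorem pderiv_guillemin (hx : x ∈ P.interior) (i : Fin n) :
    pderiv i P.guillemin x =
      ∑ k, P.h k (EuclideanSpace.single i 1) * (Real.log (P.delta k x) + 1) := by
  have hd : ∀ k, DifferentiableAt ℝ (P.delta k) x := fun k =>
    (P.hasFDerivAt_delta k x).differentiableAt
  have hl : ∀ k, DifferentiableAt ℝ (fun y => Real.log (P.delta k y)) x := fun k =>
    (hd k).log (hx k).ne'
  change pderiv i (fun y => ∑ k, P.delta k y * Real.log (P.delta k y)) x = _
  rw [pderiv_sum _ _ fun k _ => (hd k).fun_mul (hl k)]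
  refine Finset.sum_congr rfl fun k _ => ?_
  have := (hx k).ne'
  rw [pderiv_mul i (hd k) (hl k), pderiv_comp (φ := Real.log) i (Real.hasDerivAt_log this) (hd k),
    pderiv_delta]
  field_simp

theorem hess_guillemin (hx : x ∈ P.interior) (i j : Fin n) :
    hess P.guillemin x i j = ∑ k, P.h k (EuclideanSpace.single i 1) *
      P.h k (EuclideanSpace.single j 1) / P.delta k x := by
  have hd : ∀ k, DifferentiableAt ℝ (P.delta k) x := fun k =>
    (P.hasFDerivAt_delta k x).differentiableAt
  have hl : ∀ k, DifferentiableAt ℝ (fun y => Real.log (P.delta k y) + 1) x := fun k =>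
    ((hd k).log (hx k).ne').add_const 1
  simp only [hess, Matrix.of_apply]
  rw [pderiv_congr P.isOpen_interior (fun y hy => P.pderiv_guillemin hy j) hx i,
    pderiv_sum _ _ fun k _ => (differentiableAt_const _).fun_mul (hl k)]
  refine Finset.sum_congr rfl fun k _ => ?_
  have := (hx k).ne'
  rw [pderiv_mul i (differentiableAt_const _) (hl k), pderiv_const,
    pderiv_comp (φ := fun t => Real.log t + 1) i ((Real.hasDerivAt_log this).add_const 1) (hd k),
    pderiv_delta]
  field_simp; ring

end OpenPolytope

/-! ### Radial derivatives of Guillemin's function and its determinant -/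

namespace OpenPolytope

variable {n : ℕ} (P : OpenPolytope n) {p x : Vec n} {v f : Vec n → ℝ}

theorem sum_coord_mul_h (k : Fin P.N) :
    ∑ i, (x i - p i) * P.h k (EuclideanSpace.single i 1) = P.delta k x - P.delta k p := by
  rw [← P.radial_delta k, radial_eq_sum]
  simp only [pderiv_delta]

theorem radial_guillemin (hx : x ∈ P.interior) : radial p P.guillemin x =
    ∑ k, (P.delta k x - P.delta k p) * (Real.log (P.delta k x) + 1) := by
  rw [radial_eq_sum]
  simp only [P.pderiv_guillemin hx, Finset.mul_sum]
  rw [Finset.sum_comm]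
  refine Finset.sum_congr rfl fun k _ => ?_
  rw [← P.sum_coord_mul_h k, Finset.sum_mul]
  exact Finset.sum_congr rfl fun i _ => by ring

theorem radialHess_guillemin (hx : x ∈ P.interior) : radialHess p P.guillemin x =
    ∑ k, (P.delta k x - P.delta k p) ^ 2 / P.delta k x := by
  simp only [radialHess, P.hess_guillemin hx, Finset.mul_sum, Finset.sum_mul]
  have : ∀ f : Fin n → Fin n → Fin P.N → ℝ, ∑ i, ∑ j, ∑ k, f i j k = ∑ k, ∑ i, ∑ j, f i j k := by
    intro f
    rw [Finset.sum_congr rfl fun i _ => Finset.sum_comm, Finset.sum_comm]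
  rw [this]
  refine Finset.sum_congr rfl fun k _ => ?_
  rw [← P.sum_coord_mul_h k, sq, Finset.sum_mul_sum, Finset.sum_div]
  refine Finset.sum_congr rfl fun i _ => ?_
  rw [Finset.sum_div]
  exact Finset.sum_congr rfl fun j _ => by ring

/-- The Hessian of u_o is ∑ h_k h_kᵀ/δ_k, so A plus it is the Schur complement of the diagonal
block. The block matrix has bounded entries when A does, which bounds the left side without any
discussion of how the facets meet. -/
theorem det_hess_guillemin_add (hx : x ∈ P.interior) (A : Matrix (Fin n) (Fin n) ℝ) :
    (A + hess P.guillemin x).det * ∏ k, P.delta k x =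
      (Matrix.fromBlocks (Matrix.diagonal fun k => P.delta k x)
        (Matrix.of fun k j => -P.h k (EuclideanSpace.single j 1))
        (Matrix.of fun i k => P.h k (EuclideanSpace.single i 1)) A).det := by
  set D : Matrix (Fin P.N) (Fin P.N) ℝ := Matrix.diagonal fun k => P.delta k x
  have hD : D.det = ∏ k, P.delta k x := Matrix.det_diagonal
  have hu : IsUnit D.det := by
    rw [hD, isUnit_iff_ne_zero]
    exact Finset.prod_ne_zero_iff.2 fun k _ => (hx k).ne'
  let _ := D.invertibleOfIsUnitDet hu
  have hinv : ⅟D = Matrix.diagonal fun k => (P.delta k x)⁻¹ := by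
    rw [Matrix.invOf_eq_nonsing_inv]
    refine Matrix.inv_eq_left_inv ?_
    rw [Matrix.diagonal_mul_diagonal, ← Matrix.diagonal_one]
    congr 1
    ext k
    exact inv_mul_cancel₀ (hx k).ne'
  rw [Matrix.det_fromBlocks₁₁, hD, mul_comm, hinv]
  congr 2
  ext i j
  simp only [Matrix.add_apply, Matrix.sub_apply, P.hess_guillemin hx, Matrix.mul_apply,
    Matrix.diagonal_apply, mul_ite, mul_zero, Finset.sum_ite_eq', Finset.mem_univ, if_true,
    Matrix.of_apply, mul_neg, Finset.sum_neg_distrib, sub_neg_eq_add]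
  congr 1
  exact Finset.sum_congr rfl fun k _ => by ring

theorem exists_bound_det (hf : ∃ M > (0:ℝ), ∀ x ∈ P.interior, ∀ i j, |hess f x i j| ≤ M) :
    ∃ C > (0:ℝ), ∀ x ∈ P.interior,
      (hess f x + hess P.guillemin x).det * ∏ k, P.delta k x ≤ C := by
  obtain ⟨M, hM, h⟩ := hf
  obtain ⟨D, hD, hdel⟩ := P.exists_delta_le
  have hh : ∃ B ≥ (0:ℝ), ∀ (k : Fin P.N) (i : Fin n), |P.h k (EuclideanSpace.single i 1)| ≤ B := by
    refine ⟨∑ k, ‖P.h k‖, Finset.sum_nonneg fun _ _ => norm_nonneg _, fun k i => ?_⟩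
    have h1 := (P.h k).le_opNorm (EuclideanSpace.single i (1:ℝ))
    have h2 := Finset.single_le_sum (f := fun k => ‖P.h k‖) (fun _ _ => norm_nonneg _)
      (Finset.mem_univ k)
    simp only [PiLp.norm_single, norm_one, mul_one, Real.norm_eq_abs] at h1
    exact h1.trans h2
  obtain ⟨B, hB, hh⟩ := hh
  set T := D + M + B
  refine ⟨(Fintype.card (Fin P.N ⊕ Fin n)).factorial • T ^ Fintype.card (Fin P.N ⊕ Fin n),
    by simp only [nsmul_eq_mul]; positivity, fun x hx => ?_⟩
  rw [P.det_hess_guillemin_add hx]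
  refine (le_abs_self _).trans
    (Matrix.det_le (abv := (AbsoluteValue.abs : AbsoluteValue ℝ ℝ)) (x := T) ?_)
  have hx' := P.interior_subset_body hx
  have hD0 : 0 ≤ D := by linarith
  rintro (k | i) (l | j)
  · simp only [Matrix.fromBlocks_apply₁₁, AbsoluteValue.abs_apply]
    by_cases hkl : k = l
    · subst hkl
      rw [Matrix.diagonal_apply_eq, abs_of_pos (hx k)]
      have := hdel x hx' k
      simp only [T]; linarith
    · rw [Matrix.diagonal_apply_ne _ hkl, abs_zero]; positivity
  · simp only [Matrix.fromBlocks_apply₁₂, AbsoluteValue.abs_apply, Matrix.of_apply, abs_neg]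
    have := hh k j
    simp only [T]; linarith
  · simp only [Matrix.fromBlocks_apply₂₁, AbsoluteValue.abs_apply, Matrix.of_apply]
    have := hh l i
    simp only [T]; linarith
  · simp only [Matrix.fromBlocks_apply₂₂, AbsoluteValue.abs_apply]
    have := h x hx i j
    simp only [T]; linarith

end OpenPolytope

/-! ### Boundary behaviour of functions in the class 𝒮 -/

section ClassS

variable {n : ℕ} {P : OpenPolytope n} {p x : Vec n} {v : Vec n → ℝ}

theorem ClassS.contDiffOn (hv : ClassS P v) : ContDiffOn ℝ ∞ v P.interior := by
  refine ((hv.2.2.mono P.interior_subset_body).add P.contDiffOn_guillemin).congr fun x _ => ?_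
  simp

theorem ClassS.contDiffOn_sub (hv : ClassS P v) :
    ContDiffOn ℝ ∞ (fun x => v x - P.guillemin x) P.interior :=
  hv.2.2.mono P.interior_subset_body

theorem ClassS.pderiv_eq (hv : ClassS P v) (hx : x ∈ P.interior) (i : Fin n) :
    pderiv i v x = pderiv i (fun x => v x - P.guillemin x) x + pderiv i P.guillemin x := by
  rw [pderiv_sub i (differentiableAt_of_contDiffOn P.isOpen_interior hv.contDiffOn hx)
    (differentiableAt_of_contDiffOn P.isOpen_interior P.contDiffOn_guillemin hx)]
  ring

theorem ClassS.hess_eq (hv : ClassS P v) (hx : x ∈ P.interior) :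
    hess v x = hess (fun x => v x - P.guillemin x) x + hess P.guillemin x := by
  have hO := P.isOpen_interior
  ext i j
  simp only [hess, Matrix.of_apply, Matrix.add_apply]
  rw [pderiv_congr hO (fun y hy => hv.pderiv_eq hy j) hx i, pderiv_add i
    (differentiableAt_of_contDiffOn hO (contDiffOn_pderiv hO hv.contDiffOn_sub j) hx)
    (differentiableAt_of_contDiffOn hO (contDiffOn_pderiv hO P.contDiffOn_guillemin j) hx)]

theorem ClassS.posDef (hv : ClassS P v) (hu : IsUnit (hess v x).det) (hx : x ∈ P.interior) :
    (hess v x).PosDef := by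
  have h1 := hess_posSemidef_of_convexOn P.isOpen_interior
    (hv.2.1.subset P.interior_subset_body P.convex_interior) hv.contDiffOn hx
  exact h1.posDef_iff_det_ne_zero.2 hu.ne_zero

/-- In the transform of u_o the terms δ_k log δ_k cancel, and only -∑ δ_k(p) log δ_k is unbounded.
-/
theorem ClassS.legendre_eq (hv : ClassS P v) (hx : x ∈ P.interior) :
    legendre p v x = radial p (fun x => v x - P.guillemin x) x - (v x - P.guillemin x) +
      ∑ k, (P.delta k x - P.delta k p) - ∑ k, P.delta k p * Real.log (P.delta k x) := by
  have h1 : radial p v x = radial p (fun x => v x - P.guillemin x) x + radial p P.guillemin x := by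
    simp only [radial_eq_sum, hv.pderiv_eq hx, mul_add, Finset.sum_add_distrib]
  rw [legendre, h1, P.radial_guillemin hx]
  have h2 : ∑ k, (P.delta k x - P.delta k p) * (Real.log (P.delta k x) + 1) =
      P.guillemin x + ∑ k, (P.delta k x - P.delta k p) -
        ∑ k, P.delta k p * Real.log (P.delta k x) := by
    simp only [OpenPolytope.guillemin]
    rw [← Finset.sum_add_distrib, ← Finset.sum_sub_distrib]
    exact Finset.sum_congr rfl fun k _ => by ring
  rw [h2]; ring

theorem ClassS.exists_bound_legendre (hv : ClassS P v) (hp : p ∈ P.interior) :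
    ∃ C > (0:ℝ), ∀ x ∈ P.interior,
      |legendre p v x + ∑ k, P.delta k p * Real.log (P.delta k x)| ≤ C := by
  obtain ⟨M, hM, h⟩ := P.exists_bound_radial hp hv.2.2
  obtain ⟨M', hM', h'⟩ := P.exists_bound_of_continuousOn hv.2.2.continuousOn
  obtain ⟨M'', hM'', h''⟩ := P.exists_bound_of_continuousOn
    (f := fun x => ∑ k, (P.delta k x - P.delta k p))
    (by have := P.continuous_delta; fun_prop)
  refine ⟨M + M' + M'', by positivity, fun x hx => ?_⟩
  rw [hv.legendre_eq hx, sub_add_cancel]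
  have h1 := abs_le.1 (h x hx)
  have h2 := abs_le.1 (h' x (P.interior_subset_body hx))
  have h3 := abs_le.1 (h'' x (P.interior_subset_body hx))
  rw [abs_le]
  constructor <;> linarith [h1.1, h1.2, h2.1, h2.2, h3.1, h3.2]

/-- The radial Hessian of u_o is ∑ (δ_k - δ_k(p))²/δ_k, whose poles are δ_k(p)²/δ_k; the smooth part
of v contributes a bounded term. -/
theorem ClassS.exists_le_radialHess (hv : ClassS P v) (hp : p ∈ P.interior) :
    ∃ C > (0:ℝ), ∀ x ∈ P.interior,
      ∑ k, P.delta k p ^ 2 / P.delta k x ≤ radialHess p v x + C := by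
  obtain ⟨M, hM, h⟩ := P.exists_bound_radialHess hp hv.2.2
  have hS : 0 ≤ ∑ k, P.delta k p := Finset.sum_nonneg fun k _ => (hp k).le
  refine ⟨M + 2 * ∑ k, P.delta k p, by positivity, fun x hx => ?_⟩
  have h1 : radialHess p v x = radialHess p (fun x => v x - P.guillemin x) x +
      radialHess p P.guillemin x := by
    simp only [radialHess, hv.hess_eq hx, Matrix.add_apply, mul_add, add_mul,
      Finset.sum_add_distrib]
  have h2 : ∑ k, P.delta k p ^ 2 / P.delta k x - 2 * ∑ k, P.delta k p ≤
      radialHess p P.guillemin x := by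
    rw [P.radialHess_guillemin hx, Finset.mul_sum, ← Finset.sum_sub_distrib]
    refine Finset.sum_le_sum fun k _ => ?_
    have hk := hx k
    have : (P.delta k x - P.delta k p) ^ 2 / P.delta k x =
        P.delta k p ^ 2 / P.delta k x - 2 * P.delta k p + P.delta k x := by
      field_simp; ring
    linarith
  have := abs_le.1 (h x hx)
  linarith [this.1]

theorem ClassS.exists_bound_det (hv : ClassS P v) (hp : p ∈ P.interior) :
    ∃ C > (0:ℝ), ∀ x ∈ P.interior, (hess v x).det * ∏ k, P.delta k x ≤ C := by
  obtain ⟨C, hC, h⟩ := P.exists_bound_det (P.exists_bound_hess hp hv.2.2)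
  exact ⟨C, hC, fun x hx => by rw [hv.hess_eq hx]; exact h x hx⟩

theorem ClassS.exists_le_legendre (hv : ClassS P v) (hp : p ∈ P.interior) :
    ∃ C > (0:ℝ), ∀ x ∈ P.interior,
      -C ≤ legendre p v x ∧ ∀ k, P.delta k p * -Real.log (P.delta k x) ≤ legendre p v x + C := by
  obtain ⟨C, hC, h⟩ := hv.exists_bound_legendre hp
  obtain ⟨D, hD, hdel⟩ := P.exists_delta_le
  have hlD : 0 ≤ Real.log D := Real.log_nonneg hD
  have hS : 0 ≤ ∑ k, P.delta k p * Real.log D :=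
    Finset.sum_nonneg fun k _ => mul_nonneg (hp k).le hlD
  refine ⟨C + ∑ k, P.delta k p * Real.log D, by positivity, fun x hx => ?_⟩
  have h1 := (abs_le.1 (h x hx)).1
  have hterm : ∀ k, 0 ≤ P.delta k p * Real.log D - P.delta k p * Real.log (P.delta k x) := by
    intro k
    rw [← mul_sub]
    exact mul_nonneg (hp k).le (sub_nonneg.2
      (Real.log_le_log (hx k) (hdel x (P.interior_subset_body hx) k)))
  have h2 : ∑ k, (P.delta k p * Real.log D - P.delta k p * Real.log (P.delta k x)) ≤
      legendre p v x + (C + ∑ k, P.delta k p * Real.log D) := by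
    rw [Finset.sum_sub_distrib]; linarith
  refine ⟨?_, fun k => ?_⟩
  · have := Finset.sum_nonneg fun k (_ : k ∈ Finset.univ) => hterm k
    linarith
  · have h3 := Finset.single_le_sum (fun k _ => hterm k) (Finset.mem_univ k)
    have := mul_nonneg (hp k).le hlD
    linarith

/-- An upper bound on E bounds every δ_k from below by a positive constant. Cutoffs in E are
therefore compactly supported in the open polytope. -/
theorem ClassS.isCompact_sublevel (hv : ClassS P v) (hp : p ∈ P.interior) (R : ℝ) :
    IsCompact {x ∈ P.interior | legendre p v x ≤ R} := by
  obtain ⟨C, hC, h⟩ := hv.exists_le_legendre hp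
  set K : Set (Vec n) := P.body ∩ ⋂ k, {x | Real.exp (-((R + C) / P.delta k p)) ≤ P.delta k x}
  have hKΩ : K ⊆ P.interior := fun x hx k => (Real.exp_pos _).trans_le (mem_iInter.1 hx.2 k)
  have hK : IsCompact K := P.isCompact_body.inter_right
    (isClosed_iInter fun k => isClosed_le continuous_const (P.continuous_delta k))
  have hcont : ContinuousOn (legendre p v) K :=
    (contDiffOn_legendre P.isOpen_interior hv.contDiffOn).continuousOn.mono hKΩ
  have heq : {x ∈ P.interior | legendre p v x ≤ R} = K ∩ legendre p v ⁻¹' Iic R := by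
    ext x
    constructor
    · rintro ⟨hx, hR⟩
      refine ⟨⟨P.interior_subset_body hx, mem_iInter.2 fun k => ?_⟩, hR⟩
      have h1 := (h x hx).2 k
      have h2 : -Real.log (P.delta k x) ≤ (R + C) / P.delta k p := by
        rw [le_div_iff₀ (hp k)]; linarith
      simp only [mem_ofPred_eq]
      rw [← Real.le_log_iff_exp_le (hx k)]
      linarith
    · rintro ⟨hxK, hR⟩
      exact ⟨hKΩ hxK, hR⟩
  rw [heq]
  exact hK.of_isClosed_subset (hcont.preimage_isClosed_of_isClosed hK.isClosed isClosed_Iic)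
    inter_subset_left

/-- The radial Hessian grows faster than some exponential of the Legendre transform. -/
theorem ClassS.exists_exp_le_radialHess (hv : ClassS P v) (hn : n ≠ 0) (hp : p ∈ P.interior) :
    ∃ a > (0:ℝ), ∀ M : ℝ, ∃ R : ℝ, ∀ x ∈ P.interior, R < legendre p v x →
      M * Real.exp (a * legendre p v x) ≤ radialHess p v x := by
  obtain ⟨C, hC, h⟩ := hv.exists_bound_legendre hp
  obtain ⟨C', hC', h'⟩ := hv.exists_le_radialHess hp
  have := P.nonempty_facets hn hp
  set S := ∑ k, P.delta k p
  have hS : 0 < S := Finset.sum_pos (fun k _ => hp k) Finset.univ_nonempty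
  obtain ⟨k₀, hk₀⟩ := Finite.exists_min fun k => P.delta k p
  set c := P.delta k₀ p ^ 2
  have hc : 0 < c := by have := hp k₀; positivity
  have key : ∀ x ∈ P.interior,
      c * Real.exp (-(C / S)) * Real.exp (legendre p v x / S) ≤ radialHess p v x + C' := by
    intro x hx
    set Y := ∑ k, (P.delta k x)⁻¹
    have hY : 0 < Y := Finset.sum_pos (fun k _ => inv_pos.2 (hx k)) Finset.univ_nonempty
    have h1 : c * Y ≤ radialHess p v x + C' := by
      refine le_trans ?_ (h' x hx)
      rw [Finset.mul_sum]
      refine Finset.sum_le_sum fun k _ => ?_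
      rw [div_eq_mul_inv]
      exact mul_le_mul_of_nonneg_right (pow_le_pow_left₀ (hp k₀).le (hk₀ k) 2)
        (inv_pos.2 (hx k)).le
    -- Each -log δ_k is at most log Y, and the weights δ_k(p) add up to S; so Y, and with it the
    -- radial Hessian, grows at least like exp(E/S).
    have h2 : legendre p v x ≤ C + S * Real.log Y := by
      have h3 := (abs_le.1 (h x hx)).2
      have h4 : -∑ k, P.delta k p * Real.log (P.delta k x) ≤ S * Real.log Y := by
        rw [← Finset.sum_neg_distrib, Finset.sum_mul]
        refine Finset.sum_le_sum fun k _ => ?_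
        rw [← mul_neg, ← Real.log_inv]
        refine mul_le_mul_of_nonneg_left (Real.log_le_log (inv_pos.2 (hx k)) ?_) (hp k).le
        exact Finset.single_le_sum (f := fun k => (P.delta k x)⁻¹)
          (fun k _ => (inv_pos.2 (hx k)).le) (Finset.mem_univ k)
      linarith
    have h5 : Real.exp (-(C / S)) * Real.exp (legendre p v x / S) ≤ Y := by
      rw [← Real.exp_add, ← Real.le_log_iff_exp_le hY]
      have : -(C / S) + legendre p v x / S = (legendre p v x - C) / S := by ring
      rw [this, div_le_iff₀ hS]
      linarith
    rw [mul_assoc]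
    exact (mul_le_mul_of_nonneg_left h5 hc.le).trans h1
  -- Half of the exponent 1/S: with t = exp(aE) the lower bound reads b t² - C', which eventually
  -- beats M t for every M.
  refine ⟨1 / (2 * S), by positivity, fun M => ?_⟩
  set b := c * Real.exp (-(C / S))
  have hb : 0 < b := by positivity
  have hlim : ∀ᶠ t : ℝ in Filter.atTop, M * t ≤ b * t ^ 2 - C' := by
    filter_upwards [Filter.eventually_ge_atTop ((|M| + C') / b + 1),
      Filter.eventually_ge_atTop 1] with t ht ht1
    have h1 : |M| + C' ≤ b * t := by
      have : (|M| + C') / b ≤ t := by linarith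
      rw [div_le_iff₀ hb] at this; linarith
    have h2 : M * t ≤ |M| * t := mul_le_mul_of_nonneg_right (le_abs_self M) (by linarith)
    nlinarith
  have hexp : Filter.Tendsto (fun E : ℝ => Real.exp (1 / (2 * S) * E)) Filter.atTop Filter.atTop :=
    Real.tendsto_exp_atTop.comp (Filter.tendsto_id.const_mul_atTop (by positivity))
  obtain ⟨R, hR⟩ := Filter.eventually_atTop.1 (hexp.eventually hlim)
  refine ⟨R, fun x hx hRx => (hR _ hRx.le).trans ?_⟩
  have h1 := key x hx
  have h2 : Real.exp (1 / (2 * S) * legendre p v x) ^ 2 = Real.exp (legendre p v x / S) := by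
    rw [← Real.exp_nat_mul]; congr 1; push_cast; field_simp
  rw [h2]; linarith

end ClassS

/-! ### Convex cutoff functions -/

section Cutoff

theorem hasDerivAt_max_pow (m : ℕ) (t : ℝ) :
    HasDerivAt (fun s : ℝ => max s 0 ^ (m + 2)) ((m + 2) * max t 0 ^ (m + 1)) t := by
  rcases lt_trichotomy t 0 with h | h | h
  · have h1 : (fun s : ℝ => max s 0 ^ (m + 2)) =ᶠ[nhds t] fun _ => 0 := by
      filter_upwards [Iio_mem_nhds h] with s hs
      rw [max_eq_right (le_of_lt hs)]; simp
    rw [max_eq_right h.le]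
    simpa using (hasDerivAt_const t (0:ℝ)).congr_of_eventuallyEq h1
  · subst h
    have : HasDerivAt (fun s : ℝ => max s 0 ^ (m + 2)) 0 0 := by
      rw [hasDerivAt_iff_isLittleO_nhds_zero]
      have h2 : (fun h : ℝ => h ^ 2) =o[nhds 0] fun h => h := by
        simpa using Asymptotics.isLittleO_pow_id (𝕜 := ℝ) (one_lt_two)
      refine Asymptotics.IsBigO.trans_isLittleO ?_ h2
      refine Asymptotics.IsBigO.of_bound 1 ?_
      filter_upwards [Ioo_mem_nhds (show (-1:ℝ) < 0 by norm_num) (show (0:ℝ) < 1 by norm_num)]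
        with s hs
      have h0 : 0 ≤ max s 0 := le_max_right _ _
      have h1 : max s 0 ≤ |s| := max_le (le_abs_self s) (abs_nonneg s)
      have h3 : |s| ≤ 1 := abs_le.2 ⟨hs.1.le, hs.2.le⟩
      simp only [zero_add, max_self, ne_eq, Nat.add_eq_zero_iff, OfNat.ofNat_ne_zero, and_false,
        not_false_eq_true, zero_pow, sub_zero, smul_zero, Real.norm_eq_abs, one_mul, abs_pow,
        abs_of_nonneg h0]
      calc max s 0 ^ (m + 2) ≤ |s| ^ (m + 2) := pow_le_pow_left₀ h0 h1 _
        _ ≤ |s| ^ 2 := pow_le_pow_of_le_one (abs_nonneg s) h3 (by omega)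
    simpa using this
  · have h1 : (fun s : ℝ => max s 0 ^ (m + 2)) =ᶠ[nhds t] fun s => s ^ (m + 2) := by
      filter_upwards [Ioi_mem_nhds h] with s hs
      rw [max_eq_left (le_of_lt hs)]
    rw [max_eq_left h.le]
    have := (hasDerivAt_pow (m + 2) t).congr_of_eventuallyEq h1
    simpa using this

theorem contDiff_max_pow (m : ℕ) : ContDiff ℝ 1 (fun s : ℝ => max s 0 ^ (m + 2)) := by
  rw [contDiff_one_iff_deriv]
  refine ⟨fun t => (hasDerivAt_max_pow m t).differentiableAt, ?_⟩
  rw [funext fun t => (hasDerivAt_max_pow m t).deriv]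
  fun_prop

/-- The argument of the cutoff functions. -/
noncomputable def cutArg (a R t : ℝ) : ℝ := 1 - (t - Real.exp (-(a * t))) / R

/-- A convex cutoff function at scale `R`, with a correction making it strictly convex. -/
noncomputable def cut (a R t : ℝ) : ℝ := max (cutArg a R t) 0 ^ 3

/-- Minus the derivative of `cut`. -/
noncomputable def cutSlope (a R t : ℝ) : ℝ :=
  3 * max (cutArg a R t) 0 ^ 2 * ((1 + a * Real.exp (-(a * t))) / R)

/-- The derivative of `cutSlope`. -/
noncomputable def cutSlopeDeriv (a R t : ℝ) : ℝ :=
  -(6 * max (cutArg a R t) 0 * ((1 + a * Real.exp (-(a * t))) / R) ^ 2) -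
    3 * max (cutArg a R t) 0 ^ 2 * (a ^ 2 * Real.exp (-(a * t)) / R)

variable {a R t : ℝ}

theorem hasDerivAt_cutArg : HasDerivAt (cutArg a R) (-((1 + a * Real.exp (-(a * t))) / R)) t := by
  have h1 : HasDerivAt (fun t : ℝ => Real.exp (-(a * t))) (Real.exp (-(a * t)) * -(a * 1)) t :=
    ((hasDerivAt_id t).const_mul a).neg.exp
  refine ((((hasDerivAt_id t).sub h1).div_const R).const_sub 1).congr_deriv ?_
  ring

theorem contDiff_cutArg : ContDiff ℝ ∞ (cutArg a R) := by
  unfold cutArg; fun_prop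

theorem hasDerivAt_cut : HasDerivAt (cut a R) (-cutSlope a R t) t := by
  refine ((hasDerivAt_max_pow 1 (cutArg a R t)).comp t hasDerivAt_cutArg).congr_deriv ?_
  simp only [cutSlope]; push_cast; ring

theorem hasDerivAt_cutSlope : HasDerivAt (cutSlope a R) (cutSlopeDeriv a R t) t := by
  have h1 : HasDerivAt (fun t : ℝ => Real.exp (-(a * t))) (Real.exp (-(a * t)) * -(a * 1)) t :=
    ((hasDerivAt_id t).const_mul a).neg.exp
  have h2 := ((hasDerivAt_max_pow 0 (cutArg a R t)).comp t hasDerivAt_cutArg).const_mul 3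
  have h3 := ((h1.const_mul a).const_add 1).div_const R
  refine (h2.mul h3).congr_deriv ?_
  simp only [cutSlopeDeriv, Function.comp]; push_cast; ring

theorem contDiff_cut : ContDiff ℝ 1 (cut a R) :=
  (contDiff_max_pow 1).comp (contDiff_cutArg.of_le (by simp))

theorem contDiff_cutSlope : ContDiff ℝ 1 (cutSlope a R) := by
  have h1 : ContDiff ℝ 1 fun t => max (cutArg a R t) 0 ^ 2 :=
    (contDiff_max_pow 0).comp (contDiff_cutArg.of_le (by simp))
  unfold cutSlope
  exact (contDiff_const.mul h1).mul (by fun_prop)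

theorem continuous_cutSlopeDeriv : Continuous (cutSlopeDeriv a R) := by
  have := (contDiff_cutArg (a := a) (R := R)).continuous
  unfold cutSlopeDeriv; fun_prop

theorem cut_nonneg : 0 ≤ cut a R t := by unfold cut; positivity

theorem cutSlope_nonneg (ha : 0 < a) (hR : 0 < R) : 0 ≤ cutSlope a R t := by
  unfold cutSlope; positivity

/-- The term kept comes from the exponential correction. Like `cutSlope` it carries the squared
cutoff and one factor 1/R, so the two can be compared uniformly in R; the discarded term has the
factor 1/R² and could not dominate `cutSlope`. -/
theorem cutSlopeDeriv_le : cutSlopeDeriv a R t ≤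
    -(3 * max (cutArg a R t) 0 ^ 2 * (a ^ 2 * Real.exp (-(a * t)) / R)) := by
  have : 0 ≤ 6 * max (cutArg a R t) 0 * ((1 + a * Real.exp (-(a * t))) / R) ^ 2 := by positivity
  unfold cutSlopeDeriv; linarith

theorem exp_neg_le {b : ℝ} (ha : 0 < a) (hb : -b ≤ t) :
    Real.exp (-(a * t)) ≤ Real.exp (a * b) := by
  refine Real.exp_le_exp.2 ?_
  nlinarith

theorem max_cutArg_le {b : ℝ} (ha : 0 < a) (hR : 1 ≤ R) (hb0 : 0 ≤ b) (hb : -b ≤ t) :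
    max (cutArg a R t) 0 ≤ 1 + b + Real.exp (a * b) := by
  have h1 := exp_neg_le ha hb
  have h0 := Real.exp_pos (a * b)
  refine max_le ?_ (by positivity)
  have : (-(t - Real.exp (-(a * t)))) / R ≤ b + Real.exp (a * b) := by
    rw [div_le_iff₀ (by linarith)]
    nlinarith
  rw [cutArg, sub_eq_add_neg, ← neg_div]; linarith

theorem cutArg_nonpos {b : ℝ} (ha : 0 < a) (hR : 1 ≤ R) (hb : -b ≤ t)
    (ht : R + Real.exp (a * b) ≤ t) : cutArg a R t ≤ 0 := by
  have h1 := exp_neg_le ha hb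
  have : 1 ≤ (t - Real.exp (-(a * t))) / R := by
    rw [one_le_div (by linarith)]; linarith
  rw [cutArg]; linarith

theorem tendsto_cutArg : Filter.Tendsto (fun m : ℕ => cutArg a (m + 1) t) Filter.atTop (nhds 1) := by
  have h : Filter.Tendsto (fun m : ℕ => (t - Real.exp (-(a * t))) / ((m : ℝ) + 1)) Filter.atTop
      (nhds 0) := by
    simpa [Function.comp_def] using (tendsto_const_div_atTop_nhds_zero_nat
      (t - Real.exp (-(a * t)))).comp (Filter.tendsto_add_atTop_nat 1)
  simpa [cutArg] using h.const_sub 1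

theorem tendsto_cut : Filter.Tendsto (fun m : ℕ => cut a (m + 1) t) Filter.atTop (nhds 1) := by
  have := ((tendsto_cutArg (a := a) (t := t)).max (tendsto_const_nhds (x := (0:ℝ)))).pow 3
  simpa [cut] using this

end Cutoff

/-! ### The integrated Abreu equation -/

section Identity

variable {n : ℕ} {Ω : Set (Vec n)} {v A U : Vec n → ℝ} {x p : Vec n}

/-- Minus the logarithm of the determinant of the Hessian. -/
noncomputable def negLogDet (v : Vec n → ℝ) (x : Vec n) : ℝ := -Real.log (hess v x).det

theorem contDiffOn_negLogDet (hΩ : IsOpen Ω) (hv : ContDiffOn ℝ ∞ v Ω)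
    (hu : ∀ y ∈ Ω, IsUnit (hess v y).det) : ContDiffOn ℝ ∞ (negLogDet v) Ω :=
  ((contDiffOn_det (contDiffOn_hess hΩ hv)).log fun y hy => (hu y hy).ne_zero).neg

theorem sum_pderiv_legendre_mul_inv (hΩ : IsOpen Ω) (hv : ContDiffOn ℝ ∞ v Ω)
    (hu : IsUnit (hess v x).det) (hx : x ∈ Ω) (j : Fin n) :
    ∑ i, pderiv i (legendre p v) x * (hess v x)⁻¹ i j = x j - p j := by
  have h1 : ∑ i, pderiv i (legendre p v) x * (hess v x)⁻¹ i j =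
      ∑ a, (hess v x * (hess v x)⁻¹) a j * (x a - p a) := by
    simp only [pderiv_legendre hΩ hv hx, Matrix.mul_apply, Finset.sum_mul]
    rw [Finset.sum_comm]
    refine Finset.sum_congr rfl fun a _ => Finset.sum_congr rfl fun i _ => ?_
    rw [hess_symm hΩ hv hx i a]; ring
  rw [h1, Matrix.mul_nonsing_inv _ hu]
  simp [Matrix.one_apply]

/-- Integration by parts against the inverse Hessian of a solution of the Abreu equation, with a
cutoff depending on the Legendre type transform. -/
theorem setIntegral_abreu (hΩ : IsOpen Ω) (hv : ContDiffOn ℝ ∞ v Ω)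
    (hu : ∀ y ∈ Ω, IsUnit (hess v y).det)
    (hA : ∀ y ∈ Ω, ∑ i, ∑ j, pderiv i (pderiv j (fun y => (hess v y)⁻¹ i j)) y = -A y)
    (hU : ContDiffOn ℝ ∞ U Ω) {φ φ' : ℝ → ℝ} (hφ : ∀ t, HasDerivAt φ (φ' t) t)
    (hφ1 : ContDiff ℝ 1 φ) {K : Set (Vec n)} (hK : IsCompact K) (hKΩ : K ⊆ Ω)
    (h0 : ∀ y ∈ Ω, y ∉ K → φ (legendre p v y) = 0) :
    ∫ x in Ω, (φ (legendre p v x) * ((hess v x)⁻¹ * hess U x).trace +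
      φ' (legendre p v x) * (radial p U x - U x * radial p (negLogDet v) x) +
      φ (legendre p v x) * (A x * U x)) = 0 := by
  set E := legendre p v
  have hE : ContDiffOn ℝ ∞ E Ω := contDiffOn_legendre hΩ hv
  set F : Fin n → Vec n → ℝ := fun i y => ∑ j, pderiv j (fun y => (hess v y)⁻¹ i j) y
  have hI := contDiffOn_inv_hess hΩ hv hu
  have hF : ∀ i, ContDiffOn ℝ ∞ (F i) Ω := fun i =>
    ContDiffOn.sum fun j _ => contDiffOn_pderiv hΩ (hI i j) j
  -- B = V⁻¹∇U - U div V⁻¹. In its divergence the two terms pairing ∇U with div V⁻¹ cancel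
  -- (`hcross`), and the Abreu equation gives div div V⁻¹ = -A.
  set B : Fin n → Vec n → ℝ := fun i y => ∑ j, (hess v y)⁻¹ i j * pderiv j U y - U y * F i y
  have hB : ∀ i, ContDiffOn ℝ ∞ (B i) Ω := fun i =>
    (ContDiffOn.sum fun j _ => (hI i j).mul (contDiffOn_pderiv hΩ hU j)).sub (hU.mul (hF i))
  have hW : ∀ i, ContDiffOn ℝ 1 (fun y => φ (E y) * B i y) Ω := fun i =>
    (hφ1.comp_contDiffOn (hE.of_le (by simp))).mul ((hB i).of_le (by simp))
  rw [← setIntegral_divergence_eq_zero hΩ hK hKΩ hW (by intro i y hy hyK; simp [E, h0 y hy hyK])]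
  refine setIntegral_congr_fun hΩ.measurableSet fun x hx => ?_
  have dE := differentiableAt_of_contDiffOn hΩ hE hx
  have dU := differentiableAt_of_contDiffOn hΩ hU hx
  have dU' : ∀ j, DifferentiableAt ℝ (pderiv j U) x := fun j =>
    differentiableAt_of_contDiffOn hΩ (contDiffOn_pderiv hΩ hU j) hx
  have dI : ∀ i j, DifferentiableAt ℝ (fun y => (hess v y)⁻¹ i j) x := fun i j =>
    differentiableAt_of_contDiffOn hΩ (hI i j) hx
  have dF : ∀ i, DifferentiableAt ℝ (F i) x := fun i =>
    differentiableAt_of_contDiffOn hΩ (hF i) hx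
  have dB : ∀ i, DifferentiableAt ℝ (B i) x := fun i =>
    differentiableAt_of_contDiffOn hΩ (hB i) hx
  have dφ : DifferentiableAt ℝ (fun y => φ (E y)) x := (hφ _).differentiableAt.comp x dE
  have pB : ∀ i, pderiv i (B i) x = ∑ j, pderiv i (fun y => (hess v y)⁻¹ i j) x * pderiv j U x +
      ∑ j, (hess v x)⁻¹ i j * hess U x i j - pderiv i U x * F i x - U x * pderiv i (F i) x := by
    intro i
    rw [show B i = fun y => (∑ j, (hess v y)⁻¹ i j * pderiv j U y) - U y * F i y from rfl,
      pderiv_sub i (DifferentiableAt.fun_sum fun j _ => (dI i j).fun_mul (dU' j))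
        (dU.fun_mul (dF i)), pderiv_mul i dU (dF i),
      pderiv_sum _ _ fun j _ => (dI i j).fun_mul (dU' j)]
    have hm : ∀ j, pderiv i (fun y => (hess v y)⁻¹ i j * pderiv j U y) x =
        pderiv i (fun y => (hess v y)⁻¹ i j) x * pderiv j U x +
          (hess v x)⁻¹ i j * hess U x i j := fun j => pderiv_mul i (dI i j) (dU' j)
    rw [Finset.sum_congr rfl fun j _ => hm j, Finset.sum_add_distrib]
    ring
  have hdiv : ∑ i, pderiv i (F i) x = -A x := by
    rw [← hA x hx]
    refine Finset.sum_congr rfl fun i _ => ?_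
    rw [show F i = fun y => ∑ j, pderiv j (fun y => (hess v y)⁻¹ i j) y from rfl,
      pderiv_sum _ _ fun j _ => differentiableAt_of_contDiffOn hΩ (contDiffOn_pderiv hΩ (hI i j) j) hx]
  have hcross : ∑ i, ∑ j, pderiv i (fun y => (hess v y)⁻¹ i j) x * pderiv j U x =
      ∑ i, pderiv i U x * F i x := by
    rw [Finset.sum_comm]
    refine Finset.sum_congr rfl fun j _ => ?_
    rw [← Finset.sum_mul, mul_comm]
    congr 1
    refine Finset.sum_congr rfl fun i _ => ?_
    exact pderiv_congr hΩ (fun y hy => inv_hess_symm hΩ hv hy i j) hx i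
  -- Since div V⁻¹ = V⁻¹∇(-log det V) and V⁻¹∇E = x - p, pairing ∇E with B leaves only radial
  -- derivatives.
  have hEB : ∑ i, pderiv i E x * B i x = radial p U x - U x * radial p (negLogDet v) x := by
    have h1 : ∀ i, B i x = ∑ j, (hess v x)⁻¹ i j *
        (pderiv j U x - U x * pderiv j (negLogDet v) x) := by
      intro i
      have hFx : F i x = ∑ j, (hess v x)⁻¹ i j * pderiv j (negLogDet v) x :=
        divergence_inv_hess hΩ hv hu hx i
      simp only [B, hFx, Finset.mul_sum, ← Finset.sum_sub_distrib]
      exact Finset.sum_congr rfl fun j _ => by ring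
    simp only [h1, Finset.mul_sum, radial_eq_sum]
    rw [Finset.sum_comm, ← Finset.sum_sub_distrib]
    refine Finset.sum_congr rfl fun j _ => ?_
    rw [← sum_pderiv_legendre_mul_inv hΩ hv (hu x hx) hx j, Finset.sum_mul, Finset.sum_mul,
      Finset.mul_sum, ← Finset.sum_sub_distrib]
    exact Finset.sum_congr rfl fun i _ => by ring
  have hdW : ∀ i, pderiv i (fun y => φ (E y) * B i y) x =
      φ' (E x) * (pderiv i E x * B i x) + φ (E x) * pderiv i (B i) x := by
    intro i
    rw [pderiv_mul i dφ (dB i), pderiv_comp i (hφ _) dE]; ring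
  simp only [hdW, Finset.sum_add_distrib, ← Finset.mul_sum, hEB, pB, Finset.sum_sub_distrib, hcross,
    hdiv]
  rw [trace_mul_eq_sum (hess_symm hΩ hU hx)]
  ring

end Identity

/-! ### The cutoff inequality for test functions -/

/-- Positive convex functions with bounded radial derivative, used as test functions. -/
structure TestFn {n : ℕ} (P : OpenPolytope n) (p : Vec n) (U : Vec n → ℝ) (C : ℝ) : Prop where
  smooth : ContDiffOn ℝ ∞ U P.interior
  continuousOn : ContinuousOn U P.body
  posSemidef : ∀ x ∈ P.interior, (hess U x).PosSemidef
  one_le : ∀ x ∈ P.body, 1 ≤ U x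
  le_bound : ∀ x ∈ P.body, U x ≤ C
  radial_le : ∀ x ∈ P.interior, radial p U x ≤ C
  ray_le : ∀ z ∈ P.body, ∀ s ∈ Ioo (0:ℝ) 1, U (p + s • (z - p)) ≤ U z

/-- The exponent `a` and the bound `b` are adapted to the growth of the Legendre type transform. -/
structure CutData {n : ℕ} (P : OpenPolytope n) (p : Vec n) (v : Vec n → ℝ) (a b : ℝ) : Prop where
  a_pos : 0 < a
  b_nonneg : 0 ≤ b
  le_legendre : ∀ x ∈ P.interior, -b ≤ legendre p v x
  growth : ∀ M : ℝ, ∃ R : ℝ, ∀ x ∈ P.interior, R < legendre p v x →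
      M * Real.exp (a * legendre p v x) ≤ radialHess p v x

/-- The sum `∑ δ_k(p) / δ_k`. -/
noncomputable def OpenPolytope.poleSum {n : ℕ} (P : OpenPolytope n) (p x : Vec n) : ℝ :=
  ∑ k, P.delta k p / P.delta k x

section Main

variable {n : ℕ} {P : OpenPolytope n} {p x : Vec n} {v A U : Vec n → ℝ} {a b CU R : ℝ}

theorem ClassS.exists_cutData (hv : ClassS P v) (hn : n ≠ 0) (hp : p ∈ P.interior) :
    ∃ a b, CutData P p v a b := by
  obtain ⟨a, ha, h⟩ := hv.exists_exp_le_radialHess hn hp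
  obtain ⟨b, hb, h'⟩ := hv.exists_le_legendre hp
  exact ⟨a, b, ha, hb.le, fun x hx => (h' x hx).1, h⟩

theorem CutData.cutArg_nonpos (hd : CutData P p v a b) (hR : 1 ≤ R) (hx : x ∈ P.interior)
    (hxK : x ∉ {y ∈ P.interior | legendre p v y ≤ R + Real.exp (a * b)}) :
    cutArg a R (legendre p v x) ≤ 0 := by
  refine ToricAbreu.cutArg_nonpos hd.a_pos hR (hd.le_legendre x hx) ?_
  by_contra h
  exact hxK ⟨hx, (not_le.1 h).le⟩

theorem CutData.cut_eq_zero (hd : CutData P p v a b) (hR : 1 ≤ R) (hx : x ∈ P.interior)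
    (hxK : x ∉ {y ∈ P.interior | legendre p v y ≤ R + Real.exp (a * b)}) :
    cut a R (legendre p v x) = 0 := by
  rw [cut, max_eq_right (hd.cutArg_nonpos hR hx hxK)]; simp

theorem CutData.cutSlope_eq_zero (hd : CutData P p v a b) (hR : 1 ≤ R) (hx : x ∈ P.interior)
    (hxK : x ∉ {y ∈ P.interior | legendre p v y ≤ R + Real.exp (a * b)}) :
    cutSlope a R (legendre p v x) = 0 := by
  rw [cutSlope, max_eq_right (hd.cutArg_nonpos hR hx hxK)]; simp

theorem CutData.cutSlopeDeriv_eq_zero (hd : CutData P p v a b) (hR : 1 ≤ R) (hx : x ∈ P.interior)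
    (hxK : x ∉ {y ∈ P.interior | legendre p v y ≤ R + Real.exp (a * b)}) :
    cutSlopeDeriv a R (legendre p v x) = 0 := by
  rw [cutSlopeDeriv, max_eq_right (hd.cutArg_nonpos hR hx hxK)]; simp

theorem ClassS.continuousOn_legendre (hv : ClassS P v) :
    ContinuousOn (legendre p v) P.interior :=
  (contDiffOn_legendre P.isOpen_interior hv.contDiffOn).continuousOn

theorem CutData.integrableOn_cut (hd : CutData P p v a b) (hv : ClassS P v) (hp : p ∈ P.interior)
    (hR : 1 ≤ R) {g : Vec n → ℝ} (hg : ContinuousOn g P.interior) :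
    IntegrableOn (fun x => cut a R (legendre p v x) * g x) P.interior :=
  integrableOn_of_compact_support P.isOpen_interior (hv.isCompact_sublevel hp _)
    (fun _ hy => hy.1) ((contDiff_cut.continuous.comp_continuousOn hv.continuousOn_legendre).mul hg)
    fun y hy hyK => by rw [hd.cut_eq_zero hR hy hyK, zero_mul]

theorem CutData.integrableOn_cutSlope (hd : CutData P p v a b) (hv : ClassS P v)
    (hp : p ∈ P.interior) (hR : 1 ≤ R) {g : Vec n → ℝ} (hg : ContinuousOn g P.interior) :
    IntegrableOn (fun x => cutSlope a R (legendre p v x) * g x) P.interior :=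
  integrableOn_of_compact_support P.isOpen_interior (hv.isCompact_sublevel hp _)
    (fun _ hy => hy.1)
    ((contDiff_cutSlope.continuous.comp_continuousOn hv.continuousOn_legendre).mul hg)
    fun y hy hyK => by rw [hd.cutSlope_eq_zero hR hy hyK, zero_mul]

theorem CutData.integrableOn_cutSlopeDeriv (hd : CutData P p v a b) (hv : ClassS P v)
    (hp : p ∈ P.interior) (hR : 1 ≤ R) {g : Vec n → ℝ} (hg : ContinuousOn g P.interior) :
    IntegrableOn (fun x => cutSlopeDeriv a R (legendre p v x) * g x) P.interior :=
  integrableOn_of_compact_support P.isOpen_interior (hv.isCompact_sublevel hp _)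
    (fun _ hy => hy.1)
    ((continuous_cutSlopeDeriv.comp_continuousOn hv.continuousOn_legendre).mul hg)
    fun y hy hyK => by rw [hd.cutSlopeDeriv_eq_zero hR hy hyK, zero_mul]

theorem CutData.cutSlope_le (hd : CutData P p v a b) (hR : 1 ≤ R) (hx : x ∈ P.interior) :
    cutSlope a R (legendre p v x) ≤
      3 * max (cutArg a R (legendre p v x)) 0 ^ 2 * ((1 + a * Real.exp (a * b)) / R) := by
  have h1 := exp_neg_le hd.a_pos (hd.le_legendre x hx)
  have ha := hd.a_pos
  have hR0 : 0 < R := by linarith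
  unfold cutSlope
  gcongr

theorem CutData.cutSlope_le' (hd : CutData P p v a b) (hR : 1 ≤ R) (hx : x ∈ P.interior) :
    cutSlope a R (legendre p v x) ≤
      3 * (1 + b + Real.exp (a * b)) ^ 2 * (1 + a * Real.exp (a * b)) / R := by
  have h1 := hd.cutSlope_le hR hx
  have h2 := max_cutArg_le hd.a_pos hR hd.b_nonneg (hd.le_legendre x hx)
  have ha := hd.a_pos
  have hR0 : 0 < R := by linarith
  rw [mul_div_assoc]
  refine h1.trans ?_
  gcongr

theorem OpenPolytope.continuousOn_poleSum : ContinuousOn (P.poleSum p) P.interior := by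
  unfold OpenPolytope.poleSum
  exact continuousOn_finsetSum _ fun k _ =>
    continuousOn_const.div (P.continuous_delta k).continuousOn fun x hx => (hx k).ne'

theorem OpenPolytope.poleSum_nonneg (hp : p ∈ P.interior) (hx : x ∈ P.interior) :
    0 ≤ P.poleSum p x :=
  Finset.sum_nonneg fun k _ => (div_pos (hp k) (hx k)).le

theorem OpenPolytope.radial_sum_log (hx : x ∈ P.interior) :
    radial p (fun y => ∑ k, Real.log (P.delta k y)) x = P.N - P.poleSum p x := by
  have hd : ∀ k, DifferentiableAt ℝ (P.delta k) x := fun k =>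
    (P.hasFDerivAt_delta k x).differentiableAt
  have hl : ∀ k, DifferentiableAt ℝ (fun y => Real.log (P.delta k y)) x := fun k =>
    (hd k).log (hx k).ne'
  have h1 : radial p (fun y => ∑ k, Real.log (P.delta k y)) x =
      ∑ k, radial p (fun y => Real.log (P.delta k y)) x := by
    simp [radial, fderiv_fun_sum fun k _ => hl k]
  have h2 : ∀ k, radial p (fun y => Real.log (P.delta k y)) x =
      1 - P.delta k p / P.delta k x := by
    intro k
    have := (hx k).ne'
    rw [radial_comp p (Real.hasDerivAt_log this) (hd k), P.radial_delta]
    field_simp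
  simp [h1, h2, OpenPolytope.poleSum]

theorem ClassS.radialHess_nonneg (hv : ClassS P v)
    (hu : ∀ y ∈ P.interior, IsUnit (hess v y).det) (hx : x ∈ P.interior) :
    0 ≤ radialHess p v x :=
  quadratic_form_nonneg (hv.posDef (hu x hx) hx).posSemidef fun i => x i - p i

set_option maxHeartbeats 1000000 in
/-- The main inequality with cutoffs. -/
theorem exists_setIntegral_cut_le (hp : p ∈ P.interior) (hv : ClassS P v)
    (hsol : SolvesAbreu P A v) (hAc : ContinuousOn A P.interior) (hU : TestFn P p U CU)
    (hd : CutData P p v a b) : ∃ C, ∀ R, 1 ≤ R →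
      (∫ x in P.interior, cut a R (legendre p v x) * ((hess v x)⁻¹ * hess U x).trace) +
        (∫ x in P.interior, cut a R (legendre p v x) * (A x * U x)) ≤
      C / R + ∫ x in P.interior, cutSlope a R (legendre p v x) * (U x * P.poleSum p x) := by
  have hO := P.isOpen_interior
  have hsm := hv.contDiffOn
  have hu : ∀ y ∈ P.interior, IsUnit (hess v y).det := fun y hy => (hsol y hy).1
  obtain ⟨C₀, hC₀, hdet⟩ := hv.exists_bound_det hp
  set L : Vec n → ℝ := fun y => ∑ k, Real.log (P.delta k y)
  have hL : ContDiffOn ℝ ∞ L P.interior := ContDiffOn.sum fun k _ => P.contDiffOn_log_delta k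
  have hG := contDiffOn_negLogDet hO hsm hu
  -- N is -log of det V ∏ δ_k, shifted by its bound log C₀ so as to be nonnegative. Only this sign
  -- and boundedness of N on compact sets are used.
  set N : Vec n → ℝ := fun y => negLogDet v y - L y + Real.log C₀
  have hN : ContDiffOn ℝ ∞ N P.interior := (hG.sub hL).add contDiffOn_const
  have hN0 : ∀ x ∈ P.interior, 0 ≤ N x := by
    intro x hx
    have h1 : 0 < (hess v x).det := (hv.posDef (hu x hx) hx).det_pos
    have h2 : 0 < ∏ k, P.delta k x := Finset.prod_pos fun k _ => hx k
    have h3 := Real.log_le_log (mul_pos h1 h2) (hdet x hx)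
    rw [Real.log_mul h1.ne' h2.ne', Real.log_prod fun k _ => (hx k).ne'] at h3
    simp only [N, L, negLogDet]; linarith
  have hNrad : ∀ x ∈ P.interior,
      radial p (negLogDet v) x = radial p N x + (P.N - P.poleSum p x) := by
    intro x hx
    have d1 := differentiableAt_of_contDiffOn hO hG hx
    have d2 := differentiableAt_of_contDiffOn hO hL hx
    rw [← P.radial_sum_log hx]
    simp only [radial, N]
    rw [fderiv_add_const, fderiv_fun_sub d1 d2]
    simp [L]
  have hEc : ContDiffOn ℝ ∞ (legendre p v) P.interior := contDiffOn_legendre hO hsm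
  have hEcont := hv.continuousOn_legendre (p := p)
  have hUc := hU.smooth.continuousOn
  have hNc := hN.continuousOn
  have hGr := (contDiffOn_radial hO hG p).continuousOn
  have hNr := (contDiffOn_radial hO hN p).continuousOn
  have hUr := (contDiffOn_radial hO hU.smooth p).continuousOn
  have hQ := (contDiffOn_radialHess (p := p) hO hsm).continuousOn
  have htr : ContinuousOn (fun x => ((hess v x)⁻¹ * hess U x).trace) P.interior := by
    simp only [Matrix.trace, Matrix.diag, Matrix.mul_apply]
    exact continuousOn_finsetSum _ fun i _ => continuousOn_finsetSum _ fun j _ =>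
      (contDiffOn_inv_hess hO hsm hu i j).continuousOn.mul
        (contDiffOn_hess hO hU.smooth j i).continuousOn
  set e := Real.exp (a * b)
  have he : 0 < e := Real.exp_pos _
  have ha := hd.a_pos
  have hb0 := hd.b_nonneg
  have hCU : 1 ≤ CU := (hU.one_le p (P.interior_subset_body hp)).trans
    (hU.le_bound p (P.interior_subset_body hp))
  set κ := (1 + a * e) * ((n + 1) * CU)
  have hκ : 0 < κ := by positivity
  -- Beyond level R₀ the growth of Q outweighs κ, so the bracket multiplying N in `b4` is
  -- nonpositive. R₀ does not depend on R.
  obtain ⟨R₀, hR₀⟩ := hd.growth (κ / a ^ 2)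
  obtain ⟨N₀, hN₀⟩ := (hv.isCompact_sublevel hp R₀).exists_bound_of_continuousOn
    (hNc.mono fun _ hy => hy.1)
  set T := 1 + b + e
  set C₁ := 3 * T ^ 2 * (1 + a * e) * CU + |N₀| * (3 * T ^ 2 * κ)
  refine ⟨C₁ * volume.real P.interior, fun R hR => ?_⟩
  have hR0 : 0 < R := by linarith
  set E := legendre p v
  set Q := radialHess p v
  have h1 := setIntegral_abreu (p := p) hO hsm hu (fun y hy => (hsol y hy).2) hU.smooth
    (φ := cut a R) (φ' := fun t => -cutSlope a R t) (fun t => hasDerivAt_cut) contDiff_cut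
    (hv.isCompact_sublevel hp _) (fun _ hy => hy.1) fun y hy hyK => hd.cut_eq_zero hR hy hyK
  -- Integration by parts along the radial field removes the derivative of N, on which no bound is
  -- available near the boundary.
  have h2 := setIntegral_radial (f := fun x => cutSlope a R (E x) * (U x * N x)) hO
    (hv.isCompact_sublevel hp _) (fun _ hy => hy.1)
    ((contDiff_cutSlope.comp_contDiffOn (hEc.of_le (by simp))).mul
      ((hU.smooth.mul hN).of_le (by simp)))
    (fun y hy hyK => by rw [hd.cutSlope_eq_zero hR hy hyK, zero_mul]) p
  have hrad : ∀ x ∈ P.interior, radial p (fun x => cutSlope a R (E x) * (U x * N x)) x =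
      cutSlopeDeriv a R (E x) * (Q x * (U x * N x)) +
        cutSlope a R (E x) * (radial p U x * N x + U x * radial p N x) := by
    intro x hx
    have dE := differentiableAt_of_contDiffOn hO hEc hx
    have dU := differentiableAt_of_contDiffOn hO hU.smooth hx
    have dN := differentiableAt_of_contDiffOn hO hN hx
    have dθ : DifferentiableAt ℝ (fun y => cutSlope a R (E y)) x :=
      hasDerivAt_cutSlope.differentiableAt.comp x dE
    rw [radial_mul p dθ (dU.fun_mul dN),
      radial_mul p dU dN, radial_comp p hasDerivAt_cutSlope dE, radial_legendre hO hsm hx]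
    ring
  set T1 : Vec n → ℝ := fun x => cut a R (E x) * ((hess v x)⁻¹ * hess U x).trace
  set T2 : Vec n → ℝ := fun x => cut a R (E x) * (A x * U x)
  set S1 : Vec n → ℝ := fun x => cutSlope a R (E x) * (radial p U x - U x * (P.N - P.poleSum p x) +
    N x * (n * U x + radial p U x))
  set S2 : Vec n → ℝ := fun x => cutSlopeDeriv a R (E x) * (Q x * (U x * N x))
  set S3 : Vec n → ℝ := fun x => cutSlope a R (E x) *
    (n * (U x * N x) + (radial p U x * N x + U x * radial p N x))
  have iT1 : IntegrableOn T1 P.interior := hd.integrableOn_cut hv hp hR htr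
  have iT2 : IntegrableOn T2 P.interior := hd.integrableOn_cut hv hp hR (hAc.mul hUc)
  have hYc := P.continuousOn_poleSum (p := p)
  have iS1 : IntegrableOn S1 P.interior := hd.integrableOn_cutSlope hv hp hR (by fun_prop)
  have iS2 : IntegrableOn S2 P.interior := hd.integrableOn_cutSlopeDeriv hv hp hR (by fun_prop)
  have iS3 : IntegrableOn S3 P.interior := hd.integrableOn_cutSlope hv hp hR (by fun_prop)
  have e2 : (∫ x in P.interior, S2 x) + ∫ x in P.interior, S3 x = 0 := by
    rw [← integral_add iS2 iS3, ← h2]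
    refine setIntegral_congr_fun hO.measurableSet fun x hx => ?_
    simp only [S2, S3]
    rw [hrad x hx]; ring
  have e1 : (∫ x in P.interior, T1 x) + (∫ x in P.interior, T2 x) -
      (∫ x in P.interior, S1 x) + ∫ x in P.interior, S3 x = 0 := by
    have j1 := integral_add iT1 iT2
    have j2 := integral_sub (f := fun x => T1 x + T2 x) (iT1.add iT2) iS1
    have j3 := integral_add (f := fun x => T1 x + T2 x - S1 x) ((iT1.add iT2).sub iS1) iS3
    rw [← j1, ← j2, ← j3, ← h1]
    refine setIntegral_congr_fun hO.measurableSet fun x hx => ?_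
    simp only [T1, T2, S1, S3]
    rw [hNrad x hx]; ring
  have e3 : (∫ x in P.interior, T1 x) + (∫ x in P.interior, T2 x) =
      ∫ x in P.interior, (S1 x + S2 x) := by
    rw [integral_add iS1 iS2]; linarith
  rw [e3]
  have iY : IntegrableOn (fun x => cutSlope a R (E x) * (U x * P.poleSum p x)) P.interior :=
    hd.integrableOn_cutSlope hv hp hR (by fun_prop)
  have ic : IntegrableOn (fun _ : Vec n => C₁ / R) P.interior :=
    integrableOn_const (P.volume_interior_lt_top.ne)
  have hfin : (∫ x in P.interior, (S1 x + S2 x)) ≤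
      ∫ x in P.interior, (C₁ / R + cutSlope a R (E x) * (U x * P.poleSum p x)) := by
    refine setIntegral_mono_on (iS1.add iS2) (ic.add iY) hO.measurableSet fun x hx => ?_
    have hxb := P.interior_subset_body hx
    set m := max (cutArg a R (E x)) 0
    have hm0 : 0 ≤ m := le_max_right _ _
    have hmT : m ≤ T := max_cutArg_le ha hR hb0 (hd.le_legendre x hx)
    have hθ0 : 0 ≤ cutSlope a R (E x) := cutSlope_nonneg ha hR0
    have hθ1 : cutSlope a R (E x) ≤ 3 * m ^ 2 * ((1 + a * e) / R) := hd.cutSlope_le hR hx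
    have hθ2 : cutSlope a R (E x) ≤ 3 * T ^ 2 * (1 + a * e) / R := hd.cutSlope_le' hR hx
    have hθ' : cutSlopeDeriv a R (E x) ≤ -(3 * m ^ 2 * (a ^ 2 * Real.exp (-(a * E x)) / R)) :=
      cutSlopeDeriv_le
    have hQ0 : 0 ≤ Q x := hv.radialHess_nonneg hu hx
    have hU1 := hU.one_le x hxb
    have hUC := hU.le_bound x hxb
    have hUr' := hU.radial_le x hx
    have hNx := hN0 x hx
    have b1 : cutSlope a R (E x) * radial p U x ≤ 3 * T ^ 2 * (1 + a * e) * CU / R := by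
      calc _ ≤ cutSlope a R (E x) * CU := mul_le_mul_of_nonneg_left hUr' hθ0
        _ ≤ 3 * T ^ 2 * (1 + a * e) / R * CU := mul_le_mul_of_nonneg_right hθ2 (by linarith)
        _ = _ := by ring
    have b2 : 0 ≤ cutSlope a R (E x) * (U x * P.N) :=
      mul_nonneg hθ0 (mul_nonneg (by linarith) (Nat.cast_nonneg _))
    -- The total coefficient of N. The first term is harmful, of size κ; the second is helpful,
    -- since the slope of the cutoff decreases while E increases along rays at rate Q.
    have b3 : cutSlope a R (E x) * (n * U x + radial p U x) + cutSlopeDeriv a R (E x) * (Q x * U x) ≤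
        3 * m ^ 2 / R * (κ - a ^ 2 * Real.exp (-(a * E x)) * Q x) := by
      have c1 : cutSlope a R (E x) * (n * U x + radial p U x) ≤
          3 * m ^ 2 * ((1 + a * e) / R) * ((n + 1) * CU) := by
        have : n * U x + radial p U x ≤ (n + 1) * CU := by
          have : (n:ℝ) * U x ≤ n * CU := mul_le_mul_of_nonneg_left hUC (Nat.cast_nonneg _)
          linarith
        calc _ ≤ cutSlope a R (E x) * ((n + 1) * CU) := mul_le_mul_of_nonneg_left this hθ0
          _ ≤ _ := mul_le_mul_of_nonneg_right hθ1 (by positivity)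
      have c2 : cutSlopeDeriv a R (E x) * (Q x * U x) ≤
          -(3 * m ^ 2 * (a ^ 2 * Real.exp (-(a * E x)) / R)) * Q x := by
        have d0 : 0 ≤ 3 * m ^ 2 * (a ^ 2 * Real.exp (-(a * E x)) / R) := by positivity
        have d1 : Q x ≤ Q x * U x := le_mul_of_one_le_right hQ0 hU1
        calc _ ≤ -(3 * m ^ 2 * (a ^ 2 * Real.exp (-(a * E x)) / R)) * (Q x * U x) :=
              mul_le_mul_of_nonneg_right hθ' (mul_nonneg hQ0 (by linarith))
          _ ≤ _ := mul_le_mul_of_nonpos_left d1 (neg_nonpos.2 d0)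
      calc _ ≤ 3 * m ^ 2 * ((1 + a * e) / R) * ((n + 1) * CU) +
            -(3 * m ^ 2 * (a ^ 2 * Real.exp (-(a * E x)) / R)) * Q x := add_le_add c1 c2
        _ = _ := by simp only [κ]; ring
    have b4 : N x * (3 * m ^ 2 / R * (κ - a ^ 2 * Real.exp (-(a * E x)) * Q x)) ≤
        |N₀| * (3 * T ^ 2 * κ) / R := by
      -- Below level R₀, a compact set, N is bounded and the whole term is O(1/R); above it the
      -- bracket is nonpositive.
      by_cases hE : E x ≤ R₀
      · have hNle : N x ≤ |N₀| := by
          have := hN₀ x ⟨hx, hE⟩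
          rw [Real.norm_eq_abs, abs_of_nonneg hNx] at this
          exact this.trans (le_abs_self _)
        have d2 : κ - a ^ 2 * Real.exp (-(a * E x)) * Q x ≤ κ := by
          have : 0 ≤ a ^ 2 * Real.exp (-(a * E x)) * Q x := by positivity
          linarith
        have d3 : 3 * m ^ 2 / R * (κ - a ^ 2 * Real.exp (-(a * E x)) * Q x) ≤
            3 * T ^ 2 / R * κ := by
          calc _ ≤ 3 * m ^ 2 / R * κ := mul_le_mul_of_nonneg_left d2 (by positivity)
            _ ≤ _ := by gcongr
        calc _ ≤ N x * (3 * T ^ 2 / R * κ) := mul_le_mul_of_nonneg_left d3 hNx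
          _ ≤ |N₀| * (3 * T ^ 2 / R * κ) := mul_le_mul_of_nonneg_right hNle (by positivity)
          _ = _ := by ring
      · have := hR₀ x hx (not_le.1 hE)
        have d4 : κ ≤ a ^ 2 * Real.exp (-(a * E x)) * Q x := by
          calc κ = a ^ 2 * Real.exp (-(a * E x)) * (κ / a ^ 2 * Real.exp (a * E x)) := by
                rw [Real.exp_neg]; field_simp
            _ ≤ _ := mul_le_mul_of_nonneg_left this (by positivity)
        have d5 : N x * (3 * m ^ 2 / R * (κ - a ^ 2 * Real.exp (-(a * E x)) * Q x)) ≤ 0 :=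
          mul_nonpos_of_nonneg_of_nonpos hNx
            (mul_nonpos_of_nonneg_of_nonpos (by positivity) (by linarith))
        exact d5.trans (by positivity)
    have b5 := mul_le_mul_of_nonneg_left b3 hNx
    have b6 : C₁ / R = 3 * T ^ 2 * (1 + a * e) * CU / R + |N₀| * (3 * T ^ 2 * κ) / R := by
      simp only [C₁]; ring
    simp only [S1, S2]
    rw [b6]
    have b7 : cutSlope a R (E x) * (radial p U x - U x * (P.N - P.poleSum p x) +
        N x * (n * U x + radial p U x)) + cutSlopeDeriv a R (E x) * (Q x * (U x * N x)) =
        cutSlope a R (E x) * radial p U x - cutSlope a R (E x) * (U x * P.N) +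
        cutSlope a R (E x) * (U x * P.poleSum p x) +
        N x * (cutSlope a R (E x) * (n * U x + radial p U x) +
          cutSlopeDeriv a R (E x) * (Q x * U x)) := by ring
    rw [b7]
    linarith
  refine hfin.trans (le_of_eq ?_)
  rw [integral_add ic iY, setIntegral_const, smul_eq_mul]
  ring

end Main

/-! ### The pole term converges to the boundary integral -/

section Boundary

variable {n : ℕ} {P : OpenPolytope n} {p x z : Vec n} {v A U : Vec n → ℝ} {a b CU R : ℝ}

theorem measurable_indicator_ofReal {Ω : Set (Vec n)} (hΩ : IsOpen Ω) {f : Vec n → ℝ}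
    (hf : ContinuousOn f Ω) : Measurable (Ω.indicator fun x => ENNReal.ofReal (f x)) := by
  classical
  rw [← piecewise_eq_indicator]
  exact ContinuousOn.measurable_piecewise (ENNReal.continuous_ofReal.comp_continuousOn hf)
    continuousOn_const hΩ.measurableSet

theorem OpenPolytope.ae_sigma_mem : ∀ᵐ z ∂P.sigma, z ∈ P.body := by
  rw [P.sigma_eq_sum, ← Measure.sum_fintype, Measure.ae_sum_iff]
  intro k
  filter_upwards [P.ae_sigmaFacet_mem k] with z hz using hz.1

theorem OpenPolytope.isFiniteMeasure_sigma (hp : p ∈ P.interior) : IsFiniteMeasure P.sigma := by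
  have := fun k => P.isFiniteMeasure_sigmaFacet hp k
  rw [P.sigma_eq_sum]
  infer_instance

theorem OpenPolytope.integrable_sigma (hp : p ∈ P.interior) {f : Vec n → ℝ}
    (hf : ContinuousOn f P.body) : Integrable f P.sigma := by
  have := P.isFiniteMeasure_sigma hp
  rw [← Measure.restrict_eq_self_of_ae_mem P.ae_sigma_mem]
  exact hf.integrableOn_compact P.isCompact_body

/-- Along the ray ψ(s) = φ(E) satisfies θ(E)Q = -sψ', so the part of the integrand dominated by Q
integrates to at most α(ψ(0) - ψ(1)), with ψ(1) = 0. The remainder is O(1/R) since θ is. -/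
theorem CutData.setLIntegral_ray_le (hd : CutData P p v a b) (hv : ClassS P v)
    (hu : ∀ y ∈ P.interior, IsUnit (hess v y).det) (hp : p ∈ P.interior) (hR : 1 ≤ R)
    (hz : z ∈ P.body) (hzi : z ∉ P.interior) {α β : ℝ} (hα : 0 ≤ α) (hβ : 0 ≤ β)
    (hY : ∀ s ∈ Ioo (0:ℝ) 1, P.poleSum p (p + s • (z - p)) ≤
      α * radialHess p v (p + s • (z - p)) + β) :
    ∫⁻ s in Ioo (0:ℝ) 1, ENNReal.ofReal (cutSlope a R (legendre p v (p + s • (z - p))) *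
      P.poleSum p (p + s • (z - p))) ≤
    ENNReal.ofReal (α * cut a R (legendre p v p) +
      β * (3 * (1 + b + Real.exp (a * b)) ^ 2 * (1 + a * Real.exp (a * b)) / R)) := by
  have hO := P.isOpen_interior
  have hsm := hv.contDiffOn
  set c := 3 * (1 + b + Real.exp (a * b)) ^ 2 * (1 + a * Real.exp (a * b)) / R
  -- Extending φ(E) by zero gives a C¹ function on the whole space, so the fundamental theorem of
  -- calculus applies on the closed segment up to the boundary point z.
  set Φ : Vec n → ℝ := P.interior.indicator fun y => cut a R (legendre p v y)
  have hΦΩ : EqOn Φ (fun y => cut a R (legendre p v y)) P.interior := fun y hy =>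
    indicator_of_mem hy _
  have hΦ : ContDiff ℝ 1 Φ := by
    refine contDiff_of_compact_support hO (hv.isCompact_sublevel hp (R + Real.exp (a * b)))
      (fun _ hy => hy.1) (((contDiff_cut (a := a) (R := R)).comp_contDiffOn
        ((contDiffOn_legendre (p := p) hO hsm).of_le (by simp))).congr hΦΩ) fun y hyK => ?_
    by_cases hy : y ∈ P.interior
    · rw [hΦΩ hy]; exact hd.cut_eq_zero hR hy hyK
    · exact indicator_of_notMem hy _
  set ψ : ℝ → ℝ := fun s => Φ (p + s • (z - p))
  set ψ' : ℝ → ℝ := fun s => fderiv ℝ Φ (p + s • (z - p)) (z - p)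
  have hψ : ∀ s, HasDerivAt ψ (ψ' s) s := by
    intro s
    have h1 : HasDerivAt (fun s : ℝ => p + s • (z - p)) (z - p) s := by
      simpa using ((hasDerivAt_id s).smul_const (z - p)).const_add p
    exact ((hΦ.differentiable (by simp)) _).hasFDerivAt.comp_hasDerivAt s h1
  have hψc : Continuous ψ' := by
    have := hΦ.continuous_fderiv (by simp)
    exact (this.comp (by fun_prop)).clm_apply continuous_const
  have hray : ∀ s ∈ Ioo (0:ℝ) 1, p + s • (z - p) ∈ P.interior := fun s hs =>
    P.ray_mem_interior hp hz hs.1.le hs.2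
  have hQψ : ∀ s ∈ Ioo (0:ℝ) 1, cutSlope a R (legendre p v (p + s • (z - p))) *
      radialHess p v (p + s • (z - p)) = s * -ψ' s := by
    intro s hs
    have hx := hray s hs
    have h1 : radial p Φ (p + s • (z - p)) = s * ψ' s := by
      simp [radial, ψ', add_sub_cancel_left]
    have h2 : radial p Φ (p + s • (z - p)) =
        radial p (fun y => cut a R (legendre p v y)) (p + s • (z - p)) := by
      simp only [radial]
      rw [(hΦΩ.eventuallyEq_of_mem (hO.mem_nhds hx)).fderiv_eq]
    rw [radial_comp p hasDerivAt_cut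
      (differentiableAt_of_contDiffOn hO (contDiffOn_legendre hO hsm) hx),
      radial_legendre hO hsm hx] at h2
    linarith
  have hle : ∀ s ∈ Ioo (0:ℝ) 1, cutSlope a R (legendre p v (p + s • (z - p))) *
      P.poleSum p (p + s • (z - p)) ≤ α * -ψ' s + β * c := by
    intro s hs
    have hx := hray s hs
    have hθ0 : 0 ≤ cutSlope a R (legendre p v (p + s • (z - p))) :=
      cutSlope_nonneg hd.a_pos (by linarith)
    have hQ := hv.radialHess_nonneg (p := p) hu hx
    have h1 := hQψ s hs
    have h2 : 0 ≤ -ψ' s := by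
      have : 0 ≤ s * -ψ' s := h1 ▸ mul_nonneg hθ0 hQ
      exact nonneg_of_mul_nonneg_right this hs.1
    have h3 : s * -ψ' s ≤ -ψ' s := mul_le_of_le_one_left h2 hs.2.le
    calc _ ≤ cutSlope a R (legendre p v (p + s • (z - p))) *
          (α * radialHess p v (p + s • (z - p)) + β) := mul_le_mul_of_nonneg_left (hY s hs) hθ0
      _ = α * (s * -ψ' s) + β * cutSlope a R (legendre p v (p + s • (z - p))) := by
        rw [← h1]; ring
      _ ≤ _ := add_le_add (mul_le_mul_of_nonneg_left h3 hα)
        (mul_le_mul_of_nonneg_left (hd.cutSlope_le' hR hx) hβ)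
  have hcont : Continuous fun s => α * -ψ' s + β * c := by fun_prop
  have hint : IntegrableOn (fun s => α * -ψ' s + β * c) (Ioo (0:ℝ) 1) :=
    (hcont.integrableOn_Icc (a := 0) (b := 1)).mono_set Ioo_subset_Icc_self
  have hnn : 0 ≤ᵐ[volume.restrict (Ioo (0:ℝ) 1)] fun s => α * -ψ' s + β * c := by
    filter_upwards [ae_restrict_mem measurableSet_Ioo] with s hs
    exact (mul_nonneg (cutSlope_nonneg hd.a_pos (by linarith))
      (P.poleSum_nonneg hp (hray s hs))).trans (hle s hs)
  have hval : ∫ s in Ioo (0:ℝ) 1, (α * -ψ' s + β * c) =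
      α * cut a R (legendre p v p) + β * c := by
    rw [← integral_Ioc_eq_integral_Ioo, ← intervalIntegral.integral_of_le zero_le_one]
    have h1 : ∀ s ∈ uIcc (0:ℝ) 1, HasDerivAt (fun s => α * -ψ s + β * c * s)
        (α * -ψ' s + β * c) s := fun s _ => by
      simpa using ((hψ s).fun_neg.const_mul α).fun_add ((hasDerivAt_id' s).const_mul (β * c))
    rw [intervalIntegral.integral_eq_sub_of_hasDerivAt h1 (hcont.intervalIntegrable _ _)]
    have h2 : ψ 0 = cut a R (legendre p v p) := by
      simp only [ψ, zero_smul, add_zero]; exact hΦΩ hp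
    have h3 : ψ 1 = 0 := by
      simp only [ψ, one_smul, add_sub_cancel]; exact indicator_of_notMem hzi _
    rw [h2, h3]; ring
  calc _ ≤ ∫⁻ s in Ioo (0:ℝ) 1, ENNReal.ofReal (α * -ψ' s + β * c) :=
        setLIntegral_mono' measurableSet_Ioo fun s hs => ENNReal.ofReal_le_ofReal (hle s hs)
    _ = _ := by rw [← ofReal_integral_eq_lintegral_ofReal hint hnn, hval]

/-- Constants uniform over all rays; they only provide the dominating function for the limit. -/
theorem ClassS.exists_poleSum_le (hv : ClassS P v) (hp : p ∈ P.interior) :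
    ∃ α ≥ 0, ∃ β ≥ 0, ∀ x ∈ P.interior, P.poleSum p x ≤ α * radialHess p v x + β := by
  obtain ⟨C, hC, h⟩ := hv.exists_le_radialHess hp
  have hα : 0 ≤ ∑ k, (P.delta k p)⁻¹ := Finset.sum_nonneg fun k _ => (inv_pos.2 (hp k)).le
  refine ⟨∑ k, (P.delta k p)⁻¹, hα, (∑ k, (P.delta k p)⁻¹) * C, by positivity, fun x hx => ?_⟩
  rw [← mul_add]
  refine le_trans ?_ (mul_le_mul_of_nonneg_left (h x hx) hα)
  rw [OpenPolytope.poleSum, Finset.mul_sum]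
  refine Finset.sum_le_sum fun k _ => ?_
  have h1 : (P.delta k p)⁻¹ ≤ ∑ k, (P.delta k p)⁻¹ :=
    Finset.single_le_sum (f := fun k => (P.delta k p)⁻¹) (fun k _ => (inv_pos.2 (hp k)).le)
      (Finset.mem_univ k)
  have h2 : P.delta k p / P.delta k x = (P.delta k p)⁻¹ * (P.delta k p ^ 2 / P.delta k x) := by
    have := (hp k).ne'
    field_simp
  rw [h2]
  exact mul_le_mul_of_nonneg_right h1 (div_pos (pow_pos (hp k) 2) (hx k)).le

/-- On a ray ending inside the k-th facet only δ_k tends to zero, so the sharp coefficient 1/δ_k(p)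
is available. It cancels the Jacobian factor δ_k(p) of polar coordinates and yields the exact
density of σ; β may depend on the ray. -/
theorem ClassS.exists_poleSum_ray_le (hv : ClassS P v) (hp : p ∈ P.interior) {k : Fin P.N}
    (hz : z ∈ P.body) (hzj : ∀ j, j ≠ k → 0 < P.delta j z) :
    ∃ β ≥ 0, ∀ s ∈ Ioo (0:ℝ) 1, P.poleSum p (p + s • (z - p)) ≤
      (P.delta k p)⁻¹ * radialHess p v (p + s • (z - p)) + β := by
  obtain ⟨C, hC, h⟩ := hv.exists_le_radialHess hp
  have hk := hp k
  set β' := ∑ j ∈ Finset.univ.erase k, P.delta j p / min (P.delta j p) (P.delta j z)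
  have hβ' : 0 ≤ β' := Finset.sum_nonneg fun j hj => by
    have h1 := hp j
    have h2 := hzj j (Finset.ne_of_mem_erase hj)
    exact (div_pos h1 (lt_min h1 h2)).le
  refine ⟨(P.delta k p)⁻¹ * C + β', by positivity, fun s hs => ?_⟩
  have hx : p + s • (z - p) ∈ P.interior := P.ray_mem_interior hp hz hs.1.le hs.2
  have h1 : P.delta k p / P.delta k (p + s • (z - p)) ≤
      (P.delta k p)⁻¹ * (radialHess p v (p + s • (z - p)) + C) := by
    have h2 : P.delta k p ^ 2 / P.delta k (p + s • (z - p)) ≤ _ :=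
      (Finset.single_le_sum (f := fun k => P.delta k p ^ 2 / P.delta k (p + s • (z - p)))
        (fun k _ => (div_pos (pow_pos (hp k) 2) (hx k)).le) (Finset.mem_univ k)).trans (h _ hx)
    calc _ = (P.delta k p)⁻¹ * (P.delta k p ^ 2 / P.delta k (p + s • (z - p))) := by
          have := hk.ne'
          field_simp
      _ ≤ _ := mul_le_mul_of_nonneg_left h2 (inv_pos.2 hk).le
  have h3 : ∑ j ∈ Finset.univ.erase k, P.delta j p / P.delta j (p + s • (z - p)) ≤ β' := by
    refine Finset.sum_le_sum fun j hj => ?_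
    have e1 := hp j
    have e2 := hzj j (Finset.ne_of_mem_erase hj)
    refine div_le_div_of_nonneg_left e1.le (lt_min e1 e2) ?_
    rw [P.delta_ray]
    have m1 := min_le_left (P.delta j p) (P.delta j z)
    have m2 := min_le_right (P.delta j p) (P.delta j z)
    nlinarith [hs.1, hs.2]
  rw [OpenPolytope.poleSum, ← Finset.add_sum_erase _ _ (Finset.mem_univ k)]
  linarith

theorem CutData.cut_le (hd : CutData P p v a b) (hR : 1 ≤ R) (hx : x ∈ P.interior) :
    cut a R (legendre p v x) ≤ (1 + b + Real.exp (a * b)) ^ 3 :=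
  pow_le_pow_left₀ (le_max_right _ _)
    (max_cutArg_le hd.a_pos hR hd.b_nonneg (hd.le_legendre x hx)) 3

theorem OpenPolytope.notMem_interior_of_mem_facetSet {k : Fin P.N} (hz : z ∈ P.facetSet k) :
    z ∉ P.interior := fun h => (h k).ne' hz.2

/-- The contribution of the poles of `log det` near the facets. -/
theorem CutData.eventually_setLIntegral_facet_le (hd : CutData P p v a b) (hv : ClassS P v)
    (hu : ∀ y ∈ P.interior, IsUnit (hess v y).det) (hp : p ∈ P.interior)
    (hU : TestFn P p U CU) (k : Fin P.N) {ε : ℝ≥0∞} (hε : ε ≠ 0) :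
    ∀ᶠ m : ℕ in Filter.atTop, ENNReal.ofReal (P.delta k p) *
      (∫⁻ z, (∫⁻ s in Ioo (0:ℝ) 1, ENNReal.ofReal (s ^ (n - 1)) *
        P.interior.indicator (fun x => ENNReal.ofReal (cutSlope a (m + 1) (legendre p v x) *
          (U x * P.poleSum p x))) (p + s • (z - p))) ∂P.sigmaFacet k) ≤
      (∫⁻ z, ENNReal.ofReal (U z) ∂P.sigmaFacet k) + ε := by
  have := P.isFiniteMeasure_sigmaFacet hp k
  have hO := P.isOpen_interior
  have hR : ∀ m : ℕ, (1:ℝ) ≤ m + 1 := fun m => by simp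
  set g : ℕ → Vec n → ℝ≥0∞ := fun m => P.interior.indicator (fun x => ENNReal.ofReal
    (cutSlope a (m + 1) (legendre p v x) * (U x * P.poleSum p x)))
  have hg : ∀ m, Measurable (g m) := by
    intro m
    have hc : ContinuousOn (fun x => cutSlope a (m + 1) (legendre p v x) *
        (U x * P.poleSum p x)) P.interior :=
      (contDiff_cutSlope.continuous.comp_continuousOn hv.continuousOn_legendre).mul
        (hU.smooth.continuousOn.mul P.continuousOn_poleSum)
    exact measurable_indicator_ofReal hO hc
  set K : ℕ → Vec n → ℝ≥0∞ := fun m z => ENNReal.ofReal (P.delta k p) *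
    ∫⁻ s in Ioo (0:ℝ) 1, ENNReal.ofReal (s ^ (n - 1)) * g m (p + s • (z - p))
  have hKm' : ∀ m, Measurable fun z => ∫⁻ s in Ioo (0:ℝ) 1,
      ENNReal.ofReal (s ^ (n - 1)) * g m (p + s • (z - p)) := by
    intro m
    refine Measurable.lintegral_prod_right' (f := fun q : Vec n × ℝ =>
      ENNReal.ofReal (q.2 ^ (n - 1)) * g m (p + q.2 • (q.1 - p))) ?_
    have h1 : Measurable fun q : Vec n × ℝ => p + q.2 • (q.1 - p) :=
      Continuous.measurable (by fun_prop)
    have h2 : Measurable fun q : Vec n × ℝ => ENNReal.ofReal (q.2 ^ (n - 1)) :=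
      ENNReal.measurable_ofReal.comp (by fun_prop)
    exact h2.mul ((hg m).comp h1)
  have hKm : ∀ m, Measurable (K m) := fun m => (hKm' m).const_mul _
  set c := 3 * (1 + b + Real.exp (a * b)) ^ 2 * (1 + a * Real.exp (a * b))
  have ha := hd.a_pos
  have hb := hd.b_nonneg
  have hKle : ∀ m z, z ∈ P.facetSet k → ∀ α β : ℝ, 0 ≤ α → 0 ≤ β →
      (∀ s ∈ Ioo (0:ℝ) 1, P.poleSum p (p + s • (z - p)) ≤
        α * radialHess p v (p + s • (z - p)) + β) →
      K m z ≤ ENNReal.ofReal (P.delta k p * U z *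
        (α * cut a (m + 1) (legendre p v p) + β * (c / (m + 1)))) := by
    intro m z hz α β hα hβ hY
    have hUz : 0 ≤ U z := zero_le_one.trans (hU.one_le z hz.1)
    have h1 := hd.setLIntegral_ray_le hv hu hp (hR m) hz.1
      (P.notMem_interior_of_mem_facetSet hz) hα hβ hY
    rw [mul_assoc, ENNReal.ofReal_mul (hp k).le, ENNReal.ofReal_mul hUz]
    refine mul_le_mul_right (le_trans ?_ (mul_le_mul_right h1 _)) _
    rw [← lintegral_const_mul' _ _ ENNReal.ofReal_ne_top]
    refine setLIntegral_mono' measurableSet_Ioo fun s hs => ?_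
    have hx := P.ray_mem_interior hp hz.1 hs.1.le hs.2
    simp only [g, indicator_of_mem hx]
    have hs1 : ENNReal.ofReal (s ^ (n - 1)) ≤ 1 := by
      rw [← ENNReal.ofReal_one]
      exact ENNReal.ofReal_le_ofReal (pow_le_one₀ hs.1.le hs.2.le)
    refine (mul_le_of_le_one_left zero_le hs1).trans ?_
    rw [← ENNReal.ofReal_mul hUz]
    refine ENNReal.ofReal_le_ofReal ?_
    have e1 := hU.ray_le z hz.1 s hs
    have e2 : 0 ≤ cutSlope a (m + 1) (legendre p v (p + s • (z - p))) *
        P.poleSum p (p + s • (z - p)) :=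
      mul_nonneg (cutSlope_nonneg ha (by positivity)) (P.poleSum_nonneg hp hx)
    calc _ = U (p + s • (z - p)) * (cutSlope a (m + 1) (legendre p v (p + s • (z - p))) *
        P.poleSum p (p + s • (z - p))) := by ring
      _ ≤ _ := mul_le_mul_of_nonneg_right e1 e2
  obtain ⟨α, hα, β, hβ, hαβ⟩ := hv.exists_poleSum_le hp
  have hCU : 1 ≤ CU := (hU.one_le p (P.interior_subset_body hp)).trans
    (hU.le_bound p (P.interior_subset_body hp))
  have hbd : ∀ m, K m ≤ᵐ[P.sigmaFacet k] fun _ => ENNReal.ofReal (P.delta k p * CU *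
      (α * (1 + b + Real.exp (a * b)) ^ 3 + β * c)) := by
    intro m
    filter_upwards [P.ae_sigmaFacet_mem k] with z hz
    refine (hKle m z hz α β hα hβ fun s hs =>
      hαβ _ (P.ray_mem_interior hp hz.1 hs.1.le hs.2)).trans (ENNReal.ofReal_le_ofReal ?_)
    have e1 := hU.le_bound z hz.1
    have e2 := hd.cut_le (hR m) hp
    have e3 : c / (m + 1) ≤ c := div_le_self (by positivity) (hR m)
    have e4 := (hp k).le
    have e5 : 0 ≤ cut a (m + 1) (legendre p v p) := cut_nonneg
    gcongr
  -- Almost every z lies on no other facet. There the ray bound tends to U z, since the cutoff at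
  -- E(p) tends to 1 and the O(1/R) term to 0.
  have hlim : ∫⁻ z, Filter.limsup (fun m => K m z) Filter.atTop ∂P.sigmaFacet k ≤
      ∫⁻ z, ENNReal.ofReal (U z) ∂P.sigmaFacet k := by
    refine lintegral_mono_ae ?_
    filter_upwards [P.ae_sigmaFacet_mem k, P.ae_sigmaFacet_delta_pos hp k] with z hz hzj
    obtain ⟨β', hβ', h⟩ := hv.exists_poleSum_ray_le hp hz.1 hzj
    have ht : Filter.Tendsto (fun m : ℕ => ENNReal.ofReal (P.delta k p * U z *
        ((P.delta k p)⁻¹ * cut a (m + 1) (legendre p v p) + β' * (c / (m + 1)))))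
        Filter.atTop (nhds (ENNReal.ofReal (P.delta k p * U z *
          ((P.delta k p)⁻¹ * 1 + β' * 0)))) := by
      refine (ENNReal.continuous_ofReal.tendsto _).comp ?_
      refine Filter.Tendsto.const_mul _ ((tendsto_cut.const_mul _).add
        (Filter.Tendsto.const_mul _ ?_))
      have := (tendsto_one_div_add_atTop_nhds_zero_nat (𝕜 := ℝ)).const_mul c
      simpa [div_eq_mul_inv] using this
    have e1 : P.delta k p * U z * ((P.delta k p)⁻¹ * 1 + β' * 0) = U z := by
      have := (hp k).ne'
      field_simp
      ring
    rw [e1] at ht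
    rw [← ht.limsup_eq]
    exact Filter.limsup_le_limsup (Filter.Eventually.of_forall fun m =>
      hKle m z hz _ β' (inv_pos.2 (hp k)).le hβ' h)
  -- Reverse Fatou lemma, with the constant majorant from `hbd` on a finite measure.
  have hls := limsup_lintegral_le (μ := P.sigmaFacet k) (f := K) (fun _ => ENNReal.ofReal (P.delta k p * CU *
      (α * (1 + b + Real.exp (a * b)) ^ 3 + β * c))) hKm hbd (by
        rw [lintegral_const]; exact ENNReal.mul_ne_top ENNReal.ofReal_ne_top (measure_ne_top _ _))
  have hfin : ∫⁻ z, ENNReal.ofReal (U z) ∂P.sigmaFacet k ≠ ⊤ := by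
    refine ne_top_of_le_ne_top (b := ∫⁻ _, ENNReal.ofReal CU ∂P.sigmaFacet k) ?_
      (lintegral_mono_ae ?_)
    · rw [lintegral_const]; exact ENNReal.mul_ne_top ENNReal.ofReal_ne_top (measure_ne_top _ _)
    · filter_upwards [P.ae_sigmaFacet_mem k] with z hz
      exact ENNReal.ofReal_le_ofReal (hU.le_bound z hz.1)
  have hev := Filter.eventually_lt_of_limsup_lt
    ((hls.trans hlim).trans_lt (ENNReal.lt_add_right hfin hε))
  filter_upwards [hev] with m hm
  rw [← lintegral_const_mul _ (hKm' m)]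
  exact hm.le

theorem CutData.eventually_setIntegral_poleSum_le (hd : CutData P p v a b) (hv : ClassS P v)
    (hu : ∀ y ∈ P.interior, IsUnit (hess v y).det) (hn : n ≠ 0) (hp : p ∈ P.interior)
    (hU : TestFn P p U CU) {ε : ℝ} (hε : 0 < ε) :
    ∀ᶠ m : ℕ in Filter.atTop, ∫ x in P.interior, cutSlope a (m + 1) (legendre p v x) *
      (U x * P.poleSum p x) ≤ (∫ x, U x ∂P.sigma) + ε := by
  have := fun k => P.isFiniteMeasure_sigmaFacet hp k
  have := P.nonempty_facets hn hp
  have hN : (0:ℝ) < P.N := by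
    have := Fin.pos_iff_nonempty.2 this
    exact_mod_cast this
  have hO := P.isOpen_interior
  have hε' : ENNReal.ofReal (ε / P.N) ≠ 0 := by
    simpa using div_pos hε hN
  have hev := Filter.eventually_all.2 fun k =>
    hd.eventually_setLIntegral_facet_le hv hu hp hU k hε'
  filter_upwards [hev] with m hm
  set f : Vec n → ℝ := fun x => cutSlope a (m + 1) (legendre p v x) * (U x * P.poleSum p x)
  have hR : (1:ℝ) ≤ m + 1 := by simp
  have hc : ContinuousOn (fun x => U x * P.poleSum p x) P.interior :=
    hU.smooth.continuousOn.mul P.continuousOn_poleSum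
  have hf : IntegrableOn f P.interior := hd.integrableOn_cutSlope hv hp hR hc
  have hf0 : 0 ≤ᵐ[volume.restrict P.interior] f := by
    filter_upwards [ae_restrict_mem hO.measurableSet] with x hx
    have h1 := hU.one_le x (P.interior_subset_body hx)
    exact mul_nonneg (cutSlope_nonneg hd.a_pos (by positivity))
      (mul_nonneg (by linarith) (P.poleSum_nonneg hp hx))
  rw [integral_eq_lintegral_of_nonneg_ae hf0 hf.aestronglyMeasurable]
  have hU0 : 0 ≤ᵐ[P.sigma] U := by
    filter_upwards [P.ae_sigma_mem] with z hz
    exact zero_le_one.trans (hU.one_le z hz)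
  have hUi := P.integrable_sigma hp hU.continuousOn
  have hUσ0 : 0 ≤ ∫ x, U x ∂P.sigma := integral_nonneg_of_ae hU0
  refine ENNReal.toReal_le_of_le_ofReal (by positivity) ?_
  rw [ENNReal.ofReal_add hUσ0 hε.le, ofReal_integral_eq_lintegral_ofReal hUi hU0,
    P.sigma_eq_sum, lintegral_finsetSum_measure]
  have hc' : ContinuousOn f P.interior :=
    (contDiff_cutSlope.continuous.comp_continuousOn hv.continuousOn_legendre).mul hc
  have hgm := measurable_indicator_ofReal hO hc'
  calc ∫⁻ x in P.interior, ENNReal.ofReal (f x)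
      = ∫⁻ x in P.interior, P.interior.indicator (fun x => ENNReal.ofReal (f x)) x :=
        setLIntegral_congr_fun hO.measurableSet fun x hx => by simp [indicator_of_mem hx]
    _ ≤ _ := P.setLIntegral_interior_le hn hp hgm
    _ ≤ ∑ k, ((∫⁻ z, ENNReal.ofReal (U z) ∂P.sigmaFacet k) + ENNReal.ofReal (ε / P.N)) :=
        Finset.sum_le_sum fun k _ => hm k
    _ = _ := by
      rw [Finset.sum_add_distrib, Finset.sum_const, Finset.card_univ, Fintype.card_fin,
        nsmul_eq_mul, ← ENNReal.ofReal_natCast, ← ENNReal.ofReal_mul (Nat.cast_nonneg _),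
        mul_div_cancel₀ _ hN.ne']

end Boundary

/-! ### The trace estimate for test functions, then for normalized functions -/

section TraceBound

variable {n : ℕ} {P : OpenPolytope n} {p x z : Vec n} {v A U u : Vec n → ℝ} {a b CU R t : ℝ}

theorem continuousOn_trace_inv_hess_mul_hess {Ω : Set (Vec n)} (hΩ : IsOpen Ω)
    (hv : ContDiffOn ℝ ∞ v Ω) (hu : ∀ y ∈ Ω, IsUnit (hess v y).det) (hU : ContDiffOn ℝ ∞ U Ω) :
    ContinuousOn (fun x => ((hess v x)⁻¹ * hess U x).trace) Ω := by
  simp only [Matrix.trace, Matrix.diag, Matrix.mul_apply]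
  exact continuousOn_finsetSum _ fun i _ => continuousOn_finsetSum _ fun j _ =>
    (contDiffOn_inv_hess hΩ hv hu i j).continuousOn.mul (contDiffOn_hess hΩ hU j i).continuousOn

theorem OpenPolytope.integrableOn_interior {f : Vec n → ℝ} (hf : ContinuousOn f P.body) :
    IntegrableOn f P.interior :=
  (hf.integrableOn_compact P.isCompact_body).mono_set P.interior_subset_body

/-- Let the scale R = m + 1 tend to infinity in the cutoff inequality: Fatou for the trace,
dominated convergence for the term with A, and the boundary integral as upper bound for the pole
term. -/
theorem TestFn.lintegral_trace_le (hn : n ≠ 0) (hp : p ∈ P.interior) (hv : ClassS P v)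
    (hsol : SolvesAbreu P A v) (hA : ContinuousOn A P.body) (hU : TestFn P p U CU) :
    0 ≤ functionalL P A U ∧ ∫⁻ x in P.interior, ENNReal.ofReal ((hess v x)⁻¹ * hess U x).trace ≤
      ENNReal.ofReal (functionalL P A U) := by
  have hO := P.isOpen_interior
  have hsm := hv.contDiffOn
  have hu : ∀ y ∈ P.interior, IsUnit (hess v y).det := fun y hy => (hsol y hy).1
  obtain ⟨a, b, hd⟩ := hv.exists_cutData hn hp
  have hAc := hA.mono P.interior_subset_body
  obtain ⟨C, hC⟩ := exists_setIntegral_cut_le hp hv hsol hAc hU hd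
  have htr := continuousOn_trace_inv_hess_mul_hess hO hsm hu hU.smooth
  have hR : ∀ m : ℕ, (1:ℝ) ≤ m + 1 := fun m => by simp
  have htr0 : ∀ x ∈ P.interior, 0 ≤ ((hess v x)⁻¹ * hess U x).trace := fun x hx =>
    trace_inv_mul_nonneg (hv.posDef (hu x hx) hx) (hU.posSemidef x hx)
  set f : ℕ → Vec n → ℝ := fun m x => cut a (m + 1) (legendre p v x) *
    ((hess v x)⁻¹ * hess U x).trace
  have hfi : ∀ m, IntegrableOn (f m) P.interior := fun m => hd.integrableOn_cut hv hp (hR m) htr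
  have hf0 : ∀ m, 0 ≤ᵐ[volume.restrict P.interior] f m := fun m => by
    filter_upwards [ae_restrict_mem hO.measurableSet] with x hx
    exact mul_nonneg cut_nonneg (htr0 x hx)
  have hAU : ContinuousOn (fun x => A x * U x) P.body := hA.mul hU.continuousOn
  obtain ⟨M, hM, hMb⟩ := P.exists_bound_of_continuousOn hAU
  have hlim : Filter.Tendsto (fun m : ℕ => ∫ x in P.interior,
      cut a (m + 1) (legendre p v x) * (A x * U x)) Filter.atTop
      (nhds (∫ x in P.interior, A x * U x)) := by
    refine tendsto_integral_of_dominated_convergence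
      (fun _ => (1 + b + Real.exp (a * b)) ^ 3 * M)
      (fun m => (hd.integrableOn_cut hv hp (hR m)
        (hAU.mono P.interior_subset_body)).aestronglyMeasurable)
      (integrableOn_const (P.volume_interior_lt_top.ne)) (fun m => ?_) ?_
    · filter_upwards [ae_restrict_mem hO.measurableSet] with x hx
      rw [Real.norm_eq_abs, abs_mul, abs_of_nonneg cut_nonneg]
      have h1 := hd.cut_le (hR m) hx
      have h2 := hMb x (P.interior_subset_body hx)
      have h3 : 0 ≤ cut a (m + 1) (legendre p v x) := cut_nonneg
      exact mul_le_mul h1 h2 (abs_nonneg _) (h3.trans h1)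
    · refine ae_of_all _ fun x => ?_
      simpa using tendsto_cut.mul_const (A x * U x)
  have hev : ∀ ε > (0:ℝ), ∀ᶠ m : ℕ in Filter.atTop,
      ∫ x in P.interior, f m x ≤ functionalL P A U + ε := by
    intro ε hε
    have hε3 : 0 < ε / 3 := by positivity
    have h1 := hd.eventually_setIntegral_poleSum_le hv hu hn hp hU hε3
    have h2 := hlim.eventually (lt_mem_nhds (sub_lt_self _ hε3))
    have h3 : Filter.Tendsto (fun m : ℕ => C / ((m:ℝ) + 1)) Filter.atTop (nhds 0) := by
      have := (tendsto_one_div_add_atTop_nhds_zero_nat (𝕜 := ℝ)).const_mul C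
      simpa [div_eq_mul_inv] using this
    filter_upwards [h1, h2, h3.eventually (gt_mem_nhds hε3)] with m k1 k2 k3
    have k4 := hC (m + 1) (hR m)
    simp only [f, functionalL]
    linarith
  have hL0 : 0 ≤ functionalL P A U := by
    refine le_of_forall_pos_le_add fun ε hε => ?_
    obtain ⟨m, hm⟩ := (hev ε hε).exists
    exact (integral_nonneg_of_ae (hf0 m)).trans hm
  refine ⟨hL0, ENNReal.le_of_forall_pos_le_add fun ε hε _ => ?_⟩
  calc _ = ∫⁻ x in P.interior, Filter.liminf (fun m => ENNReal.ofReal (f m x)) Filter.atTop := by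
        refine lintegral_congr fun x => ?_
        have : Filter.Tendsto (fun m => ENNReal.ofReal (f m x)) Filter.atTop
            (nhds (ENNReal.ofReal (1 * ((hess v x)⁻¹ * hess U x).trace))) :=
          (ENNReal.continuous_ofReal.tendsto _).comp (tendsto_cut.mul_const _)
        rw [this.liminf_eq, one_mul]
    _ ≤ Filter.liminf (fun m => ∫⁻ x in P.interior, ENNReal.ofReal (f m x)) Filter.atTop :=
        lintegral_liminf_le' fun m => (hfi m).aestronglyMeasurable.aemeasurable.ennreal_ofReal
    _ ≤ ENNReal.ofReal (functionalL P A U + ε) := by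
        refine Filter.liminf_le_of_frequently_le' (Filter.Eventually.frequently ?_)
        filter_upwards [hev ε hε] with m hm
        rw [← ofReal_integral_eq_lintegral_ofReal (hfi m) (hf0 m)]
        exact ENNReal.ofReal_le_ofReal hm
    _ = _ := by rw [ENNReal.ofReal_add hL0 ε.coe_nonneg, ENNReal.ofReal_coe_nnreal]

/-- The dilate `x ↦ u (p + t (x - p))`. -/
def dilate (p : Vec n) (t : ℝ) (u : Vec n → ℝ) (x : Vec n) : ℝ := u (p + t • (x - p))

theorem fderiv_dilate (hu : DifferentiableAt ℝ u (p + t • (x - p))) (w : Vec n) :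
    fderiv ℝ (dilate p t u) x w = t * fderiv ℝ u (p + t • (x - p)) w := by
  have h1 : HasFDerivAt (fun x : Vec n => p + t • (x - p)) (t • ContinuousLinearMap.id ℝ (Vec n)) x :=
    (((hasFDerivAt_id x).sub_const p).const_smul t).const_add p
  have h2 : HasFDerivAt (dilate p t u) _ x := hu.hasFDerivAt.comp x h1
  rw [h2.fderiv]
  simp

theorem ClassCTilde.ray_mul_le (hu : ClassCTilde P p u) (hp : p ∈ P.interior) (hz : z ∈ P.body)
    {s : ℝ} (h0 : 0 ≤ s) (h1 : s ≤ 1) : u (p + s • (z - p)) ≤ s * u z := by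
  have := hu.1.2.1.2 (P.interior_subset_body hp) hz (sub_nonneg.2 h1) h0 (by ring)
  rw [hu.2.1] at this
  have e : (1 - s) • p + s • z = p + s • (z - p) := by rw [smul_sub, sub_smul, one_smul]; abel
  rw [e] at this
  simpa using this

theorem ClassCTilde.contDiffOn_dilate (hu : ClassCTilde P p u) (hp : p ∈ P.interior) (h0 : 0 ≤ t)
    (h1 : t < 1) : ContDiffOn ℝ ∞ (dilate p t u) P.interior :=
  hu.1.2.2.comp (t := P.interior) (f := fun x : Vec n => p + t • (x - p))
    (ContDiff.contDiffOn (by fun_prop)) fun _ hx =>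
    P.ray_mem_interior hp (P.interior_subset_body hx) h0 h1

theorem ClassCTilde.continuousOn_dilate (hu : ClassCTilde P p u) (hp : p ∈ P.interior)
    (h0 : 0 ≤ t) (h1 : t ≤ 1) : ContinuousOn (dilate p t u) P.body :=
  hu.1.1.comp (t := P.body) (f := fun x : Vec n => p + t • (x - p))
    (Continuous.continuousOn (by fun_prop)) fun _ hx => P.ray_mem_body hp hx h0 h1

theorem ClassCTilde.convexOn_dilate (hu : ClassCTilde P p u) (hp : p ∈ P.interior)
    (h0 : 0 ≤ t) (h1 : t ≤ 1) : ConvexOn ℝ P.body (dilate p t u) := by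
  refine ⟨P.convex_body, fun x hx y hy a b ha hb hab => ?_⟩
  have := hu.1.2.1.2 (P.ray_mem_body hp hx h0 h1) (P.ray_mem_body hp hy h0 h1) ha hb hab
  have e : a • (p + t • (x - p)) + b • (p + t • (y - p)) = p + t • (a • x + b • y - p) := by
    obtain rfl : b = 1 - a := by linarith
    module
  rw [e] at this
  exact this

theorem hess_dilate (hu : ClassCTilde P p u) (hp : p ∈ P.interior) (h0 : 0 ≤ t)
    (h1 : t < 1) (hx : x ∈ P.interior) :
    hess (dilate p t u) x = t ^ 2 • hess u (p + t • (x - p)) := by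
  have hO := P.isOpen_interior
  have hm : ∀ y ∈ P.interior, p + t • (y - p) ∈ P.interior := fun y hy =>
    P.ray_mem_interior hp (P.interior_subset_body hy) h0 h1
  ext i j
  have e : EqOn (pderiv j (dilate p t u)) (fun y => t * dilate p t (pderiv j u) y) P.interior :=
    fun y hy => fderiv_dilate (differentiableAt_of_contDiffOn hO hu.1.2.2 (hm y hy)) _
  have hd : DifferentiableAt ℝ (pderiv j u) (p + t • (x - p)) :=
    differentiableAt_of_contDiffOn hO (contDiffOn_pderiv hO hu.1.2.2 j) (hm x hx)
  have hdd : DifferentiableAt ℝ (dilate p t (pderiv j u)) x :=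
    DifferentiableAt.comp (f := fun x : Vec n => p + t • (x - p)) x hd (by fun_prop)
  simp only [hess, Matrix.of_apply, Matrix.smul_apply, smul_eq_mul]
  rw [pderiv_congr hO e hx, pderiv, fderiv_const_mul hdd, smul_apply, smul_eq_mul,
    fderiv_dilate hd, pderiv]
  ring

theorem hess_add_const (c : ℝ) : hess (fun y => u y + c) x = hess u x := by
  ext i j
  simp only [hess, Matrix.of_apply]
  congr 1
  ext y
  simp [pderiv]

/-- A dilation with t < 1 moves the closed polytope into a compact part of the open one, where the
radial derivative of u is bounded. Adding 1 gives the lower bound required of a test function. -/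
theorem ClassCTilde.exists_testFn_dilate (hu : ClassCTilde P p u) (hp : p ∈ P.interior)
    (h0 : 0 < t) (h1 : t < 1) : ∃ C, TestFn P p (fun x => dilate p t u x + 1) C := by
  have hO := P.isOpen_interior
  obtain ⟨M, hM, hMb⟩ := P.exists_bound_of_continuousOn hu.1.1
  set S := (fun x : Vec n => p + t • (x - p)) '' P.body
  have hS : IsCompact S := P.isCompact_body.image (by fun_prop)
  have hSΩ : S ⊆ P.interior := by
    rintro _ ⟨x, hx, rfl⟩
    exact P.ray_mem_interior hp hx h0.le h1
  obtain ⟨M', hM'⟩ := hS.exists_bound_of_continuousOn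
    ((contDiffOn_radial hO hu.1.2.2 p).continuousOn.mono hSΩ)
  have hsm := hu.contDiffOn_dilate hp h0.le h1
  refine ⟨max (M + 1) M', ⟨hsm.add contDiffOn_const,
    (hu.continuousOn_dilate hp h0.le h1.le).add continuousOn_const, fun x hx => ?_, fun x hx => ?_,
    fun x hx => ?_, fun x hx => ?_, fun z hz s hs => ?_⟩⟩
  · rw [hess_add_const]
    exact hess_posSemidef_of_convexOn hO ((hu.convexOn_dilate hp h0.le h1.le).subset
      P.interior_subset_body P.convex_interior) hsm hx
  · have := hu.2.2 _ (P.ray_mem_body hp hx h0.le h1.le)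
    simpa [dilate] using this
  · have := (abs_le.1 (hMb _ (P.ray_mem_body hp hx h0.le h1.le))).2
    exact le_max_of_le_left (by simpa [dilate] using this)
  · have hm := P.ray_mem_interior hp (P.interior_subset_body hx) h0.le h1
    have e : radial p (fun x => dilate p t u x + 1) x = radial p u (p + t • (x - p)) := by
      simp only [radial]
      rw [fderiv_add_const, fderiv_dilate (differentiableAt_of_contDiffOn hO hu.1.2.2 hm)]
      simp
    rw [e]
    exact le_max_of_le_right ((le_abs_self _).trans
      (hM' _ ⟨x, P.interior_subset_body hx, rfl⟩))
  · have hm := P.ray_mem_body hp hz h0.le h1.le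
    have h2 := hu.ray_mul_le hp hm hs.1.le hs.2.le
    have h3 := hu.2.2 _ hm
    have e : p + t • (p + s • (z - p) - p) = p + s • (p + t • (z - p) - p) := by
      simp only [add_sub_cancel_left]; rw [smul_comm]
    simp only [dilate]
    rw [e]
    have : s * u (p + t • (z - p)) ≤ u (p + t • (z - p)) := mul_le_of_le_one_left h3 hs.2.le
    linarith

/-- The functional vanishes on constants, so the 1 added to the dilates is harmless. -/
theorem functionalL_add_one (hp : p ∈ P.interior) (hA : ContinuousOn A P.body)
    (hU : ContinuousOn U P.body)
    (hext : ∀ l : EuclideanSpace ℝ (Fin n) →ᵃ[ℝ] ℝ, functionalL P A l = 0) :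
    functionalL P A (fun x => U x + 1) = functionalL P A U := by
  have h1 := hext (AffineMap.const ℝ _ 1)
  have h2 := P.integrable_sigma hp hU
  have h3 : Integrable (fun _ : Vec n => (1:ℝ)) P.sigma :=
    P.integrable_sigma hp continuousOn_const
  have h4 := P.integrableOn_interior (hA.mul hU)
  have h5 := P.integrableOn_interior hA
  simp only [functionalL, AffineMap.coe_const, Function.const_apply, mul_one] at h1 ⊢
  have e1 := integral_add h2 h3
  have e2 := integral_add (f := fun x => A x * U x) h4 h5
  rw [e1]
  simp only [mul_add, mul_one]
  rw [e2]
  linarith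

theorem tendsto_dilate_functionalL (hu : ClassCTilde P p u) (hp : p ∈ P.interior)
    (hA : ContinuousOn A P.body) {t : ℕ → ℝ} (ht : ∀ m, t m ∈ Ioo (0:ℝ) 1)
    (htl : Filter.Tendsto t Filter.atTop (nhds 1)) :
    Filter.Tendsto (fun m => functionalL P A (dilate p (t m) u)) Filter.atTop
      (nhds (functionalL P A u)) := by
  obtain ⟨M, hM, hMb⟩ := P.exists_bound_of_continuousOn hu.1.1
  obtain ⟨M', hM', hMb'⟩ := P.exists_bound_of_continuousOn hA
  have hO := P.isOpen_interior
  have := P.isFiniteMeasure_sigma hp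
  have hc := fun m => hu.continuousOn_dilate hp (ht m).1.le (ht m).2.le
  have hb : ∀ m, ∀ x ∈ P.body, |dilate p (t m) u x| ≤ M := fun m x hx =>
    hMb _ (P.ray_mem_body hp hx (ht m).1.le (ht m).2.le)
  have hl : ∀ x ∈ P.body, Filter.Tendsto (fun m => dilate p (t m) u x) Filter.atTop
      (nhds (u x)) := by
    intro x hx
    refine (hu.1.1 x hx).tendsto.comp (tendsto_nhdsWithin_iff.2 ⟨?_,
      Filter.Eventually.of_forall fun m => P.ray_mem_body hp hx (ht m).1.le (ht m).2.le⟩)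
    have := (htl.smul_const (x - p)).const_add p
    simpa using this
  refine Filter.Tendsto.sub ?_ ?_
  · refine tendsto_integral_of_dominated_convergence (fun _ => M)
      (fun m => (P.integrable_sigma hp (hc m)).aestronglyMeasurable) (integrable_const _)
      (fun m => ?_) ?_
    · filter_upwards [P.ae_sigma_mem] with x hx using hb m x hx
    · filter_upwards [P.ae_sigma_mem] with x hx using hl x hx
  · refine tendsto_integral_of_dominated_convergence (fun _ => M' * M)
      (fun m => (P.integrableOn_interior (hA.mul (hc m))).aestronglyMeasurable)
      (integrableOn_const (P.volume_interior_lt_top.ne)) (fun m => ?_) ?_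
    · filter_upwards [ae_restrict_mem hO.measurableSet] with x hx
      have hx' := P.interior_subset_body hx
      rw [Real.norm_eq_abs, abs_mul]
      exact mul_le_mul (hMb' x hx') (hb m x hx') (abs_nonneg _) hM'.le
    · filter_upwards [ae_restrict_mem hO.measurableSet] with x hx
      exact (hl x (P.interior_subset_body hx)).const_mul _

/-- The trace of the Hessian of a normalized function, measured by a solution of the Abreu
equation, is controlled by the linear functional. -/
theorem ClassCTilde.lintegral_trace_le (hu : ClassCTilde P p u) (hn : n ≠ 0)
    (hp : p ∈ P.interior) (hv : ClassS P v) (hsol : SolvesAbreu P A v)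
    (hA : ContinuousOn A P.body)
    (hext : ∀ l : EuclideanSpace ℝ (Fin n) →ᵃ[ℝ] ℝ, functionalL P A l = 0) :
    0 ≤ functionalL P A u ∧ ∫⁻ x in P.interior, ENNReal.ofReal ((hess v x)⁻¹ * hess u x).trace ≤
      ENNReal.ofReal (functionalL P A u) := by
  have hO := P.isOpen_interior
  -- The shift to m + 2 in the denominator keeps t strictly positive at m = 0.
  set t : ℕ → ℝ := fun m => 1 - 1 / ((m + 1 : ℕ) + 1)
  have ht : ∀ m, t m ∈ Ioo (0:ℝ) 1 := by
    intro m
    have h1 : (1:ℝ) / ((m + 1 : ℕ) + 1) < 1 := by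
      rw [div_lt_one (by positivity)]; push_cast; linarith [(Nat.cast_nonneg m : (0:ℝ) ≤ m)]
    have h2 : (0:ℝ) < 1 / ((m + 1 : ℕ) + 1) := by positivity
    exact ⟨by simp only [t]; linarith, by simp only [t]; linarith⟩
  have htl : Filter.Tendsto t Filter.atTop (nhds 1) := by
    have := ((tendsto_one_div_add_atTop_nhds_zero_nat (𝕜 := ℝ)).comp
      (Filter.tendsto_add_atTop_nat 1)).const_sub 1
    simpa [t] using this
  have hL := tendsto_dilate_functionalL hu hp hA ht htl
  have key : ∀ m, 0 ≤ functionalL P A (dilate p (t m) u) ∧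
      ∫⁻ x in P.interior, ENNReal.ofReal ((hess v x)⁻¹ * hess (dilate p (t m) u) x).trace ≤
      ENNReal.ofReal (functionalL P A (dilate p (t m) u)) := by
    intro m
    obtain ⟨C, hC⟩ := hu.exists_testFn_dilate hp (ht m).1 (ht m).2
    have := hC.lintegral_trace_le hn hp hv hsol hA
    rw [functionalL_add_one hp hA (hu.continuousOn_dilate hp (ht m).1.le (ht m).2.le) hext] at this
    simpa only [hess_add_const] using this
  refine ⟨ge_of_tendsto' hL fun m => (key m).1, ?_⟩
  have hlim : ∀ x ∈ P.interior, Filter.Tendsto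
      (fun m => ENNReal.ofReal ((hess v x)⁻¹ * hess (dilate p (t m) u) x).trace) Filter.atTop
      (nhds (ENNReal.ofReal ((hess v x)⁻¹ * hess u x).trace)) := by
    intro x hx
    refine (ENNReal.continuous_ofReal.tendsto _).comp ?_
    have h1 : Filter.Tendsto (fun m => p + t m • (x - p)) Filter.atTop (nhds x) := by
      have := (htl.smul_const (x - p)).const_add p
      simpa using this
    have h2 : ∀ i j, Filter.Tendsto (fun m => hess (dilate p (t m) u) x i j) Filter.atTop
        (nhds (hess u x i j)) := by
      intro i j
      have h3 := ((contDiffOn_hess hO hu.1.2.2 i j).continuousOn.continuousAt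
        (hO.mem_nhds hx)).tendsto.comp h1
      have h4 := (htl.pow 2).mul h3
      rw [one_pow, one_mul] at h4
      refine h4.congr fun m => ?_
      rw [hess_dilate hu hp (ht m).1.le (ht m).2 hx]
      simp
    simp only [Matrix.trace, Matrix.diag, Matrix.mul_apply]
    exact tendsto_finsetSum _ fun i _ => tendsto_finsetSum _ fun j _ => (h2 j i).const_mul _
  calc _ = ∫⁻ x in P.interior, Filter.liminf
        (fun m => ENNReal.ofReal ((hess v x)⁻¹ * hess (dilate p (t m) u) x).trace)
          Filter.atTop :=
        setLIntegral_congr_fun hO.measurableSet fun x hx => (hlim x hx).liminf_eq.symm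
    _ ≤ Filter.liminf (fun m => ∫⁻ x in P.interior,
          ENNReal.ofReal ((hess v x)⁻¹ * hess (dilate p (t m) u) x).trace) Filter.atTop :=
        lintegral_liminf_le' fun m =>
          ((continuousOn_trace_inv_hess_mul_hess hO hv.contDiffOn (fun y hy => (hsol y hy).1)
            (hu.contDiffOn_dilate hp (ht m).1.le (ht m).2)).aemeasurable
              hO.measurableSet).ennreal_ofReal
    _ ≤ Filter.liminf (fun m => ENNReal.ofReal (functionalL P A (dilate p (t m) u)))
          Filter.atTop := Filter.liminf_le_liminf (Filter.Eventually.of_forall fun m => (key m).2)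
    _ = _ := ((ENNReal.continuous_ofReal.tendsto _).comp hL).liminf_eq

end TraceBound

/-! ### Two integrations by parts for the radial derivative -/

section Growth

variable {n : ℕ} {P : OpenPolytope n} {p x z : Vec n} {v A U u : Vec n → ℝ} {a b r R : ℝ}
  {Ω : Set (Vec n)}

/-- The square of the distance to `p`. -/
def sqDist (p x : Vec n) : ℝ := ∑ i, (x i - p i) ^ 2

theorem sqDist_eq_dist (p x : Vec n) : sqDist p x = dist x p ^ 2 := by
  rw [sqDist, EuclideanSpace.dist_eq, Real.sq_sqrt (Finset.sum_nonneg fun _ _ => by positivity)]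
  exact Finset.sum_congr rfl fun i _ => by rw [Real.dist_eq, sq_abs]

theorem sqDist_nonneg (p x : Vec n) : 0 ≤ sqDist p x :=
  Finset.sum_nonneg fun _ _ => sq_nonneg _

theorem contDiff_sqDist (p : Vec n) : ContDiff ℝ ∞ (sqDist p) :=
  ContDiff.sum fun i _ => (contDiff_coord_sub i p).pow 2

theorem pderiv_sqDist (i : Fin n) : pderiv i (sqDist p) x = 2 * (x i - p i) := by
  have hd : ∀ j, DifferentiableAt ℝ (fun y : Vec n => y j - p j) x := fun j =>
    ((contDiff_coord_sub j p).differentiable (by simp)) x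
  have h1 : pderiv i (sqDist p) x = ∑ j, pderiv i (fun y => (y j - p j) ^ 2) x :=
    pderiv_sum Finset.univ i fun j _ => (hd j).pow 2
  have h2 : ∀ j, pderiv i (fun y : Vec n => (y j - p j) ^ 2) x =
      2 * (x j - p j) * if i = j then 1 else 0 := fun j => by
    rw [pderiv_comp (φ := fun s => s ^ 2) (φ' := 2 * (x j - p j)) i
      (by simpa using hasDerivAt_pow 2 (x j - p j)) (hd j), pderiv_coord_sub]
  rw [h1]
  simp [h2]

theorem radial_sqDist : radial p (sqDist p) x = 2 * sqDist p x := by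
  rw [radial_eq_sum, sqDist, Finset.mul_sum]
  exact Finset.sum_congr rfl fun i _ => by rw [pderiv_sqDist]; ring

/-- Integration by parts of the Laplacian against a radial cutoff. -/
theorem setIntegral_cutoff_mul_laplacian (hΩ : IsOpen Ω) (hr : Metric.closedBall p r ⊆ Ω)
    (hr0 : 0 ≤ r) (hu : ContDiffOn ℝ ∞ u Ω) :
    ∫ x in Ω, max (r ^ 2 - sqDist p x) 0 ^ 3 * (hess u x).trace =
      ∫ x in Ω, 6 * max (r ^ 2 - sqDist p x) 0 ^ 2 * radial p u x := by
  set ζ : Vec n → ℝ := fun x => max (r ^ 2 - sqDist p x) 0 ^ 3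
  have hsq := contDiff_sqDist p
  have hζ : ContDiff ℝ 1 ζ :=
    (contDiff_max_pow 1).comp ((contDiff_const.sub hsq).of_le (by simp))
  have h0 : ∀ y ∈ Ω, y ∉ Metric.closedBall p r → max (r ^ 2 - sqDist p y) 0 = 0 := by
    intro y _ hy
    rw [Metric.mem_closedBall, not_le] at hy
    rw [sqDist_eq_dist, max_eq_right]
    nlinarith
  have hc : IsCompact (Metric.closedBall p r) := isCompact_closedBall p r
  have hzp : ∀ x i, pderiv i ζ x = -(6 * max (r ^ 2 - sqDist p x) 0 ^ 2) * (x i - p i) := by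
    intro x i
    have hd : DifferentiableAt ℝ (fun y => r ^ 2 - sqDist p y) x :=
      (contDiff_const.sub hsq).differentiable (by simp) x
    have h1 := pderiv_comp i (hasDerivAt_max_pow 1 (r ^ 2 - sqDist p x)) hd
    have h2 : pderiv i (fun y => r ^ 2 - sqDist p y) x = -(2 * (x i - p i)) := by
      rw [pderiv_sub i (by fun_prop) (hsq.differentiable (by simp) x), pderiv_sqDist,
        pderiv_const]
      ring
    rw [h2] at h1
    refine h1.trans ?_
    push_cast
    ring
  have hmain := setIntegral_divergence_eq_zero (W := fun i x => ζ x * pderiv i u x) hΩ hc hr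
    (fun i => hζ.contDiffOn.mul ((contDiffOn_pderiv hΩ hu i).of_le (by simp)))
    (fun i y hy hyK => by simp [ζ, h0 y hy hyK])
  have hmc : Continuous fun x => max (r ^ 2 - sqDist p x) 0 :=
    (continuous_const.sub hsq.continuous).max continuous_const
  have htr : ContinuousOn (fun x => (hess u x).trace) Ω :=
    continuousOn_finsetSum _ fun i _ => (contDiffOn_hess hΩ hu i i).continuousOn
  have i1 : IntegrableOn (fun x => max (r ^ 2 - sqDist p x) 0 ^ 3 * (hess u x).trace) Ω :=
    integrableOn_of_compact_support hΩ hc hr ((hmc.pow 3).continuousOn.mul htr)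
      fun y hy hyK => by simp [h0 y hy hyK]
  have i2 : IntegrableOn (fun x => 6 * max (r ^ 2 - sqDist p x) 0 ^ 2 * radial p u x) Ω :=
    integrableOn_of_compact_support hΩ hc hr
      ((continuous_const.mul (hmc.pow 2)).continuousOn.mul (contDiffOn_radial hΩ hu p).continuousOn)
      fun y hy hyK => by simp [h0 y hy hyK]
  rw [← sub_eq_zero, ← integral_sub i1 i2]
  refine Eq.trans (setIntegral_congr_fun hΩ.measurableSet fun x hx => ?_) hmain
  have h3 : ∀ i, pderiv i (fun x => ζ x * pderiv i u x) x =
      -(6 * max (r ^ 2 - sqDist p x) 0 ^ 2) * ((x i - p i) * pderiv i u x) +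
        ζ x * pderiv i (pderiv i u) x := fun i => by
    rw [pderiv_mul i (hζ.differentiable (by simp) x)
      (differentiableAt_of_contDiffOn hΩ (contDiffOn_pderiv hΩ hu i) hx), hzp]
    ring
  simp only [h3]
  rw [Finset.sum_add_distrib, ← Finset.mul_sum, ← Finset.mul_sum, ← radial_eq_sum]
  simp only [ζ, Matrix.trace, Matrix.diag, hess, Matrix.of_apply]
  ring

/-- Integration by parts of the radial second derivative against a cutoff. -/
theorem ClassS.setIntegral_cutoff_mul_radialHess (hv : ClassS P v) (hp : p ∈ P.interior)
    (ha : 0 < a) (R : ℝ) (hu : ContDiffOn ℝ ∞ u P.interior) :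
    ∫ x in P.interior, max (R - legendre p v x) 0 ^ 3 / (sqDist p x + a) ^ (n + 1) *
        radialHess p u x =
      ∫ x in P.interior, ((n + 1) * max (R - legendre p v x) 0 ^ 3 * (sqDist p x - a) /
        (sqDist p x + a) ^ (n + 2) + 3 * max (R - legendre p v x) 0 ^ 2 * radialHess p v x /
        (sqDist p x + a) ^ (n + 1)) * radial p u x := by
  have hΩ := P.isOpen_interior
  have hc := hv.isCompact_sublevel hp R
  have hE := contDiffOn_legendre (p := p) hΩ hv.contDiffOn
  have hsq := contDiff_sqDist p
  have hpos : ∀ x, 0 < sqDist p x + a := fun x => by linarith [sqDist_nonneg p x]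
  set ψ : Vec n → ℝ := fun x => max (R - legendre p v x) 0 ^ 3
  set q : Vec n → ℝ := fun x => ((sqDist p x + a) ^ (n + 1))⁻¹
  have hψ : ContDiffOn ℝ 1 ψ P.interior :=
    (contDiff_max_pow 1).comp_contDiffOn ((contDiffOn_const.sub hE).of_le (by simp))
  have hq : ContDiff ℝ ∞ q :=
    ((hsq.add contDiff_const).pow _).inv fun x => (pow_pos (hpos x) _).ne'
  have hD := contDiffOn_radial hΩ hu p
  have h0 : ∀ y ∈ P.interior, y ∉ {y ∈ P.interior | legendre p v y ≤ R} →
      max (R - legendre p v y) 0 = 0 := by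
    intro y hy hyK
    refine max_eq_right ?_
    by_contra h
    exact hyK ⟨hy, by linarith⟩
  have hmain := setIntegral_radial (f := fun x => ψ x * (q x * radial p u x)) hΩ hc
    (fun _ hy => hy.1) (hψ.mul ((hq.contDiffOn.mul hD).of_le (by simp)))
    (fun y hy hyK => by simp [ψ, h0 y hy hyK]) p
  have hmc : ContinuousOn (fun x => max (R - legendre p v x) 0) P.interior :=
    (continuous_id.max continuous_const).comp_continuousOn
      (continuousOn_const.sub hE.continuousOn)
  have hsc : ContinuousOn (sqDist p) P.interior := hsq.continuous.continuousOn
  have hQ := (contDiffOn_radialHess (p := p) hΩ hv.contDiffOn).continuousOn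
  have hQu := (contDiffOn_radialHess (p := p) hΩ hu).continuousOn
  have hne : ∀ m : ℕ, ∀ x ∈ P.interior, (sqDist p x + a) ^ m ≠ 0 := fun m x _ =>
    (pow_pos (hpos x) _).ne'
  have hden : ∀ m : ℕ, ContinuousOn (fun x => (sqDist p x + a) ^ m) P.interior := fun m =>
    (hsc.add continuousOn_const).pow m
  have i1 : IntegrableOn (fun x => max (R - legendre p v x) 0 ^ 3 / (sqDist p x + a) ^ (n + 1) *
      radialHess p u x) P.interior :=
    integrableOn_of_compact_support hΩ hc (fun _ hy => hy.1)
      (((hmc.pow 3).div (hden _) (hne _)).mul hQu) fun y hy hyK => by simp [h0 y hy hyK]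
  have i2 : IntegrableOn (fun x => ((n + 1) * max (R - legendre p v x) 0 ^ 3 *
      (sqDist p x - a) / (sqDist p x + a) ^ (n + 2) +
      3 * max (R - legendre p v x) 0 ^ 2 * radialHess p v x /
        (sqDist p x + a) ^ (n + 1)) * radial p u x) P.interior :=
    integrableOn_of_compact_support hΩ hc (fun _ hy => hy.1)
      (((((continuousOn_const.mul (hmc.pow 3)).mul (hsc.sub continuousOn_const)).div (hden _)
        (hne _)).add (((continuousOn_const.mul (hmc.pow 2)).mul hQ).div (hden _) (hne _))).mul
        hD.continuousOn) fun y hy hyK => by simp [h0 y hy hyK]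
  rw [← sub_eq_zero, ← integral_sub i1 i2]
  refine Eq.trans (setIntegral_congr_fun hΩ.measurableSet fun x hx => ?_) hmain
  have dE := differentiableAt_of_contDiffOn hΩ hE hx
  have dψ : DifferentiableAt ℝ ψ x :=
    (hψ.contDiffAt (hΩ.mem_nhds hx)).differentiableAt (by simp)
  have dq : DifferentiableAt ℝ q x := hq.differentiable (by simp) x
  have dD := differentiableAt_of_contDiffOn hΩ hD hx
  have e1 : radial p ψ x = -(3 * max (R - legendre p v x) 0 ^ 2 * radialHess p v x) := by
    have h1 : HasDerivAt (fun t => max (R - t) 0 ^ 3)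
        (-(3 * max (R - legendre p v x) 0 ^ 2)) (legendre p v x) := by
      have := (hasDerivAt_max_pow 1 (R - legendre p v x)).comp (legendre p v x)
        ((hasDerivAt_id (legendre p v x)).const_sub R)
      exact this.congr_deriv (by push_cast; ring)
    have := radial_comp p h1 dE
    rw [radial_legendre hΩ hv.contDiffOn hx] at this
    exact this.trans (by ring)
  -- With s the squared distance, this derivative and the term (n + 1)q, whose extra 1 comes from
  -- differentiating ∂u radially, combine to (n + 1)(a - s)/(s + a)^(n+2). After moving it to the
  -- other side the weight is positive for s > a.
  have e2 : radial p q x = -((n + 1) / (sqDist p x + a) ^ (n + 2)) * (2 * sqDist p x) := by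
    have h1 : HasDerivAt (fun t : ℝ => ((t + a) ^ (n + 1))⁻¹)
        (-((n + 1) / (sqDist p x + a) ^ (n + 2))) (sqDist p x) := by
      have h2 : HasDerivAt (fun t : ℝ => (t + a) ^ (n + 1))
          ((n + 1) * (sqDist p x + a) ^ n) (sqDist p x) := by
        simpa using ((hasDerivAt_id' (sqDist p x)).add_const a).fun_pow (n + 1)
      refine (h2.fun_inv (pow_pos (hpos x) _).ne').congr_deriv ?_
      have := (hpos x).ne'
      field_simp
      ring
    have := radial_comp p h1 (hsq.differentiable (by simp) x)
    rw [radial_sqDist] at this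
    exact this
  have e3 : radial p (radial p u) x = radial p u x + radialHess p u x :=
    radial_radial hΩ hu hx p
  rw [radial_mul p dψ (dq.fun_mul dD), radial_mul p dq dD, e1, e2, e3]
  simp only [ψ, q]
  have := (hpos x).ne'
  field_simp
  ring

/-- The gradient inequality at x, evaluated at p where u vanishes. -/
theorem le_radial_of_convexOn (hp : p ∈ P.interior) (hu : ClassCTilde P p u)
    (hx : x ∈ P.interior) : u x ≤ radial p u x := by
  have h := add_fderiv_le_of_convexOn hu.1.2.1 (P.interior_subset_body hx)
    (P.interior_subset_body hp) (differentiableAt_of_contDiffOn P.isOpen_interior hu.1.2.2 hx)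
  rw [hu.2.1, ← neg_sub x p, map_neg] at h
  simp only [radial]
  linarith

theorem radialHess_le (hH : (hess u x).PosSemidef) :
    radialHess p u x ≤ (hess u x).trace * sqDist p x :=
  quadratic_form_le_trace hH fun i => x i - p i

end Growth

/-! ### Coercivity of the linear functional -/

section Coercive

variable {n : ℕ} {P : OpenPolytope n} {p x z : Vec n} {v A U u : Vec n → ℝ}

theorem setIntegral_le_of_weight {Ω K : Set (Vec n)} (hΩ : IsOpen Ω) (hK : IsCompact K)
    (hKΩ : K ⊆ Ω) {η D : Vec n → ℝ} {c : ℝ} (hu : ContinuousOn u Ω)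
    (hint : IntegrableOn (fun x => η x * D x) Ω) (hη : ∀ x ∈ Ω, 0 ≤ η x)
    (hηK : ∀ x ∈ K, c ≤ η x) (huD : ∀ x ∈ Ω, u x ≤ D x) (hD : ∀ x ∈ Ω, 0 ≤ D x) (hc : 0 ≤ c) :
    c * ∫ x in K, u x ≤ ∫ x in Ω, η x * D x := by
  rw [← integral_const_mul]
  have h1 : IntegrableOn (fun x => c * u x) K :=
    ((hu.mono hKΩ).integrableOn_compact hK).const_mul c
  calc _ ≤ ∫ x in K, η x * D x := by
        refine setIntegral_mono_on h1 (hint.mono_set hKΩ) hK.measurableSet fun x hx => ?_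
        exact (mul_le_mul_of_nonneg_left (huD x (hKΩ hx)) hc).trans
          (mul_le_mul_of_nonneg_right (hηK x hx) (hD x (hKΩ hx)))
    _ ≤ _ := by
        refine setIntegral_mono_set hint ?_ (Filter.Eventually.of_forall hKΩ)
        filter_upwards [ae_restrict_mem hΩ.measurableSet] with x hx
        exact mul_nonneg (hη x hx) (hD x hx)

/-- On compact subsets of the polytope, a normalized function is controlled by the trace of its
Hessian. -/
theorem ClassS.exists_setIntegral_le (hv : ClassS P v) (hp : p ∈ P.interior)
    (hV : ∀ y ∈ P.interior, IsUnit (hess v y).det) {K : Set (Vec n)} (hK : IsCompact K)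
    (hKΩ : K ⊆ P.interior) : ∃ C ≥ 0, ∀ u, ClassCTilde P p u → ∀ L ≥ 0,
      ∫⁻ x in P.interior, ENNReal.ofReal ((hess v x)⁻¹ * hess u x).trace ≤ ENNReal.ofReal L →
      ∫ x in K, u x ≤ C * L := by
  have hΩ := P.isOpen_interior
  obtain ⟨r, hr, hrΩ⟩ := Metric.nhds_basis_closedBall.mem_iff.1 (hΩ.mem_nhds hp)
  obtain ⟨b, hb, hbE⟩ := hv.exists_le_legendre hp
  have hEc := hv.continuousOn_legendre (p := p)
  obtain ⟨R₀, hR₀⟩ := hK.exists_bound_of_continuousOn (hEc.mono hKΩ)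
  have hsq := (contDiff_sqDist p).continuous
  obtain ⟨T, hT, hTb⟩ := P.exists_bound_of_continuousOn hsq.continuousOn
  set R := |R₀| + 1
  -- With this a, the Laplacian cutoff is at least 2a on the set `sqDist p x ≤ 2 * a`, which
  -- contains the region where the weight w can be negative.
  set a := r ^ 2 / 4
  have ha : 0 < a := by positivity
  have hra : r ^ 2 = 4 * a := by simp only [a]; ring
  have hpos : ∀ x, 0 < sqDist p x + a := fun x => by linarith [sqDist_nonneg p x]
  set B := (R + b) ^ 3
  have hB : 0 < B := by positivity
  -- Chosen so that the Laplacian weight, at least 24 a² k near p, exceeds the worst negative value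
  -- of w there by 1.
  set k := ((n + 1) * B * a / a ^ (n + 2) + 1) / (24 * a ^ 2)
  have hk : 0 < k := by positivity
  have hk' : k * (24 * a ^ 2) = (n + 1) * B * a / a ^ (n + 2) + 1 := by
    simp only [k]; field_simp
  set m : Vec n → ℝ := fun x => max (r ^ 2 - sqDist p x) 0
  set e : Vec n → ℝ := fun x => max (R - legendre p v x) 0
  set q : Vec n → ℝ := fun x => (sqDist p x + a) ^ (n + 1)
  set w : Vec n → ℝ := fun x => (n + 1) * e x ^ 3 * (sqDist p x - a) / (sqDist p x + a) ^ (n + 2) +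
    3 * e x ^ 2 * radialHess p v x / q x
  -- The weight of ∂u in the sum of the two identities: the Laplacian part repairs w near p, and w
  -- is positive away from p wherever E < R.
  set η : Vec n → ℝ := fun x => k * (6 * m x ^ 2) + w x
  set c := min 1 ((n + 1) * a / (T + a) ^ (n + 2))
  have hc : 0 < c := by positivity
  have hm0 : ∀ x, 0 ≤ m x := fun x => le_max_right _ _
  have he0 : ∀ x, 0 ≤ e x := fun x => le_max_right _ _
  have heB : ∀ x ∈ P.interior, e x ^ 3 ≤ B := fun x hx =>
    pow_le_pow_left₀ (he0 x) (max_le (by linarith [(hbE x hx).1]) (by positivity)) 3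
  have hw2 : ∀ x ∈ P.interior, 0 ≤ 3 * e x ^ 2 * radialHess p v x / q x := fun x hx =>
    div_nonneg (mul_nonneg (by positivity) (hv.radialHess_nonneg hV hx)) (pow_pos (hpos x) _).le
  have hnear : ∀ x ∈ P.interior, sqDist p x ≤ 2 * a → 1 ≤ η x := by
    intro x hx hxa
    have h1 : 2 * a ≤ m x := le_max_of_le_left (by linarith)
    have h2 : 24 * a ^ 2 ≤ 6 * m x ^ 2 := by nlinarith
    have h3 : k * (24 * a ^ 2) ≤ k * (6 * m x ^ 2) := mul_le_mul_of_nonneg_left h2 hk.le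
    have h4 : -((n + 1) * B * a / a ^ (n + 2)) ≤
        (n + 1) * e x ^ 3 * (sqDist p x - a) / (sqDist p x + a) ^ (n + 2) := by
      have h5 : (n + 1) * e x ^ 3 * a / (sqDist p x + a) ^ (n + 2) ≤
          (n + 1) * B * a / a ^ (n + 2) := by
        have := heB x hx
        have := sqDist_nonneg p x
        gcongr
        linarith
      have h6 : 0 ≤ (n + 1) * e x ^ 3 * sqDist p x / (sqDist p x + a) ^ (n + 2) :=
        div_nonneg (mul_nonneg (mul_nonneg (by positivity) (pow_nonneg (he0 x) 3))
          (sqDist_nonneg p x)) (pow_pos (hpos x) _).le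
      rw [mul_sub, sub_div]
      linarith
    have h7 := hw2 x hx
    simp only [η, w]
    linarith
  have hfar : ∀ x ∈ P.interior, 2 * a ≤ sqDist p x →
      (n + 1) * e x ^ 3 * a / (T + a) ^ (n + 2) ≤ η x := by
    intro x hx hxa
    have h1 := (le_abs_self _).trans (hTb x (P.interior_subset_body hx))
    have h2 : (n + 1) * e x ^ 3 * a / (T + a) ^ (n + 2) ≤
        (n + 1) * e x ^ 3 * (sqDist p x - a) / (sqDist p x + a) ^ (n + 2) := by
      have h4 : 0 ≤ (n + 1) * e x ^ 3 := mul_nonneg (by positivity) (pow_nonneg (he0 x) 3)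
      refine div_le_div₀ (mul_nonneg h4 (by linarith))
        (mul_le_mul_of_nonneg_left (by linarith) h4) (pow_pos (hpos x) _)
        (pow_le_pow_left₀ (hpos x).le (by linarith) _)
    have h3 : 0 ≤ k * (6 * m x ^ 2) := by positivity
    have h7 := hw2 x hx
    simp only [η, w]
    linarith
  have hη : ∀ x ∈ P.interior, 0 ≤ η x := by
    intro x hx
    rcases le_total (sqDist p x) (2 * a) with h | h
    · exact zero_le_one.trans (hnear x hx h)
    · refine le_trans ?_ (hfar x hx h)
      have := pow_nonneg (he0 x) 3
      positivity
  have hηK : ∀ x ∈ K, c ≤ η x := by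
    intro x hxK
    have hx := hKΩ hxK
    rcases le_total (sqDist p x) (2 * a) with h | h
    · exact (min_le_left _ _).trans (hnear x hx h)
    · refine (min_le_right _ _).trans (le_trans ?_ (hfar x hx h))
      have h1 : 1 ≤ e x := by
        have := (le_abs_self _).trans ((hR₀ x hxK).trans (le_abs_self _))
        exact le_max_of_le_left (by simp only [R]; linarith)
      have h2 : 1 ≤ e x ^ 3 := one_le_pow₀ h1
      have : ((n:ℝ) + 1) * a ≤ (n + 1) * e x ^ 3 * a := by
        have : (0:ℝ) ≤ (n + 1) * a := by positivity
        nlinarith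
      gcongr
  set S := Metric.closedBall p r ∪ {x ∈ P.interior | legendre p v x ≤ R}
  have hS : IsCompact S := (isCompact_closedBall p r).union (hv.isCompact_sublevel hp R)
  have hSΩ : S ⊆ P.interior := union_subset hrΩ fun _ hx => hx.1
  have hm1 : ∀ x, x ∉ S → m x = 0 := by
    intro x hx
    have : r < dist x p := by
      by_contra h
      exact hx (Or.inl (Metric.mem_closedBall.2 (not_lt.1 h)))
    simp only [m, sqDist_eq_dist]
    exact max_eq_right (by nlinarith)
  have he1 : ∀ x ∈ P.interior, x ∉ S → e x = 0 := by
    intro x hx hxS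
    refine max_eq_right ?_
    by_contra h
    exact hxS (Or.inr ⟨hx, by linarith⟩)
  have hmc : Continuous m := (continuous_const.sub hsq).max continuous_const
  have hec : ContinuousOn e P.interior := (continuous_id.max continuous_const).comp_continuousOn
    (continuousOn_const.sub hEc)
  have hqc : Continuous q := (hsq.add continuous_const).pow _
  have hq0 : ∀ x, 0 < q x := fun x => pow_pos (hpos x) _
  have hQ := (contDiffOn_radialHess (p := p) hΩ hv.contDiffOn).continuousOn
  have hηc : ContinuousOn η P.interior := by
    refine (continuous_const.mul (continuous_const.mul (hmc.pow 2))).continuousOn.add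
      (ContinuousOn.add ?_ ?_)
    · exact ((continuousOn_const.mul (hec.pow 3)).mul
        (hsq.continuousOn.sub continuousOn_const)).div
        ((hsq.add continuous_const).pow _).continuousOn fun x _ => (pow_pos (hpos x) _).ne'
    · exact ((continuousOn_const.mul (hec.pow 2)).mul hQ).div hqc.continuousOn
        fun x _ => (hq0 x).ne'
  -- The factor relating the two Hessian terms to tr(V⁻¹H). It vanishes off the compact set S, so it
  -- is bounded even though tr V is not.
  set F : Vec n → ℝ := fun x => (k * m x ^ 3 + e x ^ 3 / q x * sqDist p x) * (hess v x).trace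
  have hFc : ContinuousOn F P.interior :=
    ((continuous_const.mul (hmc.pow 3)).continuousOn.add (((hec.pow 3).div hqc.continuousOn
      fun x _ => (hq0 x).ne').mul hsq.continuousOn)).mul
      (continuousOn_finsetSum _ fun i _ => (contDiffOn_hess hΩ hv.contDiffOn i i).continuousOn)
  obtain ⟨C, hC⟩ := hS.exists_bound_of_continuousOn (hFc.mono hSΩ)
  have hFC : ∀ x ∈ P.interior, F x ≤ |C| := by
    intro x hx
    by_cases hxS : x ∈ S
    · exact (le_abs_self _).trans ((hC x hxS).trans (le_abs_self _))
    · simp [F, hm1 x hxS, he1 x hx hxS]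
  refine ⟨|C| / c, by positivity, fun u hu L hL htr => ?_⟩
  have hH : ∀ x ∈ P.interior, (hess u x).PosSemidef := fun x hx =>
    hess_posSemidef_of_convexOn hΩ (hu.1.2.1.subset P.interior_subset_body P.convex_interior)
      hu.1.2.2 hx
  have huD := fun x hx => le_radial_of_convexOn hp hu (x := x) hx
  have hD : ∀ x ∈ P.interior, 0 ≤ radial p u x := fun x hx =>
    (hu.2.2 x (P.interior_subset_body hx)).trans (huD x hx)
  have hDc := (contDiffOn_radial hΩ hu.1.2.2 p).continuousOn
  have hint : IntegrableOn (fun x => η x * radial p u x) P.interior :=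
    integrableOn_of_compact_support hΩ hS hSΩ (hηc.mul hDc) fun x hx hxS => by
      simp [η, w, hm1 x hxS, he1 x hx hxS]
  have h1 := setIntegral_le_of_weight hΩ hK hKΩ hu.1.2.2.continuousOn hint hη hηK huD hD hc.le
  have h2 := setIntegral_cutoff_mul_laplacian hΩ hrΩ hr.le hu.1.2.2
  have h3 := hv.setIntegral_cutoff_mul_radialHess hp ha R hu.1.2.2
  have htrc : ContinuousOn (fun x => (hess u x).trace) P.interior :=
    continuousOn_finsetSum _ fun i _ => (contDiffOn_hess hΩ hu.1.2.2 i i).continuousOn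
  have hQu := (contDiffOn_radialHess (p := p) hΩ hu.1.2.2).continuousOn
  have j1 : IntegrableOn (fun x => k * (m x ^ 3 * (hess u x).trace)) P.interior :=
    integrableOn_of_compact_support hΩ hS hSΩ
      (continuousOn_const.mul ((hmc.pow 3).continuousOn.mul htrc))
      fun x hx hxS => by simp [hm1 x hxS]
  have j2 : IntegrableOn (fun x => e x ^ 3 / q x * radialHess p u x) P.interior :=
    integrableOn_of_compact_support hΩ hS hSΩ
      (((hec.pow 3).div hqc.continuousOn fun x _ => (hq0 x).ne').mul hQu)
      fun x hx hxS => by simp [he1 x hx hxS]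
  have j3 : IntegrableOn (fun x => k * (6 * m x ^ 2 * radial p u x)) P.interior :=
    integrableOn_of_compact_support hΩ hS hSΩ
      (continuousOn_const.mul ((continuous_const.mul (hmc.pow 2)).continuousOn.mul hDc))
      fun x hx hxS => by simp [hm1 x hxS]
  have j4 : IntegrableOn (fun x => w x * radial p u x) P.interior := by
    have := hint.sub j3
    refine this.congr_fun (fun x hx => ?_) hΩ.measurableSet
    simp only [η, Pi.sub_apply]; ring
  have h4 : ∫ x in P.interior, η x * radial p u x =
      ∫ x in P.interior, (k * (m x ^ 3 * (hess u x).trace) + e x ^ 3 / q x * radialHess p u x) := by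
    rw [integral_add j1 j2, integral_const_mul, h2, h3, ← integral_const_mul,
      ← integral_add j3 j4]
    refine setIntegral_congr_fun hΩ.measurableSet fun x hx => ?_
    simp only [η]; ring
  rw [h4] at h1
  have hpt : ∀ x ∈ P.interior, k * (m x ^ 3 * (hess u x).trace) +
      e x ^ 3 / q x * radialHess p u x ≤ |C| * ((hess v x)⁻¹ * hess u x).trace := by
    intro x hx
    have p1 := radialHess_le (p := p) (hH x hx)
    have hVx := hv.posDef (hV x hx) hx
    have p2 := trace_le_trace_mul_trace_inv_mul hVx (hH x hx)
    have p3 := trace_inv_mul_nonneg hVx (hH x hx)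
    have p4 : 0 ≤ e x ^ 3 / q x := div_nonneg (pow_nonneg (he0 x) 3) (hq0 x).le
    have p5 : 0 ≤ k * m x ^ 3 + e x ^ 3 / q x * sqDist p x :=
      add_nonneg (mul_nonneg hk.le (pow_nonneg (hm0 x) 3)) (mul_nonneg p4 (sqDist_nonneg p x))
    calc _ ≤ k * (m x ^ 3 * (hess u x).trace) +
          e x ^ 3 / q x * ((hess u x).trace * sqDist p x) := by
          gcongr
      _ = (k * m x ^ 3 + e x ^ 3 / q x * sqDist p x) * (hess u x).trace := by ring
      _ ≤ (k * m x ^ 3 + e x ^ 3 / q x * sqDist p x) *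
          ((hess v x).trace * ((hess v x)⁻¹ * hess u x).trace) :=
          mul_le_mul_of_nonneg_left p2 p5
      _ = F x * ((hess v x)⁻¹ * hess u x).trace := by simp only [F]; ring
      _ ≤ _ := mul_le_mul_of_nonneg_right (hFC x hx) p3
  have hG0 : 0 ≤ᵐ[volume.restrict P.interior] fun x =>
      k * (m x ^ 3 * (hess u x).trace) + e x ^ 3 / q x * radialHess p u x := by
    filter_upwards [ae_restrict_mem hΩ.measurableSet] with x hx
    have p1 : 0 ≤ (hess u x).trace := (hH x hx).trace_nonneg
    have p2 : 0 ≤ radialHess p u x := quadratic_form_nonneg (hH x hx) fun i => x i - p i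
    have p4 : 0 ≤ e x ^ 3 / q x := div_nonneg (pow_nonneg (he0 x) 3) (hq0 x).le
    have p5 := pow_nonneg (hm0 x) 3
    exact add_nonneg (mul_nonneg hk.le (mul_nonneg p5 p1)) (mul_nonneg p4 p2)
  have h5 : ∫ x in P.interior, (k * (m x ^ 3 * (hess u x).trace) +
      e x ^ 3 / q x * radialHess p u x) ≤ |C| * L := by
    rw [integral_eq_lintegral_of_nonneg_ae hG0 (j1.add j2).aestronglyMeasurable]
    refine ENNReal.toReal_le_of_le_ofReal (by positivity) ?_
    calc _ ≤ ∫⁻ x in P.interior, ENNReal.ofReal |C| *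
          ENNReal.ofReal ((hess v x)⁻¹ * hess u x).trace := by
          refine setLIntegral_mono' hΩ.measurableSet fun x hx => ?_
          rw [← ENNReal.ofReal_mul (abs_nonneg C)]
          exact ENNReal.ofReal_le_ofReal (hpt x hx)
      _ = ENNReal.ofReal |C| * ∫⁻ x in P.interior,
          ENNReal.ofReal ((hess v x)⁻¹ * hess u x).trace :=
          lintegral_const_mul' _ _ ENNReal.ofReal_ne_top
      _ ≤ ENNReal.ofReal |C| * ENNReal.ofReal L := mul_le_mul_right htr _
      _ = _ := (ENNReal.ofReal_mul (abs_nonneg C)).symm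
  rw [div_mul_eq_mul_div, le_div_iff₀ hc]
  linarith

/-- Integrals over a thin shell along the boundary are controlled by the boundary norm. -/
theorem ClassCTilde.setIntegral_shell_le (hu : ClassCTilde P p u) (hn : n ≠ 0)
    (hp : p ∈ P.interior) {η : ℝ} (hη : η ∈ Ioo (0:ℝ) 1) :
    ∫ x in P.interior \ (fun x => p + (1 - η) • (x - p)) '' P.body, u x ≤
      η * (∑ k, P.delta k p) * normB P u := by
  have hΩ := P.isOpen_interior
  set K := (fun x : Vec n => p + (1 - η) • (x - p)) '' P.body
  have hK : IsCompact K := P.isCompact_body.image (by fun_prop)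
  have hO : IsOpen (P.interior \ K) := hΩ.sdiff hK.isClosed
  have hu0 : 0 ≤ᵐ[volume.restrict (P.interior \ K)] u := by
    filter_upwards [ae_restrict_mem hO.measurableSet] with x hx
    exact hu.2.2 x (P.interior_subset_body hx.1)
  have hui : IntegrableOn u (P.interior \ K) := (P.integrableOn_interior hu.1.1).mono_set sdiff_subset
  have hσ0 : 0 ≤ᵐ[P.sigma] u := by
    filter_upwards [P.ae_sigma_mem] with z hz using hu.2.2 z hz
  have hσi := P.integrable_sigma hp hu.1.1
  have hB0 : 0 ≤ normB P u := integral_nonneg_of_ae hσ0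
  have hΔ : 0 ≤ ∑ k, P.delta k p := Finset.sum_nonneg fun k _ => (hp k).le
  rw [integral_eq_lintegral_of_nonneg_ae hu0 hui.aestronglyMeasurable]
  refine ENNReal.toReal_le_of_le_ofReal (mul_nonneg (mul_nonneg hη.1.le hΔ) hB0) ?_
  set g := (P.interior \ K).indicator fun x => ENNReal.ofReal (u x)
  have hg : Measurable g := measurable_indicator_ofReal hO (hu.1.2.2.continuousOn.mono sdiff_subset)
  -- Only the parameters in (1 - η, 1) lie outside K, and there convexity with u(p) = 0 gives u ≤ s
  -- u(z) ≤ u(z).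
  have hray : ∀ k, ∀ z ∈ P.facetSet k, ∫⁻ s in Ioo (0:ℝ) 1, ENNReal.ofReal (s ^ (n - 1)) *
      g (p + s • (z - p)) ≤ ENNReal.ofReal η * ENNReal.ofReal (u z) := by
    intro k z hz
    have hle : ∀ s ∈ Ioo (0:ℝ) 1, ENNReal.ofReal (s ^ (n - 1)) * g (p + s • (z - p)) ≤
        (Ioo (1 - η) 1).indicator (fun _ => ENNReal.ofReal (u z)) s := by
      intro s hs
      by_cases hsη : s ≤ 1 - η
      · have hη' : 0 < 1 - η := by linarith [hη.2]
        have : p + s • (z - p) ∈ K := by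
          refine ⟨p + (s / (1 - η)) • (z - p), P.ray_mem_body hp hz.1 (div_nonneg hs.1.le hη'.le)
            ((div_le_one hη').2 hsη), ?_⟩
          simp only [add_sub_cancel_left, smul_smul]
          rw [mul_div_cancel₀ _ hη'.ne']
        have h0 : g (p + s • (z - p)) = 0 := indicator_of_notMem (fun h => h.2 this) _
        rw [h0, mul_zero]
        exact zero_le
      · have hs' : s ∈ Ioo (1 - η) 1 := ⟨not_le.1 hsη, hs.2⟩
        rw [indicator_of_mem hs']
        have hs1 : ENNReal.ofReal (s ^ (n - 1)) ≤ 1 := by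
          rw [← ENNReal.ofReal_one]
          exact ENNReal.ofReal_le_ofReal (pow_le_one₀ hs.1.le hs.2.le)
        refine (mul_le_of_le_one_left zero_le hs1).trans
          ((indicator_le_self _ _ _).trans (ENNReal.ofReal_le_ofReal ?_))
        exact (hu.ray_mul_le hp hz.1 hs.1.le hs.2.le).trans
          (mul_le_of_le_one_left (hu.2.2 z hz.1) hs.2.le)
    calc _ ≤ ∫⁻ s in Ioo (0:ℝ) 1, (Ioo (1 - η) 1).indicator (fun _ => ENNReal.ofReal (u z)) s :=
          setLIntegral_mono' measurableSet_Ioo hle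
      _ ≤ ∫⁻ s, (Ioo (1 - η) 1).indicator (fun _ => ENNReal.ofReal (u z)) s :=
          setLIntegral_le_lintegral _ _
      _ = _ := by
        rw [lintegral_indicator_const measurableSet_Ioo, Real.volume_Ioo, sub_sub_cancel, mul_comm]
  calc ∫⁻ x in P.interior \ K, ENNReal.ofReal (u x) = ∫⁻ x in P.interior, g x := by
        simp only [g]
        rw [lintegral_indicator hO.measurableSet, Measure.restrict_restrict hO.measurableSet,
          inter_eq_left.2 sdiff_subset]
    _ ≤ _ := P.setLIntegral_interior_le hn hp hg
    _ ≤ ∑ k, ENNReal.ofReal (η * ∑ k, P.delta k p) * ∫⁻ z, ENNReal.ofReal (u z) ∂P.sigmaFacet k := by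
        refine Finset.sum_le_sum fun k _ => ?_
        calc _ ≤ ENNReal.ofReal (P.delta k p) *
              ∫⁻ z, ENNReal.ofReal η * ENNReal.ofReal (u z) ∂P.sigmaFacet k := by
              refine mul_le_mul_right (lintegral_mono_ae ?_) _
              filter_upwards [P.ae_sigmaFacet_mem k] with z hz using hray k z hz
          _ = ENNReal.ofReal (P.delta k p * η) * ∫⁻ z, ENNReal.ofReal (u z) ∂P.sigmaFacet k := by
              rw [lintegral_const_mul' _ _ ENNReal.ofReal_ne_top, ← mul_assoc,
                ENNReal.ofReal_mul (hp k).le]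
          _ ≤ _ := by
              refine mul_le_mul_left (ENNReal.ofReal_le_ofReal ?_) _
              rw [mul_comm]
              exact mul_le_mul_of_nonneg_left
                (Finset.single_le_sum (fun k _ => (hp k).le) (Finset.mem_univ k)) hη.1.le
    _ = _ := by
        rw [← Finset.mul_sum, ENNReal.ofReal_mul (mul_nonneg hη.1.le hΔ), normB,
          ofReal_integral_eq_lintegral_ofReal hσi hσ0, P.sigma_eq_sum,
          lintegral_finsetSum_measure]

/-- The boundary norm and the integral of a normalized function are controlled by the linear
functional. -/
theorem ClassS.exists_normB_le (hv : ClassS P v) (hn : n ≠ 0)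
    (hp : p ∈ P.interior) (hsol : SolvesAbreu P A v) (hA : ContinuousOn A P.body)
    (hext : ∀ l : EuclideanSpace ℝ (Fin n) →ᵃ[ℝ] ℝ, functionalL P A l = 0) :
    ∃ C > 0, ∀ u, ClassCTilde P p u → normB P u ≤ C * functionalL P A u ∧
      ∫ x in P.interior, u x ≤ C * functionalL P A u := by
  have hΩ := P.isOpen_interior
  obtain ⟨M, hM, hMb⟩ := P.exists_bound_of_continuousOn hA
  set Δ := ∑ k, P.delta k p
  have hΔ : 0 ≤ Δ := Finset.sum_nonneg fun k _ => (hp k).le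
  -- A shell so thin that its contribution to the integral of Au is at most half of the boundary
  -- norm.
  set η := 1 / (2 * (M * Δ + 1))
  have hη : η ∈ Ioo (0:ℝ) 1 := by
    have : 0 < M * Δ + 1 := by positivity
    refine ⟨by positivity, ?_⟩
    rw [div_lt_one (by positivity)]
    nlinarith [mul_nonneg hM.le hΔ]
  have hηM : M * (η * Δ) ≤ 1 / 2 := by
    have : 0 < M * Δ + 1 := by positivity
    simp only [η]
    rw [show M * (1 / (2 * (M * Δ + 1)) * Δ) = M * Δ / (2 * (M * Δ + 1)) by ring,
      div_le_iff₀ (by positivity)]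
    linarith
  set K := (fun x : Vec n => p + (1 - η) • (x - p)) '' P.body
  have hK : IsCompact K := P.isCompact_body.image (by fun_prop)
  have hKΩ : K ⊆ P.interior := by
    rintro _ ⟨x, hx, rfl⟩
    exact P.ray_mem_interior hp hx (by linarith [hη.2]) (by linarith [hη.1])
  obtain ⟨C, hC, hCb⟩ := hv.exists_setIntegral_le hp (fun y hy => (hsol y hy).1) hK hKΩ
  refine ⟨2 * (1 + M * C) + (C + η * Δ * (2 * (1 + M * C))), by
    have := hη.1; positivity, fun u hu => ?_⟩
  obtain ⟨hL, htr⟩ := hu.lintegral_trace_le hn hp hv hsol hA hext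
  have h1 := hCb u hu _ hL htr
  have h2 := hu.setIntegral_shell_le hn hp hη
  have hui := P.integrableOn_interior hu.1.1
  have h3 : ∫ x in P.interior, u x = (∫ x in K, u x) + ∫ x in P.interior \ K, u x := by
    rw [← setIntegral_union disjoint_sdiff_right (hΩ.sdiff hK.isClosed).measurableSet
      (hui.mono_set hKΩ) (hui.mono_set sdiff_subset), union_sdiff_cancel hKΩ]
  have h4 : ∫ x in P.interior, A x * u x ≤ M * ∫ x in P.interior, u x := by
    rw [← integral_const_mul]
    refine setIntegral_mono_on (P.integrableOn_interior (hA.mul hu.1.1)) (hui.const_mul M)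
      hΩ.measurableSet fun x hx => ?_
    have hxb := P.interior_subset_body hx
    exact mul_le_mul_of_nonneg_right ((le_abs_self _).trans (hMb x hxb)) (hu.2.2 x hxb)
  have hσ0 : 0 ≤ᵐ[P.sigma] u := by
    filter_upwards [P.ae_sigma_mem] with z hz using hu.2.2 z hz
  have hB0 : 0 ≤ normB P u := integral_nonneg_of_ae hσ0
  have h5 : normB P u = functionalL P A u + ∫ x in P.interior, A x * u x := by
    simp only [normB, functionalL]; ring
  set L := functionalL P A u
  -- The boundary norm is L plus the integral of Au; the half of it coming from the shell is
  -- absorbed on the left.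
  have h6 : normB P u ≤ 2 * (1 + M * C) * L := by
    have e1 : M * ((C * L) + η * Δ * normB P u) ≤ M * C * L + 1 / 2 * normB P u := by
      have := mul_le_mul_of_nonneg_right hηM hB0
      nlinarith
    have e2 : M * ∫ x in P.interior, u x ≤ M * ((C * L) + η * Δ * normB P u) :=
      mul_le_mul_of_nonneg_left (by rw [h3]; exact add_le_add h1 h2) hM.le
    linarith
  have h7 : ∫ x in P.interior, u x ≤ (C + η * Δ * (2 * (1 + M * C))) * L := by
    have e3 : η * Δ * normB P u ≤ η * Δ * (2 * (1 + M * C) * L) :=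
      mul_le_mul_of_nonneg_left h6 (mul_nonneg hη.1.le hΔ)
    rw [h3]
    linarith
  have e4 : 0 ≤ 2 * (1 + M * C) * L := by positivity
  have e5 : 0 ≤ (C + η * Δ * (2 * (1 + M * C))) * L := by
    have := hη.1
    positivity
  constructor <;> linarith

end Coercive

/-! ### The entropy term and dimension zero -/

section Entropy

variable {n : ℕ} {P : OpenPolytope n} {p x z : Vec n} {v A U u : Vec n → ℝ}

theorem lintegral_neg_log_one_sub_lt_top :
    ∫⁻ s in Ioo (0:ℝ) 1, ENNReal.ofReal (-Real.log (1 - s)) < ⊤ := by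
  have h1 : IntervalIntegrable (fun s => -Real.log (1 - s)) volume 0 1 := by
    have := (intervalIntegral.intervalIntegrable_log' (a := 0) (b := 1)).comp_sub_left 1
    have := this.symm.neg
    rw [sub_self, sub_zero] at this
    exact this
  rw [intervalIntegrable_iff_integrableOn_Ioo_of_le zero_le_one] at h1
  exact h1.lintegral_lt_top

/-- On a ray δ_j ≥ (1 - s)δ_j(p), so in polar coordinates the integrand is dominated by -log(1 - s)
plus a constant. -/
theorem OpenPolytope.lintegral_neg_log_delta_lt_top (hn : n ≠ 0) (hp : p ∈ P.interior)
    (j : Fin P.N) : ∫⁻ x in P.interior, ENNReal.ofReal (-Real.log (P.delta j x)) < ⊤ := by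
  have := fun k => P.isFiniteMeasure_sigmaFacet hp k
  have hΩ := P.isOpen_interior
  set g := P.interior.indicator fun x => ENNReal.ofReal (-Real.log (P.delta j x))
  have hg : Measurable g :=
    measurable_indicator_ofReal hΩ (P.contDiffOn_log_delta j).continuousOn.neg
  set I := ∫⁻ s in Ioo (0:ℝ) 1, ENNReal.ofReal (-Real.log (1 - s))
  set d := ENNReal.ofReal (-Real.log (P.delta j p))
  have hray : ∀ k, ∀ z ∈ P.facetSet k, ∫⁻ s in Ioo (0:ℝ) 1, ENNReal.ofReal (s ^ (n - 1)) *
      g (p + s • (z - p)) ≤ I + d := by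
    intro k z hz
    calc _ ≤ ∫⁻ s in Ioo (0:ℝ) 1, (ENNReal.ofReal (-Real.log (1 - s)) + d) := by
          refine setLIntegral_mono' measurableSet_Ioo fun s hs => ?_
          have hx := P.ray_mem_interior hp hz.1 hs.1.le hs.2
          have hs1 : ENNReal.ofReal (s ^ (n - 1)) ≤ 1 := by
            rw [← ENNReal.ofReal_one]
            exact ENNReal.ofReal_le_ofReal (pow_le_one₀ hs.1.le hs.2.le)
          refine (mul_le_of_le_one_left zero_le hs1).trans ?_
          simp only [g, indicator_of_mem hx]
          refine le_trans (ENNReal.ofReal_le_ofReal ?_) ENNReal.ofReal_add_le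
          have h1 : 0 < 1 - s := by linarith [hs.2]
          rw [← neg_add, ← Real.log_mul h1.ne' (hp j).ne']
          refine neg_le_neg (Real.log_le_log (mul_pos h1 (hp j)) ?_)
          rw [P.delta_ray]
          linarith [mul_nonneg hs.1.le (P.delta_nonneg hz.1 j)]
      _ = _ := by
          rw [lintegral_add_right _ measurable_const, setLIntegral_const]
          simp [I]
  calc _ = ∫⁻ x in P.interior, g x :=
        setLIntegral_congr_fun hΩ.measurableSet fun x hx => by simp only [g, indicator_of_mem hx]
    _ ≤ _ := P.setLIntegral_interior_le hn hp hg
    _ ≤ ∑ k, ENNReal.ofReal (P.delta k p) * ∫⁻ _, (I + d) ∂P.sigmaFacet k := by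
        refine Finset.sum_le_sum fun k _ => mul_le_mul_right (lintegral_mono_ae ?_) _
        filter_upwards [P.ae_sigmaFacet_mem k] with z hz using hray k z hz
    _ < ⊤ := by
        refine ENNReal.sum_lt_top.2 fun k _ => ENNReal.mul_lt_top ENNReal.ofReal_lt_top ?_
        rw [lintegral_const]
        exact ENNReal.mul_lt_top (ENNReal.add_lt_top.2
          ⟨lintegral_neg_log_one_sub_lt_top, ENNReal.ofReal_lt_top⟩) (measure_lt_top _ _)

theorem logDet_toENNReal_le {y : ℝ} (h : (hess u x).det ≤ Real.exp y) :
    (logDet u x).toENNReal ≤ ENNReal.ofReal y := by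
  rcases le_or_gt (hess u x).det 0 with h0 | h0
  · simp [logDet, ENNReal.ofReal_eq_zero.2 h0]
  · rw [logDet, ENNReal.log_ofReal_of_pos h0, EReal.toENNReal_of_ne_top (EReal.coe_ne_top _),
      EReal.toReal_coe]
    exact ENNReal.ofReal_le_ofReal ((Real.log_le_iff_le_exp h0).2 h)

/-- The positive part of `log det` is controlled by the linear functional. -/
theorem ClassS.exists_lintegral_logDet_le (hv : ClassS P v) (hn : n ≠ 0)
    (hp : p ∈ P.interior) (hsol : SolvesAbreu P A v) (hA : ContinuousOn A P.body)
    (hext : ∀ l : EuclideanSpace ℝ (Fin n) →ᵃ[ℝ] ℝ, functionalL P A l = 0) :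
    ∃ C ≥ 0, ∀ u, ClassCTilde P p u → ∫⁻ x in P.interior, (logDet u x).toENNReal ≤
      ENNReal.ofReal (C + functionalL P A u / 2) := by
  have hΩ := P.isOpen_interior
  have hV : ∀ y ∈ P.interior, IsUnit (hess v y).det := fun y hy => (hsol y hy).1
  obtain ⟨C₀, hC₀, hdet⟩ := hv.exists_bound_det hp
  set c := n * Real.log 2 + Real.log C₀
  -- An upper bound, independent of u, for the integral of the positive part of n log 2 + log det V.
  set J : ℝ≥0∞ := ∫⁻ x in P.interior, (ENNReal.ofReal c +
    ∑ k, ENNReal.ofReal (-Real.log (P.delta k x)))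
  have hm : ∀ k, AEMeasurable (fun x => ENNReal.ofReal (-Real.log (P.delta k x)))
      (volume.restrict P.interior) := fun k =>
    (((P.contDiffOn_log_delta k).continuousOn.neg).aemeasurable hΩ.measurableSet).ennreal_ofReal
  have hJ : J < ⊤ := by
    simp only [J]
    rw [lintegral_add_left measurable_const, lintegral_finsetSum' _ fun k _ => hm k,
      setLIntegral_const]
    exact ENNReal.add_lt_top.2 ⟨ENNReal.mul_lt_top ENNReal.ofReal_lt_top P.volume_interior_lt_top,
      ENNReal.sum_lt_top.2 fun k _ => P.lintegral_neg_log_delta_lt_top hn hp k⟩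
  refine ⟨J.toReal, ENNReal.toReal_nonneg, fun u hu => ?_⟩
  obtain ⟨hL, htr⟩ := hu.lintegral_trace_le hn hp hv hsol hA hext
  have hpt : ∀ x ∈ P.interior, (logDet u x).toENNReal ≤ (ENNReal.ofReal c +
      ∑ k, ENNReal.ofReal (-Real.log (P.delta k x))) +
      ENNReal.ofReal (1 / 2) * ENNReal.ofReal ((hess v x)⁻¹ * hess u x).trace := by
    intro x hx
    have hVx := hv.posDef (hV x hx) hx
    have hH := hess_posSemidef_of_convexOn hΩ
      (hu.1.2.1.subset P.interior_subset_body P.convex_interior) hu.1.2.2 hx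
    have h1 := det_le_det_mul_exp hVx hH
    have hprod : 0 < ∏ k, P.delta k x := Finset.prod_pos fun k _ => hx k
    have h2 : (hess v x).det ≤ C₀ * (∏ k, P.delta k x)⁻¹ := by
      rw [← div_eq_mul_inv, le_div_iff₀ hprod]; exact hdet x hx
    set τ := ((hess v x)⁻¹ * hess u x).trace
    have h3 : (hess u x).det ≤ Real.exp (c + ∑ k, -Real.log (P.delta k x) + 1 / 2 * τ) := by
      have e1 : Real.exp c = 2 ^ n * C₀ := by
        simp only [c]
        rw [Real.exp_add, Real.exp_log hC₀, ← Real.log_pow, Real.exp_log (by positivity)]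
      have e2 : Real.exp (∑ k, -Real.log (P.delta k x)) = (∏ k, P.delta k x)⁻¹ := by
        rw [Finset.sum_neg_distrib, ← Real.log_prod fun k _ => (hx k).ne', Real.exp_neg,
          Real.exp_log hprod]
      rw [Real.exp_add, Real.exp_add, e1, e2, one_div_mul_eq_div]
      refine h1.trans (mul_le_mul_of_nonneg_right ?_ (Real.exp_pos _).le)
      rw [mul_assoc]
      exact mul_le_mul_of_nonneg_left h2 (by positivity)
    refine (logDet_toENNReal_le h3).trans ?_
    rw [← ENNReal.ofReal_mul (by norm_num : (0:ℝ) ≤ 1 / 2)]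
    refine ENNReal.ofReal_add_le.trans (add_le_add_left (ENNReal.ofReal_add_le.trans
      (add_le_add_right ?_ _)) _)
    induction (Finset.univ : Finset (Fin P.N)) using Finset.cons_induction with
    | empty => simp
    | cons k s hk ih =>
      rw [Finset.sum_cons, Finset.sum_cons]
      exact ENNReal.ofReal_add_le.trans (add_le_add_right ih _)
  calc _ ≤ ∫⁻ x in P.interior, ((ENNReal.ofReal c +
        ∑ k, ENNReal.ofReal (-Real.log (P.delta k x))) +
        ENNReal.ofReal (1 / 2) * ENNReal.ofReal ((hess v x)⁻¹ * hess u x).trace) :=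
        setLIntegral_mono' hΩ.measurableSet hpt
    _ = J + ENNReal.ofReal (1 / 2) *
        ∫⁻ x in P.interior, ENNReal.ofReal ((hess v x)⁻¹ * hess u x).trace := by
        have hm' : AEMeasurable (fun x => ENNReal.ofReal c +
            ∑ k, ENNReal.ofReal (-Real.log (P.delta k x))) (volume.restrict P.interior) :=
          aemeasurable_const.add (Finset.aemeasurable_fun_sum _ fun k _ => hm k)
        rw [lintegral_add_left' hm',
          lintegral_const_mul' _ _ ENNReal.ofReal_ne_top]
    _ ≤ ENNReal.ofReal J.toReal + ENNReal.ofReal (1 / 2) * ENNReal.ofReal (functionalL P A u) := by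
        rw [ENNReal.ofReal_toReal hJ.ne]
        exact add_le_add_right (mul_le_mul_right htr _) _
    _ = _ := by
        rw [← ENNReal.ofReal_mul (by norm_num), ← ENNReal.ofReal_add ENNReal.toReal_nonneg
          (by positivity), one_div_mul_eq_div]

/-- The Mabuchi functional dominates the linear functional on normalized functions. -/
theorem ClassS.exists_le_mabuchi (hv : ClassS P v) (hn : n ≠ 0)
    (hp : p ∈ P.interior) (hsol : SolvesAbreu P A v) (hA : ContinuousOn A P.body)
    (hext : ∀ l : EuclideanSpace ℝ (Fin n) →ᵃ[ℝ] ℝ, functionalL P A l = 0) :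
    ∃ C ≥ 0, ∀ u, ClassCTilde P p u →
      ((-C + functionalL P A u / 2 : ℝ) : EReal) ≤ mabuchi P A u := by
  obtain ⟨C, hC, h⟩ := hv.exists_lintegral_logDet_le hn hp hsol hA hext
  refine ⟨C, hC, fun u hu => ?_⟩
  have hL := (hu.lintegral_trace_le hn hp hv hsol hA hext).1
  have h1 : ((∫⁻ x in P.interior, (logDet u x).toENNReal : ℝ≥0∞) : EReal) ≤
      ((C + functionalL P A u / 2 : ℝ) : EReal) := by
    refine (EReal.coe_ennreal_le_coe_ennreal_iff.2 (h u hu)).trans ?_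
    rw [EReal.coe_ennreal_ofReal, max_eq_left (by positivity)]
  have h2 : ((-(C + functionalL P A u / 2) : ℝ) : EReal) ≤ entropy P u := by
    -- The integral of the positive part of -log det is only used to be nonnegative; it may be
    -- infinite.
    have := EReal.sub_le_sub (EReal.coe_ennreal_nonneg
      (∫⁻ x in P.interior, (-logDet u x).toENNReal)) h1
    rw [zero_sub] at this
    exact this
  calc ((-C + functionalL P A u / 2 : ℝ) : EReal) =
        ((-(C + functionalL P A u / 2) : ℝ) : EReal) + (functionalL P A u : EReal) := by
        rw [← EReal.coe_add]; congr 1; ring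
    _ ≤ _ := add_le_add_left h2 _

/-- Polar coordinates need n ≠ 0. In dimension zero there is a single point, no facet is possible,
normalized functions vanish, and the empty determinant is 1. -/
theorem mabuchi_eq_zero_of_dim_zero {P : OpenPolytope 0} {p : Vec 0} {A u : Vec 0 → ℝ}
    (hu : ClassCTilde P p u) :
    mabuchi P A u = 0 ∧ normB P u = 0 ∧ ∫ x in P.interior, u x = 0 := by
  have hu0 : ∀ x, u x = 0 := fun x => by rw [Subsingleton.elim x p]; exact hu.2.1
  have hN : IsEmpty (Fin P.N) := by
    refine ⟨fun k => ?_⟩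
    obtain ⟨x, hx, -⟩ := P.facet k
    obtain ⟨y, hy⟩ := P.nonempty
    rw [Subsingleton.elim x y] at hx
    exact (hy k).ne' hx
  have hσ : normB P u = 0 := by simp [normB, hu0]
  have hi : ∫ x in P.interior, u x = 0 := by simp [hu0]
  refine ⟨?_, hσ, hi⟩
  have hl : ∀ x, logDet u x = 0 := fun x => by simp [logDet]
  simp [mabuchi, entropy, functionalL, hl, hu0]

end Entropy

end ToricAbreu

theorem theorem4p8 {n : ℕ} (P : ToricAbreu.OpenPolytope n)
    (A : EuclideanSpace ℝ (Fin n) → ℝ) (hA : ContDiffOn ℝ ∞ A P.body)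
    (hext : ∀ l : EuclideanSpace ℝ (Fin n) →ᵃ[ℝ] ℝ, ToricAbreu.functionalL P A l = 0)
    (p : EuclideanSpace ℝ (Fin n)) (hp : p ∈ P.interior)
    (hsol : ∃ v, ToricAbreu.ClassS P v ∧ ToricAbreu.SolvesAbreu P A v) :
    (∃ ε > (0 : ℝ), ∃ C > (0 : ℝ), ∀ u, ToricAbreu.ClassCTilde P p u →
      ((-C + ε * ∫ x in P.interior, u x : ℝ) : EReal) ≤ ToricAbreu.mabuchi P A u) ∧
    (∃ ε' > (0 : ℝ), ∃ C > (0 : ℝ), ∀ u, ToricAbreu.ClassCTilde P p u →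
      ((-C + ε' * ToricAbreu.normB P u : ℝ) : EReal) ≤ ToricAbreu.mabuchi P A u) := by
  rcases eq_or_ne n 0 with rfl | hn
  · have h1 : ((-1 : ℝ) : EReal) ≤ 0 := by exact_mod_cast neg_one_lt_zero.le
    refine ⟨⟨1, one_pos, 1, one_pos, fun u hu => ?_⟩, ⟨1, one_pos, 1, one_pos, fun u hu => ?_⟩⟩ <;>
      obtain ⟨e1, e2, e3⟩ := ToricAbreu.mabuchi_eq_zero_of_dim_zero (A := A) hu
    · rw [e1, e3, mul_zero, add_zero]; exact h1
    · rw [e1, e2, mul_zero, add_zero]; exact h1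
  · obtain ⟨v, hv, hsol⟩ := hsol
    obtain ⟨C, hC, h⟩ := hv.exists_le_mabuchi hn hp hsol hA.continuousOn hext
    obtain ⟨C', hC', h'⟩ := hv.exists_normB_le hn hp hsol hA.continuousOn hext
    -- The witness 1/(2C') converts L/2 into y; C + 1 replaces C because the constant must be
    -- strictly positive.
    have key : ∀ y L : ℝ, y ≤ C' * L → -(C + 1) + 1 / (2 * C') * y ≤ -C + L / 2 := by
      intro y L hy
      have : 1 / (2 * C') * y ≤ 1 / (2 * C') * (C' * L) :=
        mul_le_mul_of_nonneg_left hy (by positivity)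
      have e : 1 / (2 * C') * (C' * L) = L / 2 := by field_simp
      linarith
    exact ⟨⟨1 / (2 * C'), by positivity, C + 1, by positivity, fun u hu =>
      (EReal.coe_le_coe_iff.2 (key _ _ (h' u hu).2)).trans (h u hu)⟩,
      ⟨1 / (2 * C'), by positivity, C + 1, by positivity, fun u hu =>
      (EReal.coe_le_coe_iff.2 (key _ _ (h' u hu).1)).trans (h u hu)⟩⟩
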